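/- Let $\mathbb M$ be a smooth connected manifold with a bracket generating distribution $\mathcal H$ of dimension $d$ and a smooth fiberwise inner product $g$ on $\mathcal H$. A smooth vector field $Z$ is a sub-Riemannian Killing field if $[Z,X]$ is horizontal for every horizontal field $X$ and $Z\,g(X,Y)=g([Z,X],Y)+g(X,[Z,Y])$ for all horizontal $X,Y$. Assume that $\mathbb M$ has transverse symmetries: there is a finite-dimensional Lie algebra $\mathcal V$ of sub-Riemannian Killing fields with $T_x\mathbb M=\mathcal H(x)\oplus\mathcal V(x)$ for every $x\in\mathbb M$, where $\mathcal V(x)=\{Z(x):Z\in\mathcal V\}$. Fix an inner product on $\mathcal V$ with orthonormal basis $Z_1,\dots,Z_{\mathfrak h}$, let $g_R$ be the Riemannian metric extending $g$ for which $\mathcal H(x)\perp\mathcal V(x)$ and $Z_1(x),\dots,Z_{\mathfrak h}(x)$ are orthonormal, and let $\mu$ be its Riemannian measure. Let $X_1,\dots,X_d$ denote a local orthonormal frame of $\mathcal H$ and put $$\nabla_{\mathcal H}f=\sum_i (X_if)X_i,\qquad Lf=\operatorname{div}_\mu(\nabla_{\mathcal H}f),\qquad \Gamma(f,u)=\tfrac12\{L(fu)-fLu-uLf\},\qquad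 \Gamma^Z(f,u)=\sum_m (Z_mf)(Z_mu),$$ $$\Gamma_2(f,u)=\tfrac12\{L\Gamma(f,u)-\Gamma(f,Lu)-\Gamma(u,Lf)\},\qquad \Gamma^Z_2(f,u)=\tfrac12\{L\Gamma^Z(f,u)-\Gamma^Z(f,Lu)-\Gamma^Z(u,Lf)\},$$ and $B(f)=B(f,f)$ for each of these forms. Let $\nabla$ be the canonical connection, i.e. the affine connection with $\nabla g=0$, $\nabla_XY$ horizontal, $\nabla Z=0$, $T(X,Y)$ vertical and $T(X,Z)=0$ for all horizontal $X,Y$ and $Z\in\mathcal V$, where $T$ is its torsion; let $\mathrm{Ric}$ be its Ricci tensor and put $$\mathcal R(f)=\mathrm{Ric}(\nabla_{\mathcal H}f,\nabla_{\mathcal H}f)+\sum_{l,k=1}^d\Big(-\big((\nabla_{X_l}T)(X_l,X_k)f\big)(X_kf)+\tfrac14\big(T(X_l,X_k)f\big)^2\Big),\qquad \mathcal T(f)=\sum_{i=1}^d\|T(X_i,\nabla_{\mathcal H}f)\|_{g_R}^2 .$$ Let $\rho_1\in\mathbb R$, $\rho_2>0$, $\kappa\ge0$. Then the generalized curvature-dimension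 inequality $\mathrm{CD}(\rho_1,\rho_2,\kappa,d)$, $$\Gamma_2(f)+\nu\,\Gamma_2^Z(f)\ \ge\ \tfrac1d (Lf)^2+\Big(\rho_1-\frac{\kappa}{\nu}\Big)\Gamma(f)+\rho_2\,\Gamma^Z(f)\qquad\text{for all } f\in C^\infty(\mathbb M),\ \nu>0,$$ holds on $\mathbb M$ if and only if, for every $f\in C^\infty(\mathbb M)$, $$\mathcal R(f)\ \ge\ \rho_1\Gamma(f)+\rho_2\Gamma^Z(f)\qquad\text{and}\qquad \mathcal T(f)\ \le\ \kappa\,\Gamma(f).$$ -/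

import Mathlib

open scoped Manifold ContDiff ENNReal Topology

noncomputable section

/-! ### Vector fields and functions on a smooth `n`-manifold -/

section Basics

variable (n : ℕ) (M : Type*) [TopologicalSpace M] [ChartedSpace (EuclideanSpace ℝ (Fin n)) M]

/-- A (not necessarily smooth) vector field on `M`. -/
abbrev VField : Type _ := (x : M) → TangentSpace (𝓡 n) x

variable {n M} [IsManifold (𝓡 n) ∞ M]

/-- The vector field `X` is smooth on the set `U`. -/
def VField.SmoothOn (X : VField n M) (U : Set M) : Prop :=
  ContMDiffOn (𝓡 n) (𝓡 n).tangent ∞ (fun x => (⟨x, X x⟩ : TangentBundle (𝓡 n) M)) U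

/-- The derivative `X f` of the function `f` along the vector field `X`. -/
def VField.der (X : VField n M) (f : M → ℝ) (x : M) : ℝ :=
  mvfderiv (𝓡 n) f x (X x)

/-- The Lie bracket `[X, Y]`. -/
abbrev VField.bracket (X Y : VField n M) : VField n M :=
  VectorField.mlieBracket (𝓡 n) X Y

variable (n) in
/-- `f ∈ C^∞(M)`. -/
def SmoothFun (f : M → ℝ) : Prop := ContMDiff (𝓡 n) 𝓘(ℝ, ℝ) ∞ f

end Basics

/-! ### The generalized curvature-dimension inequality -/

section CurvatureDimension

variable {M : Type*}

/-- The carré du champ `Γ(f,g) = ½ (L(fg) - f Lg - g Lf)` of an operator `L`. -/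
def carreDuChamp (L : (M → ℝ) → M → ℝ) (f g : M → ℝ) (x : M) : ℝ :=
  (1 / 2) * (L (fun y => f y * g y) x - f x * L g x - g x * L f x)

/-- The iterated form `½ (L B(f,g) - B(f, Lg) - B(g, Lf))` of a bilinear form `B`: this is `Γ₂` for
`B = Γ` and `Γ₂^Z` for `B = Γ^Z`. -/
def iteratedForm (L : (M → ℝ) → M → ℝ) (B : (M → ℝ) → (M → ℝ) → M → ℝ)
    (f g : M → ℝ) (x : M) : ℝ :=
  (1 / 2) * (L (B f g) x - B f (L g) x - B g (L f) x)

/-- The generalized curvature-dimension inequality `CD(ρ₁, ρ₂, κ, d)` with respect to `L` and `Γ^Z`;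
`1 / d = 0` for `d = ∞`. -/
def GeneralizedCD (n : ℕ) [TopologicalSpace M] [ChartedSpace (EuclideanSpace ℝ (Fin n)) M]
    (L : (M → ℝ) → M → ℝ) (ΓZ : (M → ℝ) → (M → ℝ) → M → ℝ) (ρ₁ ρ₂ κ : ℝ) (d : ℝ≥0∞) : Prop :=
  ∀ f : M → ℝ, SmoothFun n f → ∀ ν : ℝ, 0 < ν → ∀ x : M,
    iteratedForm L (carreDuChamp L) f f x + ν * iteratedForm L ΓZ f f x ≥
      (d⁻¹).toReal * (L f x) ^ 2 + (ρ₁ - κ / ν) * carreDuChamp L f f x + ρ₂ * ΓZ f f x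

end CurvatureDimension

/-! ### Sub-Riemannian structures and transverse symmetries -/

section SubRiemannian

variable {n d : ℕ} {M : Type*} [TopologicalSpace M] [ChartedSpace (EuclideanSpace ℝ (Fin n)) M]
  [IsManifold (𝓡 n) ∞ M]

/-- The vector fields obtained from smooth horizontal fields by iterated Lie brackets. -/
inductive IterBracket (Hor : ∀ x : M, Submodule ℝ (TangentSpace (𝓡 n) x)) : VField n M → Prop
  | horizontal (X : VField n M) (hX : X.SmoothOn Set.univ) (hH : ∀ x, X x ∈ Hor x) :
      IterBracket Hor X
  | bracket (X Y : VField n M) (hX : IterBracket Hor X) (hY : IterBracket Hor Y) :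
      IterBracket Hor (X.bracket Y)

/-- `X` is a smooth local frame of the distribution `Hor`, orthonormal for `g`, on the set `U`. -/
structure IsOrthonormalFrameOn (Hor : ∀ x : M, Submodule ℝ (TangentSpace (𝓡 n) x))
    (g : ∀ x : M, TangentSpace (𝓡 n) x →ₗ[ℝ] TangentSpace (𝓡 n) x →ₗ[ℝ] ℝ)
    (X : Fin d → VField n M) (U : Set M) : Prop where
  smooth : ∀ i, (X i).SmoothOn U
  span_eq : ∀ y ∈ U, Submodule.span ℝ (Set.range fun i => X i y) = Hor y
  orthonormal : ∀ y ∈ U, ∀ i j, g y (X i y) (X j y) = if i = j then 1 else 0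

variable (n d M) in
/-- A sub-Riemannian structure `(H, g)` on the `n`-manifold `M`: a bracket generating distribution
of dimension `d` with a fiberwise inner product. Only the restriction of `g x` to `Hor x` matters;
smoothness of `H` and `g` is the existence of smooth local orthonormal frames. -/
structure SubRiemannianStructure where
  Hor : ∀ x : M, Submodule ℝ (TangentSpace (𝓡 n) x)
  g : ∀ x : M, TangentSpace (𝓡 n) x →ₗ[ℝ] TangentSpace (𝓡 n) x →ₗ[ℝ] ℝ
  g_symm : ∀ x, ∀ u ∈ Hor x, ∀ v ∈ Hor x, g x u v = g x v u
  g_pos : ∀ x, ∀ u ∈ Hor x, u ≠ 0 → 0 < g x u u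
  exists_frame : ∀ x : M, ∃ X : Fin d → VField n M, ∃ U : Set M,
    IsOpen U ∧ x ∈ U ∧ IsOrthonormalFrameOn Hor g X U
  bracket_generating : ∀ x : M,
    Submodule.span ℝ {v : TangentSpace (𝓡 n) x | ∃ Y : VField n M, IterBracket Hor Y ∧ Y x = v} = ⊤

/-- `Z` is a sub-Riemannian Killing vector field: it preserves horizontal fields and
`(𝓛_Z g)(X, Y) = Z g(X, Y) - g([Z, X], Y) - g(X, [Z, Y]) = 0` for horizontal `X`, `Y`. -/
structure SubRiemannianStructure.IsKilling (S : SubRiemannianStructure n d M) (Z : VField n M) :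
    Prop where
  smooth : Z.SmoothOn Set.univ
  bracket_mem : ∀ (U : Set M) (X : VField n M), IsOpen U → X.SmoothOn U →
    (∀ y ∈ U, X y ∈ S.Hor y) → ∀ x ∈ U, Z.bracket X x ∈ S.Hor x
  lie_metric : ∀ (U : Set M) (X Y : VField n M), IsOpen U → X.SmoothOn U → Y.SmoothOn U →
    (∀ y ∈ U, X y ∈ S.Hor y) → (∀ y ∈ U, Y y ∈ S.Hor y) → ∀ x ∈ U,
      Z.der (fun y => S.g y (X y) (Y y)) x
        = S.g x (Z.bracket X x) (Y x) + S.g x (X x) (Z.bracket Y x)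

variable (n d M) in
/-- A sub-Riemannian structure with transverse symmetries: a Lie algebra `V` of Killing fields with
`T_x M = H(x) ⊕ V(x)` for all `x`. The inner product on `V` is given through one of its
orthonormal bases `Z₁, …, Z_h`; every basis is orthonormal for exactly one inner product. -/
structure TransverseSymmetries (h : ℕ) extends SubRiemannianStructure n d M where
  V : Submodule ℝ (VField n M)
  killing : ∀ Z ∈ V, toSubRiemannianStructure.IsKilling Z
  bracket_mem : ∀ Z ∈ V, ∀ W ∈ V, VField.bracket Z W ∈ V
  isCompl : ∀ x : M, IsCompl (Hor x) (V.map (LinearMap.proj x))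
  Zbasis : Module.Basis (Fin h) ℝ V

namespace TransverseSymmetries

variable {h : ℕ} (S : TransverseSymmetries n d M h)

/-- A local orthonormal horizontal frame `X₁, …, X_d` near `x`. The tensors and traces below do
not depend on the frame that is chosen. -/
def frame (x : M) : Fin d → VField n M := (S.exists_frame x).choose

/-- The orthonormal basis `Z₁, …, Z_h` of `V`, as vector fields. -/
def Z (m : Fin h) : VField n M := (S.Zbasis m : VField n M)

/-- The projection of `T_x M` onto `H(x)` along `V(x)`. -/
def projH (x : M) (v : TangentSpace (𝓡 n) x) : TangentSpace (𝓡 n) x :=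
  (Submodule.projectionOnto (S.Hor x) (S.V.map (LinearMap.proj x)) (S.isCompl x) v :
    S.Hor x)

/-- Evaluation `V → T_x M` of the Lie algebra `V` at `x`. -/
def evalV (x : M) : S.V →ₗ[ℝ] TangentSpace (𝓡 n) x := LinearMap.proj x ∘ₗ S.V.subtype

/-- The coordinates `c_m(v)` of the vertical part of `v`: `v = projH x v + ∑ₘ c_m(v) Z_m(x)`.
Evaluation `V → V(x)` is automatically injective. -/
def vertCoord (x : M) (v : TangentSpace (𝓡 n) x) (m : Fin h) : ℝ :=
  S.Zbasis.repr ((S.evalV x).leftInverse (v - S.projH x v)) m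

/-- The Riemannian extension `g_R` of `g`, for which `H(x) ⊕ V(x)` is orthogonal and the
`Z_m(x)` are orthonormal. -/
def gR (x : M) (u v : TangentSpace (𝓡 n) x) : ℝ :=
  S.g x (S.projH x u) (S.projH x v) + ∑ m, S.vertCoord x u m * S.vertCoord x v m

/-- The horizontal gradient `∇_H f = ∑ᵢ (X_i f) X_i`. -/
def gradH (f : M → ℝ) : VField n M := fun x =>
  ∑ i, (S.frame x i).der f x • S.frame x i x

/-- The density `√det (g_R(∂_i, ∂_j))` of the Riemannian measure `μ` of `g_R`, in the chart
at `x₀`. -/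
def chartDensity (x₀ : M) (y : EuclideanSpace ℝ (Fin n)) : ℝ :=
  let φ := extChartAt (𝓡 n) x₀
  let e : Fin n → TangentSpace (𝓡 n) (φ.symm y) := fun i =>
    mfderiv 𝓘(ℝ, EuclideanSpace ℝ (Fin n)) (𝓡 n) φ.symm y (EuclideanSpace.single i (1 : ℝ))
  Real.sqrt (Matrix.det (Matrix.of fun i j : Fin n => S.gR (φ.symm y) (e i) (e j)))

/-- The components of the vector field `X` in the chart at `x₀`. -/
def chartComponent (x₀ : M) (X : VField n M) (i : Fin n) (y : EuclideanSpace ℝ (Fin n)) : ℝ :=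
  (show EuclideanSpace ℝ (Fin n) from
    VectorField.mpullback 𝓘(ℝ, EuclideanSpace ℝ (Fin n)) (𝓡 n) (extChartAt (𝓡 n) x₀).symm X y) i

/-- The divergence `ρ⁻¹ ∑ᵢ ∂_i (ρ X^i)` of `X` with respect to `μ`, where `ρ` is the density of
`μ`, computed at `x` in the chart at `x`. -/
def divergence (X : VField n M) (x : M) : ℝ :=
  let φ := extChartAt (𝓡 n) x
  (S.chartDensity x (φ x))⁻¹ * ∑ i : Fin n,
    fderiv ℝ (fun y => S.chartDensity x y * chartComponent x X i y) (φ x)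
      (EuclideanSpace.single i (1 : ℝ))

/-- The sub-Laplacian `L f = div_μ (∇_H f)`, that is `L = -∑ᵢ X_i^* X_i` with adjoints
in `L²(μ)`. -/
def subLaplacian (f : M → ℝ) (x : M) : ℝ := S.divergence (S.gradH f) x

/-- `Γ(f, g)`. -/
def Γ (f g : M → ℝ) (x : M) : ℝ := carreDuChamp S.subLaplacian f g x

/-- `Γ^Z(f, g) = ∑ₘ (Z_m f) (Z_m g)`. -/
def ΓZ (f g : M → ℝ) (x : M) : ℝ := ∑ m, (S.Z m).der f x * (S.Z m).der g x

/-! #### The canonical connection -/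

/-- The horizontal part of a vector field. -/
def horPart (X : VField n M) : VField n M := fun x => S.projH x (X x)

/-- `g(X, Y)`, for the horizontal parts of `X` and `Y`. -/
def gH (X Y : VField n M) (x : M) : ℝ := S.g x (S.projH x (X x)) (S.projH x (Y x))

/-- Koszul's expression, equal to `g(∇_X Y, W)` for horizontal `X`, `Y`, `W`. -/
def koszul (X Y W : VField n M) (x : M) : ℝ :=
  (1 / 2) * (X.der (S.gH Y W) x + Y.der (S.gH X W) x - W.der (S.gH X Y) x
    + S.gH (X.bracket Y) W x - S.gH (X.bracket W) Y x - S.gH (Y.bracket W) X x)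

/-- The canonical connection `∇_X Y`. It is the affine connection such that `∇ g = 0`, `∇_X Y` is
horizontal for horizontal `X`, `Y`, `∇ Z = 0` for `Z ∈ V`, and the torsion satisfies
`T(X, Y) ∈ V(x)` and `T(X, Z) = 0` for horizontal `X`, `Y` and `Z ∈ V`. Hence `∇_X Y` is given by
Koszul's formula for horizontal `X`, `Y`, by `∇_Z Y = [Z, Y]` for `Z ∈ V` and horizontal `Y`, and by
`∇_X (∑ₘ y_m Z_m) = ∑ₘ (X y_m) Z_m`. -/
def nabla (X Y : VField n M) : VField n M := fun x =>
  (∑ k, S.koszul (S.horPart X) (S.horPart Y) (S.frame x k) x • S.frame x k x)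
  + (∑ m, S.vertCoord x (X x) m • (S.Z m).bracket (S.horPart Y) x)
  + ∑ m, X.der (fun y => S.vertCoord y (Y y) m) x • S.Z m x

/-- The torsion `T(X, Y) = ∇_X Y - ∇_Y X - [X, Y]`. -/
def torsion (X Y : VField n M) : VField n M :=
  S.nabla X Y - S.nabla Y X - X.bracket Y

/-- The covariant derivative `(∇_X T)(Y, W)` of the torsion. -/
def nablaTorsion (X Y W : VField n M) : VField n M :=
  S.nabla X (S.torsion Y W) - S.torsion (S.nabla X Y) W - S.torsion Y (S.nabla X W)

/-- The curvature `R(X, Y) W = ∇_X ∇_Y W - ∇_Y ∇_X W - ∇_{[X, Y]} W`. -/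
def curvature (X Y W : VField n M) : VField n M :=
  S.nabla X (S.nabla Y W) - S.nabla Y (S.nabla X W) - S.nabla (X.bracket Y) W

/-- The Ricci tensor `Ric(U, W) = tr (Y ↦ R(Y, U) W)` of `∇`, the trace being computed in the
frame `X₁, …, X_d, Z₁, …, Z_h`. -/
def Ric (U W : VField n M) (x : M) : ℝ :=
  (∑ i, S.gR x (S.curvature (S.frame x i) U W x) (S.frame x i x))
  + ∑ m, S.gR x (S.curvature (S.Z m) U W x) (S.Z m x)

/-- `𝓡(f) = Ric(∇_H f, ∇_H f) + ∑_{l,k} (-((∇_{X_l} T)(X_l, X_k) f) (X_k f) + ¼ (T(X_l, X_k) f)²)`.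
-/
def ricciForm (f : M → ℝ) (x : M) : ℝ :=
  S.Ric (S.gradH f) (S.gradH f) x
  + ∑ l, ∑ k,
      (-((S.nablaTorsion (S.frame x l) (S.frame x l) (S.frame x k)).der f x
          * (S.frame x k).der f x)
        + (1 / 4) * ((S.torsion (S.frame x l) (S.frame x k)).der f x) ^ 2)

/-- `𝓣(f) = ∑ᵢ ‖T(X_i, ∇_H f)‖²`. -/
def torsionForm (f : M → ℝ) (x : M) : ℝ :=
  ∑ i, S.gR x (S.torsion (S.frame x i) (S.gradH f) x) (S.torsion (S.frame x i) (S.gradH f) x)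

end TransverseSymmetries

end SubRiemannian

end

/-! The statement is pointwise and rests on a Bochner formula. Near a point, complete a horizontal
orthonormal frame X_i by the vertical fields Z_m. Let H be the symmetrised horizontal Hessian of f,
q the array X_i Z_m f, and c_im the Z_m-component of the vertical part of [X_i, ∇_H f], which is
that of -T(X_i, ∇_H f). Then Lf = tr H, 𝓣(f) = |c|², Γ₂(f) = 𝓡(f) + |H|² + 2⟨c, q⟩, Γ₂^Z(f) = |q|².
The formula for Γ₂ is `bochner` combined with `sum_hess_sq`. The term 2⟨c, q⟩ arises because the
torsion makes the Hessian non-symmetric. The formula for Γ₂^Z holds because the Z_m are Killing and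
therefore commute with L (`lap_Z`, `bochner_vertical`).

Sufficiency is then two elementary bounds: |H|² ≥ (tr H)²/d by Cauchy-Schwarz, and 2⟨c, q⟩ + ν|q|² ≥
-|c|²/ν by completing the square.

For necessity, 𝓡, 𝓣, Γ and Γ^Z at a point see only the first derivatives of f there, while H and q
can be prescribed freely by adding a function with vanishing first derivatives
(`exists_second_jet`). Taking H = 0 and q = -c/ν turns the curvature-dimension inequality into (𝓡 -
ρ₁Γ - ρ₂Γ^Z) + (κΓ - 𝓣)/ν ≥ 0 for all ν > 0. Letting ν → ∞ and ν → 0 separates the two conditions.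
That 𝓡 is of first order is the tensoriality of the curvature (`curv_eq_sum`).

The Bochner computation is carried out in an abstract commutative algebra with derivations. The
manifold enters through `calculus`, which realises this algebra on an open set, and through two
identifications: the canonical connection (`IsComb.nabla`) and the divergence
(`IsComb.divergence_eq`) have their expected frame expressions. Vertical coordinates make sense
because evaluation of V at a point is injective (`ker_evalV`), a consequence of connectedness and
bracket generation. -/

noncomputable section

/-! ### Calculus in an adapted frame -/

/-- Derivations `X i` (horizontal) and `Z m` (vertical) of a commutative algebra, with structure
functions `[X i, X j] = ∑ c i j k • X k + ∑ γ i j m • Z m`, `[Z m, X i] = ∑ δ m i k • X k` and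
`[Z m, Z l] = ∑ e m l q • Z q`. -/
structure FrameCalculus (A ι κ : Type*) [CommRing A] [Algebra ℝ A] [Fintype ι] [Fintype κ] where
  X : ι → Derivation ℝ A A
  Z : κ → Derivation ℝ A A
  c : ι → ι → ι → A
  γ : ι → ι → κ → A
  δ : κ → ι → ι → A
  e : κ → κ → κ → A
  c_swap : ∀ i j k, c j i k = -c i j k
  γ_swap : ∀ i j m, γ j i m = -γ i j m
  δ_swap : ∀ m i k, δ m k i = -δ m i k
  comm_XX : ∀ i j f, X i (X j f) - X j (X i f) = ∑ k, c i j k * X k f + ∑ m, γ i j m * Z m f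
  comm_ZX : ∀ m i f, Z m (X i f) - X i (Z m f) = ∑ k, δ m i k * X k f
  comm_ZZ : ∀ m l f, Z m (Z l f) - Z l (Z m f) = ∑ q, e m l q * Z q f

namespace FrameCalculus

variable {A ι κ : Type*} [CommRing A] [Algebra ℝ A] [Fintype ι] [Fintype κ]
  (C : FrameCalculus A ι κ)

/-- Connection coefficients `g(∇_{X i} X j, X k)`. -/
def G (i j k : ι) : A := (1 / 2 : ℝ) • (C.c i j k - C.c i k j - C.c j k i)

/-- The divergences of the fields `X k`. -/
def b (k : ι) : A := ∑ i, C.c i k i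

/-- The divergence of `∑ u i • X i`. -/
def div (u : ι → A) : A := ∑ i, (C.X i (u i) + C.b i * u i)

/-- The sub-Laplacian. -/
def lap (f : A) : A := C.div fun i => C.X i f

/-- The horizontal Hessian `X i (X j f) - (∇_{X i} X j) f`. -/
def hess (f : A) (i j : ι) : A := C.X i (C.X j f) + ∑ l, C.G i l j * C.X l f

/-- The action on `f` of the vertical part of `[X i, X j]`. -/
def γZ (f : A) (i j : ι) : A := ∑ m, C.γ i j m * C.Z m f

/-- The components of `∇_V (∑ w i • X i)` for `V = ∑ a i • X i + ∑ α m • Z m`. -/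
def cov (a : ι → A) (α : κ → A) (w : ι → A) (k : ι) : A :=
  (∑ i, a i * C.X i (w k) + ∑ m, α m * C.Z m (w k))
    + (∑ i, ∑ l, a i * w l * C.G i l k + ∑ m, ∑ l, α m * w l * C.δ m l k)

/-- The horizontal components of `[∑ a i • X i, ∑ w i • X i]`. -/
def brH (a w : ι → A) (k : ι) : A :=
  (∑ i, a i * C.X i (w k) - ∑ i, w i * C.X i (a k)) + ∑ i, ∑ j, a i * w j * C.c i j k

/-- The vertical components of `[∑ a i • X i, ∑ w i • X i]`. -/
def brV (a w : ι → A) (m : κ) : A := ∑ i, ∑ j, a i * w j * C.γ i j m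

/-- The components of the curvature `R(a, w) u` on horizontal fields. -/
def curv (a w u : ι → A) (k : ι) : A :=
  C.cov a 0 (C.cov w 0 u) k - C.cov w 0 (C.cov a 0 u) k - C.cov (C.brH a w) (C.brV a w) u k

/-- The components of `(∇_{X l} [·, ·]^V)(X l, X k)`, where `[·, ·]^V` is the vertical part of the
bracket. -/
def nablaγ (l k : ι) (m : κ) : A :=
  C.X l (C.γ l k m) - ∑ i, C.G l l i * C.γ i k m - ∑ j, C.G l k j * C.γ l j m

theorem two_smul_half (a : A) : (2 : A) * ((1 / 2 : ℝ) • a) = a := by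
  rw [mul_smul_comm, two_mul, ← two_smul ℝ a, smul_smul]; norm_num

/-- The factor 2 is cancellable because A is an ℝ-algebra. Identities involving the scalar ½ are
proved after doubling, where only ring operations remain. -/
theorem eq_of_two_mul {a b : A} (h : 2 * a = 2 * b) : a = b := by
  have := congrArg (fun t => (1 / 2 : ℝ) • t) h
  simpa only [← mul_smul_comm, two_smul_half] using this

/-- Metric compatibility of the connection, read in an orthonormal frame. -/
theorem G_swap (i j k : ι) : C.G i k j = -C.G i j k := by
  have := C.c_swap j k i
  apply eq_of_two_mul
  rw [mul_neg, G, G, two_smul_half, two_smul_half]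
  linear_combination -this

/-- The torsion of two horizontal fields has no horizontal part. -/
theorem G_sub (i j k : ι) : C.G i j k - C.G j i k = C.c i j k := by
  have := C.c_swap i j k
  apply eq_of_two_mul
  rw [mul_sub, G, G, two_smul_half, two_smul_half]
  linear_combination -this

theorem G_self (i j : ι) : C.G i j j = 0 := by
  apply eq_of_two_mul
  have := C.G_swap i j j
  linear_combination this

theorem b_eq (k : ι) : C.b k = ∑ i, C.G i k i :=
  Finset.sum_congr rfl fun i _ => by rw [← C.G_sub, C.G_self, sub_zero]

theorem lap_eq_sum_hess (f : A) : C.lap f = ∑ i, C.hess f i i := by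
  simp only [lap, div, hess, Finset.sum_add_distrib, b_eq, Finset.sum_mul]
  rw [Finset.sum_comm]

/-- The connection terms absorb the horizontal part of [X i, X j] by `G_sub`, so only the vertical
part of the bracket survives. This is the source of every torsion term below. -/
theorem hess_sub (f : A) (i j : ι) : C.hess f i j - C.hess f j i = C.γZ f i j := by
  have h := C.comm_XX i j f
  have h2 : ∑ l, C.G i l j * C.X l f - ∑ l, C.G j l i * C.X l f
      = -∑ k, C.c i j k * C.X k f := by
    rw [← Finset.sum_sub_distrib, ← Finset.sum_neg_distrib]
    refine Finset.sum_congr rfl fun l _ => ?_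
    rw [← C.G_sub, C.G_swap i j l, C.G_swap j i l]; ring
  simp only [hess, γZ]
  linear_combination h + h2

theorem lap_mul (f g : A) :
    C.lap (f * g) = f * C.lap g + g * C.lap f + 2 * ∑ i, C.X i f * C.X i g := by
  simp only [lap, div, Finset.mul_sum, ← Finset.sum_add_distrib]
  refine Finset.sum_congr rfl fun i _ => ?_
  simp only [Derivation.leibniz, smul_eq_mul, map_add]
  ring

theorem lap_sum {σ : Type*} (s : Finset σ) (f : σ → A) :
    C.lap (∑ a ∈ s, f a) = ∑ a ∈ s, C.lap (f a) := by
  simp only [lap, div, map_sum, Finset.mul_sum, ← Finset.sum_add_distrib]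
  rw [Finset.sum_comm]

theorem div_add (u v : ι → A) : C.div (u + v) = C.div u + C.div v := by
  simp only [div, ← Finset.sum_add_distrib]
  refine Finset.sum_congr rfl fun i _ => ?_
  simp only [Pi.add_apply, map_add]; ring

theorem div_two_mul (u : ι → A) : C.div (fun i => 2 * u i) = 2 * C.div u := by
  simp only [div, Finset.mul_sum]
  refine Finset.sum_congr rfl fun i _ => ?_
  rw [two_mul, map_add]; ring

/-- `½ X i |∇f|² = ∑ j, (X j f) (hess f i j)`. -/
theorem sum_hess_mul (f : A) (i : ι) :
    ∑ j, C.X j f * C.hess f i j = ∑ j, C.X j f * C.X i (C.X j f) := by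
  have h0 : ∑ j, ∑ l, C.X j f * (C.G i l j * C.X l f) = 0 := by
    have h1 : ∑ j, ∑ l, C.X j f * (C.G i l j * C.X l f)
        = -∑ j, ∑ l, C.X j f * (C.G i l j * C.X l f) := by
      conv_lhs => rw [Finset.sum_comm]
      rw [← Finset.sum_neg_distrib]
      refine Finset.sum_congr rfl fun j _ => ?_
      rw [← Finset.sum_neg_distrib]
      refine Finset.sum_congr rfl fun l _ => ?_
      rw [C.G_swap i l j]; ring
    apply eq_of_two_mul
    linear_combination h1
  simp only [hess, mul_add, Finset.sum_add_distrib, Finset.mul_sum, h0, add_zero]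

theorem lap_gradSq (f : A) :
    C.lap (∑ j, C.X j f * C.X j f)
      = 2 * C.div fun i => ∑ j, C.X j f * C.hess f i j := by
  rw [← div_two_mul, lap]
  congr 1
  funext i
  rw [sum_hess_mul, map_sum, Finset.mul_sum]
  refine Finset.sum_congr rfl fun j _ => ?_
  simp only [Derivation.leibniz, smul_eq_mul]; ring

theorem cov_eq_mul (f : A) (a : ι → A) (k : ι) :
    C.cov a 0 (fun i => C.X i f) k = ∑ i, a i * C.hess f i k := by
  simp only [cov, hess, Pi.zero_apply, zero_mul, Finset.sum_const_zero, add_zero, mul_add,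
    Finset.sum_add_distrib, Finset.mul_sum]
  congr 1
  refine Finset.sum_congr rfl fun i _ => Finset.sum_congr rfl fun l _ => ?_
  ring

/-- Along Z m the connection acts on horizontal fields by the Lie bracket. Since Z m preserves the
metric (`δ_swap`), it therefore sends the gradient of f to the gradient of Z m f. -/
theorem cov_vertical (f : A) (α : κ → A) (a : ι → A) (k : ι) :
    C.cov a α (fun i => C.X i f) k
      = ∑ i, a i * C.hess f i k + ∑ m, α m * C.X k (C.Z m f) := by
  have h : C.cov a α (fun i => C.X i f) k = C.cov a 0 (fun i => C.X i f) k
      + ∑ m, α m * (C.Z m (C.X k f) + ∑ l, C.X l f * C.δ m l k) := by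
    simp only [cov, Pi.zero_apply, zero_mul, Finset.sum_const_zero, add_zero, mul_add,
      Finset.sum_add_distrib, Finset.mul_sum, mul_assoc]
    ring
  rw [h, cov_eq_mul]
  congr 1
  refine Finset.sum_congr rfl fun m _ => ?_
  congr 1
  have h1 : ∑ l, C.X l f * C.δ m l k = -∑ l, C.δ m k l * C.X l f := by
    rw [← Finset.sum_neg_distrib]
    refine Finset.sum_congr rfl fun l _ => ?_
    rw [C.δ_swap m k l]; ring
  rw [h1]
  linear_combination C.comm_ZX m k f

theorem cov_single [DecidableEq ι] (v : ι → A) (i k : ι) :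
    C.cov (Pi.single i 1) 0 v k = C.X i (v k) + ∑ l, C.G i l k * v l := by
  have h : ∑ i', ∑ l, (Pi.single i 1 : ι → A) i' * v l * C.G i' l k
      = ∑ l, C.G i l k * v l := by
    rw [Finset.sum_comm]
    refine Finset.sum_congr rfl fun l _ => ?_
    simp [Pi.single_apply, mul_comm]
  simp only [cov, h, Pi.zero_apply, zero_mul, Finset.sum_const_zero, add_zero]
  simp [Pi.single_apply]

/-- The divergence is the trace of the covariant derivative, because the connection is metric
(`b_eq`). -/
theorem sum_cov_single [DecidableEq ι] (v : ι → A) :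
    ∑ i, C.cov (Pi.single i 1) 0 v i = C.div v := by
  simp only [cov_single, div, b_eq, Finset.sum_add_distrib, Finset.sum_mul]
  congr 1
  rw [Finset.sum_comm]

/-! ### Bochner's formula -/

/-- The Ricci curvature of the horizontal gradient. -/
theorem sum_curv [DecidableEq ι] (f : A) :
    ∑ i, C.curv (Pi.single i 1) (fun k => C.X k f) (fun k => C.X k f) i
      = (C.div fun j => ∑ k, C.X k f * C.hess f k j) - ∑ k, C.X k f * C.X k (C.lap f)
        - ∑ i, ∑ k, C.hess f i k * C.hess f k i
        - ∑ i, ∑ j, ∑ m, C.X j f * C.γ i j m * C.X i (C.Z m f) := by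
  have e1 : C.cov (fun k => C.X k f) 0 (fun k => C.X k f)
      = fun j => ∑ k, C.X k f * C.hess f k j := by
    funext j; rw [cov_eq_mul]
  have e2 : ∀ i, C.cov (Pi.single i 1) 0 (fun k => C.X k f) = fun j => C.hess f i j := by
    intro i; funext j
    rw [cov_eq_mul]
    simp [Pi.single_apply]
  -- The horizontal part of [X i, ∇f] is ∇_{X i} ∇f - ∇_{∇f} X i; the components of X i itself are
  -- constants, killed by every derivation.
  have e3 : ∀ i k, C.brH (Pi.single i 1) (fun k => C.X k f) k
      = C.hess f i k - ∑ j, C.X j f * C.G j i k := by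
    intro i k
    have hz : ∀ j, C.X j ((Pi.single i 1 : ι → A) k) = 0 := by
      intro j
      by_cases hk : k = i
      · subst hk; simp
      · simp [hk]
    have h : ∀ j, C.X j f * C.c i j k = C.G i j k * C.X j f - C.X j f * C.G j i k := by
      intro j; rw [← C.G_sub]; ring
    simp only [brH, hz, hess, mul_zero, Finset.sum_const_zero, sub_zero]
    rw [Finset.sum_comm]
    simp only [Pi.single_apply, ite_mul, one_mul, zero_mul]
    simp only [Finset.sum_ite_eq', Finset.mem_univ, if_true, h, Finset.sum_sub_distrib]
    ring
  have e4 : ∀ i m, C.brV (Pi.single i 1) (fun k => C.X k f) m = ∑ j, C.X j f * C.γ i j m := by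
    intro i m
    simp only [brV, Pi.single_apply, ite_mul, one_mul, zero_mul]
    rw [Finset.sum_comm]
    simp
  -- The frame is not parallel, so differentiating the Hessian along ∇f and tracing gives, besides
  -- ∇f(Lf), a term in G. The same term comes from ∇_{∇f} X i in the bracket (`e6`), and the two
  -- cancel.
  have e5 : ∑ i, C.cov (fun k => C.X k f) 0 (fun j => C.hess f i j) i
      = ∑ k, C.X k f * C.X k (C.lap f)
        + ∑ i, ∑ k, ∑ l, C.X k f * C.hess f i l * C.G k l i := by
    simp only [cov, Pi.zero_apply, zero_mul, Finset.sum_const_zero, add_zero,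
      Finset.sum_add_distrib, lap_eq_sum_hess, map_sum, Finset.mul_sum]
    congr 1
    rw [Finset.sum_comm]
  have e6 : ∑ i, ∑ k, (∑ j, C.X j f * C.G j i k) * C.hess f k i
      = ∑ i, ∑ k, ∑ l, C.X k f * C.hess f i l * C.G k l i := by
    rw [Finset.sum_comm]
    refine Finset.sum_congr rfl fun k _ => ?_
    simp only [Finset.sum_mul]
    rw [Finset.sum_comm]
    refine Finset.sum_congr rfl fun i _ => Finset.sum_congr rfl fun j _ => ?_
    ring
  simp only [curv, Finset.sum_sub_distrib, e1, sum_cov_single, e2, e5, cov_vertical, e3, e4,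
    Finset.sum_add_distrib, sub_mul, Finset.sum_mul]
  have e7 : ∑ i, ∑ m, ∑ j, C.X j f * C.γ i j m * C.X i (C.Z m f)
      = ∑ i, ∑ j, ∑ m, C.X j f * C.γ i j m * C.X i (C.Z m f) :=
    Finset.sum_congr rfl fun i _ => Finset.sum_comm
  rw [e7]
  have e8 : ∑ i, ∑ k, ∑ j, C.X j f * C.G j i k * C.hess f k i
      = ∑ i, ∑ k, ∑ l, C.X k f * C.hess f i l * C.G k l i := by
    simpa only [Finset.sum_mul] using e6
  rw [e8]
  ring

/-- The divergence of the torsion part of `∇_u u - ½ ∇|u|²`, for `u` the gradient of `f`. -/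
theorem div_torsion (f : A) :
    (C.div fun j => ∑ i, C.X i f * C.γZ f i j)
      = -(∑ i, ∑ j, C.hess f i j * C.γZ f i j)
        - ∑ i, ∑ j, ∑ m, C.X j f * C.γ i j m * C.X i (C.Z m f)
        - ∑ l, ∑ k, (∑ m, C.nablaγ l k m * C.Z m f) * C.X k f := by
  have hγZ : ∀ i j, C.γZ f j i = -C.γZ f i j := by
    intro i j
    simp only [γZ, ← Finset.sum_neg_distrib]
    exact Finset.sum_congr rfl fun m _ => by rw [C.γ_swap]; ring
  have hXγZ : ∀ l i j, C.X l (C.γZ f i j)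
      = ∑ m, C.X l (C.γ i j m) * C.Z m f + ∑ m, C.γ i j m * C.X l (C.Z m f) := by
    intro l i j
    simp only [γZ, map_sum, ← Finset.sum_add_distrib]
    refine Finset.sum_congr rfl fun m _ => ?_
    simp only [Derivation.leibniz, smul_eq_mul]; ring
  have hXX : ∀ i j, C.X j (C.X i f) = C.hess f j i - ∑ l, C.G j l i * C.X l f := by
    intro i j; simp only [hess]; ring
  have hn : ∀ l k, (∑ m, C.nablaγ l k m * C.Z m f)
      = ∑ m, C.X l (C.γ l k m) * C.Z m f - ∑ i, C.G l l i * C.γZ f i k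
        - ∑ j, C.G l k j * C.γZ f l j := by
    intro l k
    simp only [nablaγ, γZ, sub_mul, Finset.sum_sub_distrib, Finset.sum_mul, Finset.mul_sum]
    congr 1
    · congr 1
      rw [Finset.sum_comm]
      exact Finset.sum_congr rfl fun i _ => Finset.sum_congr rfl fun m _ => by ring
    · rw [Finset.sum_comm]
      exact Finset.sum_congr rfl fun i _ => Finset.sum_congr rfl fun m _ => by ring
  have hb : ∀ j, C.b j = -∑ i, C.G i i j := by
    intro j
    rw [b_eq, ← Finset.sum_neg_distrib]
    exact Finset.sum_congr rfl fun i _ => by rw [C.G_swap]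
  have hXγ : ∀ l i j, ∑ m, C.X l (C.γ j i m) * C.Z m f = -∑ m, C.X l (C.γ i j m) * C.Z m f := by
    intro l i j
    rw [← Finset.sum_neg_distrib]
    exact Finset.sum_congr rfl fun m _ => by rw [C.γ_swap, map_neg]; ring
  have hγX : ∀ l i j, ∑ m, C.γ j i m * C.X l (C.Z m f) = -∑ m, C.γ i j m * C.X l (C.Z m f) := by
    intro l i j
    rw [← Finset.sum_neg_distrib]
    exact Finset.sum_congr rfl fun m _ => by rw [C.γ_swap]; ring
  -- The terms `t4`, `t2` and `t1` assemble into the covariant derivative `nablaγ`: the derivative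
  -- of γ, then the corrections of its first and second arguments, the former coming from the
  -- divergences b. The terms `t3` and `t5` are the mixed derivatives and the pairing with the
  -- Hessian. All signs come from skewness of γ.
  have t1 : ∑ j, ∑ i, (∑ l, C.G j l i * C.X l f) * C.γZ f i j
      = -∑ l, ∑ k, (∑ j, C.G l k j * C.γZ f l j) * C.X k f := by
    simp only [Finset.sum_mul, ← Finset.sum_neg_distrib]
    refine Finset.sum_congr rfl fun j _ => ?_
    rw [Finset.sum_comm]
    refine Finset.sum_congr rfl fun l _ => Finset.sum_congr rfl fun i _ => ?_
    rw [hγZ j i]; ring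
  have t2 : ∑ j, C.b j * ∑ i, C.X i f * C.γZ f i j
      = ∑ l, ∑ k, (∑ i, C.G l l i * C.γZ f i k) * C.X k f := by
    simp only [hb, neg_mul, Finset.sum_mul, Finset.mul_sum]
    simp only [← Finset.sum_neg_distrib]
    calc ∑ j, ∑ i, ∑ l, -(C.G l l j * (C.X i f * C.γZ f i j))
        = ∑ j, ∑ l, ∑ i, -(C.G l l j * (C.X i f * C.γZ f i j)) :=
          Finset.sum_congr rfl fun l _ => Finset.sum_comm
      _ = ∑ l, ∑ j, ∑ i, -(C.G l l j * (C.X i f * C.γZ f i j)) := Finset.sum_comm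
      _ = ∑ l, ∑ i, ∑ j, -(C.G l l j * (C.X i f * C.γZ f i j)) :=
          Finset.sum_congr rfl fun l _ => Finset.sum_comm
      _ = _ := Finset.sum_congr rfl fun l _ => Finset.sum_congr rfl fun k _ =>
          Finset.sum_congr rfl fun i _ => by rw [hγZ i k]; ring
  have t3 : ∑ j, ∑ i, C.X i f * ∑ m, C.γ i j m * C.X j (C.Z m f)
      = -∑ i, ∑ j, ∑ m, C.X j f * C.γ i j m * C.X i (C.Z m f) := by
    rw [← Finset.sum_neg_distrib]
    refine Finset.sum_congr rfl fun j _ => ?_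
    rw [← Finset.sum_neg_distrib]
    refine Finset.sum_congr rfl fun i _ => ?_
    rw [hγX j j i, mul_neg, Finset.mul_sum]
    simp only [mul_assoc]
  have t4 : ∑ j, ∑ i, C.X i f * ∑ m, C.X j (C.γ i j m) * C.Z m f
      = -∑ l, ∑ k, (∑ m, C.X l (C.γ l k m) * C.Z m f) * C.X k f := by
    rw [← Finset.sum_neg_distrib]
    refine Finset.sum_congr rfl fun j _ => ?_
    rw [← Finset.sum_neg_distrib]
    refine Finset.sum_congr rfl fun i _ => ?_
    rw [hXγ j j i]; ring
  have t5 : ∑ j, ∑ i, C.hess f j i * C.γZ f i j = -∑ i, ∑ j, C.hess f i j * C.γZ f i j := by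
    rw [← Finset.sum_neg_distrib]
    refine Finset.sum_congr rfl fun j _ => ?_
    rw [← Finset.sum_neg_distrib]
    refine Finset.sum_congr rfl fun i _ => ?_
    rw [hγZ j i]; ring
  have expand : (C.div fun j => ∑ i, C.X i f * C.γZ f i j)
      = (∑ j, ∑ i, C.hess f j i * C.γZ f i j)
        - (∑ j, ∑ i, (∑ l, C.G j l i * C.X l f) * C.γZ f i j)
        + (∑ j, ∑ i, C.X i f * ∑ m, C.X j (C.γ i j m) * C.Z m f)
        + (∑ j, ∑ i, C.X i f * ∑ m, C.γ i j m * C.X j (C.Z m f))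
        + ∑ j, C.b j * ∑ i, C.X i f * C.γZ f i j := by
    simp only [div, Finset.sum_add_distrib, map_sum]
    congr 1
    simp only [← Finset.sum_add_distrib, ← Finset.sum_sub_distrib]
    refine Finset.sum_congr rfl fun j _ => Finset.sum_congr rfl fun i _ => ?_
    rw [Derivation.leibniz, hXγZ, hXX, smul_eq_mul, smul_eq_mul]
    ring
  rw [expand, t1, t2, t3, t4, t5]
  simp only [hn, sub_mul, Finset.sum_sub_distrib]
  ring

/-- Bochner's formula for the horizontal gradient. -/
theorem bochner [DecidableEq ι] (f : A) :
    C.lap (∑ j, C.X j f * C.X j f) - 2 * ∑ k, C.X k f * C.X k (C.lap f)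
      = 2 * (∑ i, C.curv (Pi.single i 1) (fun k => C.X k f) (fun k => C.X k f) i
        + ∑ l, ∑ k, (∑ m, C.nablaγ l k m * C.Z m f) * C.X k f
        + ∑ i, ∑ j, C.hess f i j ^ 2
        + 2 * ∑ i, ∑ j, ∑ m, C.X j f * C.γ i j m * C.X i (C.Z m f)) := by
  -- The curvature trace involves the divergence of ∇_{∇f} ∇f, while ½ L|∇f|² is the divergence of ½
  -- ∇|∇f|². By `hess_sub` the difference is the torsion field of `div_torsion`. The mixed sum
  -- occurs once in `sum_curv` and once in `div_torsion`, which gives its coefficient 2 next to the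
  -- curvature.
  have h1 : (C.div fun j => ∑ k, C.X k f * C.hess f k j)
      = (C.div fun i => ∑ j, C.X j f * C.hess f i j)
        + C.div fun j => ∑ i, C.X i f * C.γZ f i j := by
    rw [← div_add]
    congr 1
    funext j
    simp only [Pi.add_apply, ← Finset.sum_add_distrib, ← hess_sub]
    exact Finset.sum_congr rfl fun i _ => by ring
  have h2 : ∑ i, ∑ k, C.hess f i k * C.hess f k i + ∑ i, ∑ j, C.hess f i j * C.γZ f i j
      = ∑ i, ∑ j, C.hess f i j ^ 2 := by
    simp only [← Finset.sum_add_distrib, ← hess_sub]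
    exact Finset.sum_congr rfl fun i _ => Finset.sum_congr rfl fun j _ => by ring
  rw [lap_gradSq, sum_curv, h1, div_torsion]
  linear_combination 2 * h2

/-- The symmetric and skew parts of the horizontal Hessian. -/
theorem sum_hess_sq (f : A) :
    ∑ i, ∑ j, C.hess f i j ^ 2
      = ∑ i, ∑ j, (C.hess f i j - (1 / 2 : ℝ) • C.γZ f i j) ^ 2
        + (1 / 4 : ℝ) • ∑ i, ∑ j, C.γZ f i j ^ 2 := by
  -- Pairing the Hessian with a skew array sees only its skew part, which is ½ γZ.
  have h : ∑ i, ∑ j, 2 * (C.hess f i j * C.γZ f i j) = ∑ i, ∑ j, C.γZ f i j ^ 2 := by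
    have hγ : ∀ i j, C.γZ f j i = -C.γZ f i j := fun i j => by rw [← hess_sub, ← hess_sub]; ring
    calc ∑ i, ∑ j, 2 * (C.hess f i j * C.γZ f i j)
        = ∑ i, ∑ j, C.hess f i j * C.γZ f i j + ∑ i, ∑ j, C.hess f i j * C.γZ f i j := by
          simp only [← Finset.mul_sum]; ring
      _ = ∑ i, ∑ j, C.hess f i j * C.γZ f i j + ∑ i, ∑ j, C.hess f j i * C.γZ f j i := by
          congr 1; rw [Finset.sum_comm]
      _ = _ := by
          simp only [← Finset.sum_add_distrib]
          refine Finset.sum_congr rfl fun i _ => Finset.sum_congr rfl fun j _ => ?_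
          rw [hγ i j, pow_two]
          nth_rewrite 3 [← hess_sub]
          ring
  have hterm : ∀ i j, C.hess f i j ^ 2
      = (C.hess f i j - (1 / 2 : ℝ) • C.γZ f i j) ^ 2 + (1 / 4 : ℝ) • C.γZ f i j ^ 2
        + (1 / 2 : ℝ) • (2 * (C.hess f i j * C.γZ f i j) - C.γZ f i j ^ 2) := by
    intro i j
    have h2 : (2 : A) * algebraMap ℝ A (1 / 2) = 1 := by
      rw [← map_ofNat (algebraMap ℝ A) 2, ← map_mul]; norm_num
    have h4 : algebraMap ℝ A (1 / 4) = algebraMap ℝ A (1 / 2) ^ 2 := by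
      rw [← map_pow]; norm_num
    simp only [Algebra.smul_def, h4]
    linear_combination (algebraMap ℝ A (1 / 2) * (-C.γZ f i j ^ 2)) * h2
  simp only [hterm, Finset.sum_add_distrib, ← Finset.smul_sum, Finset.sum_sub_distrib, h, sub_self,
    smul_zero, add_zero]

/-- This is [Z, [X_i, X_k]] = [[Z, X_i], X_k] + [X_i, [Z, X_k]] applied to t and written in
structure functions. It is obtained by differentiating the commutation relations; all higher-order
terms in t cancel. -/
theorem jacobi (m : κ) (i k : ι) (t : A) :
    ∑ p, C.Z m (C.c i k p) * C.X p t + ∑ p, C.c i k p * ∑ q, C.δ m p q * C.X q t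
      + (∑ l, C.Z m (C.γ i k l) * C.Z l t + ∑ l, C.γ i k l * ∑ q, C.e m l q * C.Z q t)
    = ∑ p, C.δ m i p * (∑ q, C.c p k q * C.X q t + ∑ l, C.γ p k l * C.Z l t)
      - ∑ p, C.X k (C.δ m i p) * C.X p t
      + ∑ p, C.X i (C.δ m k p) * C.X p t
      + ∑ p, C.δ m k p * (∑ q, C.c i p q * C.X q t + ∑ l, C.γ i p l * C.Z l t) := by
  have a1 := congrArg (C.Z m) (C.comm_XX i k t)
  have a2 := C.comm_XX i k (C.Z m t)
  have a3 := congrArg (C.X k) (C.comm_ZX m i t)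
  have a4 := congrArg (C.X i) (C.comm_ZX m k t)
  simp only [← C.comm_XX, ← C.comm_ZX, ← C.comm_ZZ, mul_sub, Finset.sum_sub_distrib]
  simp only [map_sub, map_add, map_sum, Derivation.leibniz, smul_eq_mul,
    Finset.sum_add_distrib] at a1 a3 a4
  have c1 : ∀ (u : ι → A), ∑ p, C.X p t * u p = ∑ p, u p * C.X p t := fun u =>
    Finset.sum_congr rfl fun _ _ => mul_comm _ _
  have c2 : ∀ (u : κ → A), ∑ p, C.Z p t * u p = ∑ p, u p * C.Z p t := fun u =>
    Finset.sum_congr rfl fun _ _ => mul_comm _ _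
  simp only [c1, c2] at a1 a3 a4
  linear_combination -a1 + a2 - a3 + a4

/-- A consequence of the Jacobi identity at a point where the frame admits dual functions. -/
theorem eval_Z_b [DecidableEq ι] (ev : A →+* ℝ) (t : ι → A)
    (htX : ∀ i j, ev (C.X i (t j)) = if i = j then 1 else 0) (htZ : ∀ m j, ev (C.Z m (t j)) = 0)
    (m : κ) (k : ι) :
    ev (C.Z m (C.b k)) = ev (∑ i, C.X i (C.δ m k i) + ∑ p, C.δ m k p * C.b p) := by
  have hδ : ∀ i, C.δ m i i = 0 := fun i => eq_of_two_mul (by linear_combination C.δ_swap m i i)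
  have h : ∀ i, ev (C.Z m (C.c i k i)) + ∑ p, ev (C.c i k p) * ev (C.δ m p i)
      = ∑ p, ev (C.δ m i p) * ev (C.c p k i) + ev (C.X i (C.δ m k i))
        + ∑ p, ev (C.δ m k p) * ev (C.c i p i) := by
    intro i
    -- Applied to the dual function t i, the Jacobi identity yields its X i-component, since the
    -- vertical derivatives of t i vanish at the point. Summing over i turns c into the divergences
    -- b.
    have := congrArg ev (C.jacobi m i k (t i))
    simpa [htX, htZ, hδ] using this
  have h2 := Finset.sum_congr rfl fun i (_ : i ∈ Finset.univ) => h i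
  simp only [Finset.sum_add_distrib] at h2
  have h3 : ∑ i, ∑ p, ev (C.c i k p) * ev (C.δ m p i)
      = ∑ i, ∑ p, ev (C.δ m i p) * ev (C.c p k i) := by
    rw [Finset.sum_comm]
    exact Finset.sum_congr rfl fun _ _ => Finset.sum_congr rfl fun _ _ => mul_comm _ _
  have h4 : ∑ i, ∑ p, ev (C.δ m k p) * ev (C.c i p i)
      = ∑ p, ev (C.δ m k p) * ∑ i, ev (C.c i p i) := by
    rw [Finset.sum_comm]
    simp only [Finset.mul_sum]
  simp only [b, map_add, map_sum, map_mul]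
  linear_combination h2 - h3 + h4

/-- The second-order part of [L, Z m] is the pairing of the skew δ with second derivatives,
symmetrised by the sum, hence zero. The first-order part involves Z m (b k), which `hb` controls;
carrying the factor X k f makes that hypothesis trivial where the frame is cut off to zero. -/
theorem comm_lap_Z (m : κ) (f : A)
    (hb : ∀ k, C.Z m (C.b k) * C.X k f
      = (∑ i, C.X i (C.δ m k i) + ∑ p, C.δ m k p * C.b p) * C.X k f) :
    C.lap (C.Z m f) = C.Z m (C.lap f) := by
  have hXZ : ∀ i g, C.X i (C.Z m g) = C.Z m (C.X i g) - ∑ k, C.δ m i k * C.X k g :=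
    fun i g => by rw [← C.comm_ZX]; ring
  have hsk : ∑ i, ∑ k, C.δ m i k * C.X k (C.X i f) = -∑ i, ∑ k, C.δ m i k * C.X i (C.X k f) := by
    rw [Finset.sum_comm, ← Finset.sum_neg_distrib]
    refine Finset.sum_congr rfl fun i _ => ?_
    rw [← Finset.sum_neg_distrib]
    exact Finset.sum_congr rfl fun k _ => by rw [C.δ_swap m i k]; ring
  have h1 : ∑ k, C.Z m (C.b k) * C.X k f = -∑ i, ∑ k, C.X i (C.δ m i k) * C.X k f
      - ∑ i, ∑ k, C.b i * (C.δ m i k * C.X k f) := by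
    simp only [hb, add_mul, Finset.sum_add_distrib, Finset.sum_mul]
    have e1 : ∑ k, ∑ i, C.X i (C.δ m k i) * C.X k f = -∑ i, ∑ k, C.X i (C.δ m i k) * C.X k f := by
      rw [Finset.sum_comm, ← Finset.sum_neg_distrib]
      refine Finset.sum_congr rfl fun i _ => ?_
      rw [← Finset.sum_neg_distrib]
      exact Finset.sum_congr rfl fun k _ => by rw [C.δ_swap m i k, map_neg]; ring
    have e2 : ∑ k, ∑ p, C.δ m k p * C.b p * C.X k f
        = -∑ i, ∑ k, C.b i * (C.δ m i k * C.X k f) := by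
      rw [Finset.sum_comm, ← Finset.sum_neg_distrib]
      refine Finset.sum_congr rfl fun i _ => ?_
      rw [← Finset.sum_neg_distrib]
      exact Finset.sum_congr rfl fun k _ => by rw [C.δ_swap m i k]; ring
    rw [e1, e2]; ring
  simp only [lap, div, map_sum, map_add, map_sub, hXZ, Derivation.leibniz, smul_eq_mul, mul_sub,
    Finset.mul_sum, Finset.sum_add_distrib, Finset.sum_sub_distrib]
  have e3 : ∑ i, ∑ k, C.X k f * C.X i (C.δ m i k) = ∑ i, ∑ k, C.X i (C.δ m i k) * C.X k f :=
    Finset.sum_congr rfl fun i _ => Finset.sum_congr rfl fun k _ => mul_comm _ _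
  have e4 : ∑ k, C.X k f * C.Z m (C.b k) = ∑ k, C.Z m (C.b k) * C.X k f :=
    Finset.sum_congr rfl fun k _ => mul_comm _ _
  rw [e3, e4, h1]
  linear_combination -hsk

/-- Since L commutes with Z m, the product rule for L(Z m f)² leaves only the squared gradient of Z
m f, with no curvature term. -/
theorem bochner_vertical (f : A) (hf : ∀ m, C.lap (C.Z m f) = C.Z m (C.lap f)) :
    C.lap (∑ m, C.Z m f * C.Z m f) - 2 * ∑ m, C.Z m f * C.Z m (C.lap f)
      = 2 * ∑ i, ∑ m, C.X i (C.Z m f) ^ 2 := by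
  rw [Finset.sum_comm, lap_sum, Finset.mul_sum, Finset.mul_sum, ← Finset.sum_sub_distrib]
  refine Finset.sum_congr rfl fun m _ => ?_
  rw [lap_mul, hf]
  simp only [pow_two]
  ring

end FrameCalculus

/-! ### Vector fields as derivations -/

section ManifoldCalculus

variable {n : ℕ} {M : Type*} [TopologicalSpace M] [ChartedSpace (EuclideanSpace ℝ (Fin n)) M]

/-- The vector field `V` in the chart at `x₀`. -/
def chartRep (x₀ : M) (V : VField n M) (y : EuclideanSpace ℝ (Fin n)) :
    EuclideanSpace ℝ (Fin n) :=
  VectorField.mpullback 𝓘(ℝ, EuclideanSpace ℝ (Fin n)) (𝓡 n) (extChartAt (𝓡 n) x₀).symm V y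

theorem VField.der_congr {V W : VField n M} {f g : M → ℝ} {x : M} (hV : V x = W x)
    (hf : f =ᶠ[𝓝 x] g) : V.der f x = W.der g x := by
  have : mfderiv (𝓡 n) 𝓘(ℝ, ℝ) f x = mfderiv (𝓡 n) 𝓘(ℝ, ℝ) g x := hf.mfderiv_eq
  unfold VField.der
  rw [hV]
  exact congrArg (fun L => L (W x)) this

variable [IsManifold (𝓡 n) ∞ M]

theorem isInvertible_mfderiv_chart_symm {x₀ : M} {y : EuclideanSpace ℝ (Fin n)}
    (hy : y ∈ (extChartAt (𝓡 n) x₀).target) :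
    (mfderiv 𝓘(ℝ, EuclideanSpace ℝ (Fin n)) (𝓡 n) (extChartAt (𝓡 n) x₀).symm y).IsInvertible := by
  have : IsManifold (𝓡 n) 1 M := inferInstance
  have h := isInvertible_mfderivWithin_extChartAt_symm (I := 𝓡 n) hy
  rwa [ModelWithCorners.range_eq_univ, mfderivWithin_univ] at h

theorem mfderiv_chartRep {x₀ : M} (V : VField n M) {y : EuclideanSpace ℝ (Fin n)}
    (hy : y ∈ (extChartAt (𝓡 n) x₀).target) :
    mfderiv 𝓘(ℝ, EuclideanSpace ℝ (Fin n)) (𝓡 n) (extChartAt (𝓡 n) x₀).symm y (chartRep x₀ V y)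
      = V ((extChartAt (𝓡 n) x₀).symm y) := by
  obtain ⟨e, he⟩ := isInvertible_mfderiv_chart_symm hy
  unfold chartRep
  rw [VectorField.mpullback_apply, ← he, ContinuousLinearMap.inverse_equiv]
  exact e.apply_symm_apply _

theorem chartRep_eq {x₀ x : M} (V : VField n M) (hx : x ∈ (extChartAt (𝓡 n) x₀).source) :
    chartRep x₀ V (extChartAt (𝓡 n) x₀ x)
      = mfderiv (𝓡 n) 𝓘(ℝ, EuclideanSpace ℝ (Fin n)) (extChartAt (𝓡 n) x₀) x (V x) := by
  have : IsManifold (𝓡 n) 1 M := inferInstance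
  have hy := (extChartAt (𝓡 n) x₀).map_source hx
  have h1 := mfderiv_chartRep V hy
  have h2 := mfderiv_extChartAt_comp_mfderivWithin_extChartAt_symm (I := 𝓡 n) hy
  rw [ModelWithCorners.range_eq_univ, mfderivWithin_univ] at h2
  have h3 := congrArg (fun L => L (chartRep x₀ V (extChartAt (𝓡 n) x₀ x))) h2
  have h4 : mfderiv (𝓡 n) 𝓘(ℝ, EuclideanSpace ℝ (Fin n)) (extChartAt (𝓡 n) x₀)
      ((extChartAt (𝓡 n) x₀).symm (extChartAt (𝓡 n) x₀ x))
      (V ((extChartAt (𝓡 n) x₀).symm (extChartAt (𝓡 n) x₀ x)))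
      = chartRep x₀ V (extChartAt (𝓡 n) x₀ x) := by
    rw [← h1]; exact h3
  rw [(extChartAt (𝓡 n) x₀).left_inv hx] at h4
  exact h4.symm

theorem mdifferentiableAt_chart_symm {x₀ : M} {y : EuclideanSpace ℝ (Fin n)}
    (hy : y ∈ (extChartAt (𝓡 n) x₀).target) :
    MDifferentiableAt 𝓘(ℝ, EuclideanSpace ℝ (Fin n)) (𝓡 n) (extChartAt (𝓡 n) x₀).symm y :=
  ((contMDiffOn_extChartAt_symm (n := ∞) x₀).contMDiffAt
    ((isOpen_extChartAt_target x₀).mem_nhds hy)).mdifferentiableAt (by simp)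

theorem VField.der_chart {x₀ : M} (V : VField n M) {f : M → ℝ} {y : EuclideanSpace ℝ (Fin n)}
    (hy : y ∈ (extChartAt (𝓡 n) x₀).target)
    (hf : MDifferentiableAt (𝓡 n) 𝓘(ℝ, ℝ) f ((extChartAt (𝓡 n) x₀).symm y)) :
    V.der f ((extChartAt (𝓡 n) x₀).symm y)
      = fderiv ℝ (f ∘ (extChartAt (𝓡 n) x₀).symm) y (chartRep x₀ V y) := by
  unfold VField.der
  rw [← mfderiv_chartRep V hy]
  have := mfderiv_comp_apply y hf (mdifferentiableAt_chart_symm hy) (chartRep x₀ V y)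
  rw [mfderiv_eq_fderiv] at this
  exact this.symm

theorem VField.der_chart_self {x₀ : M} (V : VField n M) {f : M → ℝ}
    (hf : MDifferentiableAt (𝓡 n) 𝓘(ℝ, ℝ) f x₀) :
    V.der f x₀ = fderiv ℝ (f ∘ (extChartAt (𝓡 n) x₀).symm) (extChartAt (𝓡 n) x₀ x₀)
      (chartRep x₀ V (extChartAt (𝓡 n) x₀ x₀)) := by
  have h := V.der_chart (f := f) (mem_extChartAt_target (I := 𝓡 n) x₀)
    (by rwa [extChartAt_to_inv])
  rwa [extChartAt_to_inv] at h

theorem differentiableAt_chartRep {x₀ : M} {V : VField n M}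
    (hV : MDifferentiableAt (𝓡 n) (𝓡 n).tangent (fun x => (⟨x, V x⟩ : TangentBundle (𝓡 n) M)) x₀) :
    DifferentiableAt ℝ (chartRep x₀ V) (extChartAt (𝓡 n) x₀ x₀) := by
  have : IsManifold (𝓡 n) 2 M := inferInstance
  have h := (mdifferentiableWithinAt_univ.2 hV).differentiableWithinAt_mpullbackWithin_vectorField
  rw [ModelWithCorners.range_eq_univ, VectorField.mpullbackWithin_univ, Set.preimage_univ,
    Set.univ_inter] at h
  exact differentiableWithinAt_univ.1 h

/-- The bracket at x₀ is defined through the chart at x₀, so the identity is unwound at the centre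
of that chart. This suffices, as every use is at the base point. -/
theorem chartRep_bracket (x₀ : M) (V W : VField n M) :
    chartRep x₀ (V.bracket W) (extChartAt (𝓡 n) x₀ x₀)
      = VectorField.lieBracket ℝ (chartRep x₀ V) (chartRep x₀ W) (extChartAt (𝓡 n) x₀ x₀) := by
  have : IsManifold (𝓡 n) 1 M := inferInstance
  rw [chartRep_eq _ (mem_extChartAt_source x₀)]
  obtain ⟨e, he⟩ := isInvertible_mfderiv_extChartAt (I := 𝓡 n) (mem_extChartAt_source (I := 𝓡 n) x₀)
  have h := VectorField.mlieBracketWithin_apply (I := 𝓡 n) (V := V) (W := W) (s := Set.univ)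
    (x₀ := x₀)
  rw [ModelWithCorners.range_eq_univ, VectorField.mpullbackWithin_univ,
    VectorField.mpullbackWithin_univ, Set.preimage_univ, Set.univ_inter] at h
  change _ = (mfderiv (𝓡 n) 𝓘(ℝ, EuclideanSpace ℝ (Fin n)) (extChartAt (𝓡 n) x₀) x₀).inverse
    (VectorField.lieBracketWithin (E := EuclideanSpace ℝ (Fin n)) ℝ (chartRep x₀ V)
      (chartRep x₀ W) Set.univ (extChartAt (𝓡 n) x₀ x₀)) at h
  rw [VectorField.lieBracketWithin_univ, ← he, ContinuousLinearMap.inverse_equiv] at h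
  rw [← he]
  unfold VField.bracket VectorField.mlieBracket
  rw [h]
  exact e.apply_symm_apply _

/-- The Lie bracket is the commutator of derivations. -/
theorem VField.der_bracket {x₀ : M} {U : Set M} (hU : IsOpen U) (hx : x₀ ∈ U) {V W : VField n M}
    (hV : V.SmoothOn U) (hW : W.SmoothOn U) {f : M → ℝ}
    (hf : ContMDiffOn (𝓡 n) 𝓘(ℝ, ℝ) ∞ f U)
    (hVf : MDifferentiableAt (𝓡 n) 𝓘(ℝ, ℝ) (V.der f) x₀)
    (hWf : MDifferentiableAt (𝓡 n) 𝓘(ℝ, ℝ) (W.der f) x₀) :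
    (V.bracket W).der f x₀ = V.der (W.der f) x₀ - W.der (V.der f) x₀ := by
  set φ := extChartAt (𝓡 n) x₀ with hφ
  have hUx := hU.mem_nhds hx
  have hfx : ContMDiffAt (𝓡 n) 𝓘(ℝ, ℝ) ∞ f x₀ := hf.contMDiffAt hUx
  have hnear : ∀ᶠ y in 𝓝 (φ x₀), y ∈ φ.target ∧ φ.symm y ∈ U := by
    refine Filter.Eventually.and
      ((isOpen_extChartAt_target x₀).mem_nhds (mem_extChartAt_target x₀)) ?_
    exact (continuousAt_extChartAt_symm x₀).preimage_mem_nhds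
      (by rw [extChartAt_to_inv]; exact hUx)
  have hder : ∀ V' : VField n M, V'.der f ∘ φ.symm =ᶠ[𝓝 (φ x₀)]
      fun y => fderiv ℝ (f ∘ φ.symm) y (chartRep x₀ V' y) := by
    intro V'
    filter_upwards [hnear] with y hy
    exact V'.der_chart hy.1 ((hf.contMDiffAt (hU.mem_nhds hy.2)).mdifferentiableAt (by simp))
  have hF : ContDiffAt ℝ ∞ (f ∘ φ.symm) (φ x₀) := by
    rw [← contMDiffAt_iff_contDiffAt]
    refine ContMDiffAt.comp (φ x₀) (by rw [extChartAt_to_inv]; exact hfx) ?_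
    exact (contMDiffOn_extChartAt_symm (n := ∞) x₀).contMDiffAt
      ((isOpen_extChartAt_target x₀).mem_nhds (mem_extChartAt_target x₀))
  have hdV := differentiableAt_chartRep ((hV.contMDiffAt hUx).mdifferentiableAt (by simp))
  have hdW := differentiableAt_chartRep ((hW.contMDiffAt hUx).mdifferentiableAt (by simp))
  have hdF : DifferentiableAt ℝ (fderiv ℝ (f ∘ φ.symm)) (φ x₀) :=
    (hF.fderiv_right (m := 1) (by simp [← WithTop.coe_one, ← WithTop.coe_add])).differentiableAt
      (by simp)
  -- Symmetry of the second derivative removes the second-order terms from the commutator.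
  have hsymm := hF.isSymmSndFDerivAt (by
    rw [minSmoothness_of_isRCLikeNormedField]; exact WithTop.coe_le_coe.2 le_top)
  rw [VField.der_chart_self _ (hfx.mdifferentiableAt (by simp)), chartRep_bracket,
    V.der_chart_self hWf, W.der_chart_self hVf, (hder W).fderiv_eq, (hder V).fderiv_eq,
    fderiv_clm_apply hdF hdW, fderiv_clm_apply hdF hdV]
  simp only [VectorField.lieBracket, map_sub, _root_.add_apply,
    ContinuousLinearMap.comp_apply, ContinuousLinearMap.flip_apply, ← hφ]
  rw [hsymm.eq (chartRep x₀ V (φ x₀)) (chartRep x₀ W (φ x₀))]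
  ring

theorem VField.SmoothOn.der {U : Set M} (hU : IsOpen U) {V : VField n M} (hV : V.SmoothOn U)
    {f : M → ℝ} (hf : ContMDiffOn (𝓡 n) 𝓘(ℝ, ℝ) ∞ f U) :
    ContMDiffOn (𝓡 n) 𝓘(ℝ, ℝ) ∞ (V.der f) U := by
  have : IsManifold (𝓡 n) 1 M := inferInstance
  have h1 := hf.contMDiffOn_tangentMapWithin (m := ∞) (by simp) hU.uniqueMDiffOn
  have h2 := h1.comp hV (fun x hx => hx)
  have h3 := (contMDiff_snd_tangentBundle_modelSpace (n := ∞) ℝ 𝓘(ℝ, ℝ)).comp_contMDiffOn h2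
  refine h3.congr fun x hx => ?_
  simp only [VField.der, Function.comp, tangentMapWithin]
  rw [mfderivWithin_of_isOpen hU hx]
  rfl

theorem VField.SmoothOn.bracket {U : Set M} (hU : IsOpen U) {V W : VField n M}
    (hV : V.SmoothOn U) (hW : W.SmoothOn U) : (V.bracket W).SmoothOn U := by
  have h1 : IsManifold (𝓡 n) (((⊤ : ℕ∞) : WithTop ℕ∞) + 1) M := by simpa
  have h2 : IsManifold (𝓡 n) (minSmoothness ℝ 2) M := by
    rw [minSmoothness_of_isRCLikeNormedField]; infer_instance
  intro x hx
  refine (ContMDiffAt.mlieBracket_vectorField (m := ⊤) (n := ⊤) (hV.contMDiffAt (hU.mem_nhds hx))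
    (hW.contMDiffAt (hU.mem_nhds hx)) ?_).contMDiffWithinAt
  simp [minSmoothness_of_isRCLikeNormedField]

end ManifoldCalculus

/-! ### The algebra of functions smooth on an open set, and dual functions of a frame -/

section SmoothAlgebra

variable {n : ℕ} {M : Type*} [TopologicalSpace M] [ChartedSpace (EuclideanSpace ℝ (Fin n)) M]

variable (n) in
/-- The algebra of functions on `M` that are smooth on `U`. -/
def smoothAlg (U : Set M) : Subalgebra ℝ (M → ℝ) where
  carrier := {f | ContMDiffOn (𝓡 n) 𝓘(ℝ, ℝ) ∞ f U}
  mul_mem' hf hg := ContMDiffOn.mul hf hg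
  add_mem' hf hg := ContMDiffOn.add hf hg
  algebraMap_mem' _ := contMDiffOn_const

theorem smoothAlg.mdifferentiableAt {U : Set M} (hU : IsOpen U) (f : smoothAlg n U) {x : M}
    (hx : x ∈ U) : MDifferentiableAt (𝓡 n) 𝓘(ℝ, ℝ) (f : M → ℝ) x :=
  (ContMDiffOn.contMDiffAt f.2 (hU.mem_nhds hx)).mdifferentiableAt (by simp)

theorem smoothAlg.indicator_mem {U : Set M} {f : M → ℝ} (hf : ContMDiffOn (𝓡 n) 𝓘(ℝ, ℝ) ∞ f U) :
    U.indicator f ∈ smoothAlg n U :=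
  ContMDiffOn.congr hf fun _ hx => Set.indicator_of_mem hx f

/-- Elements of `smoothAlg n U` are functions on all of M, unrestricted off U, so equality has to be
checked there too. Derivations and coefficients are extended by zero, which makes the second case
immediate. -/
theorem smoothAlg.ext_on_off {U : Set M} {f g : smoothAlg n U}
    (hon : ∀ y ∈ U, (f : M → ℝ) y = (g : M → ℝ) y)
    (hoff : ∀ y ∉ U, (f : M → ℝ) y = (g : M → ℝ) y) : f = g :=
  Subtype.ext <| funext fun y => by
    by_cases hy : y ∈ U
    exacts [hon y hy, hoff y hy]

theorem VField.der_add (V : VField n M) {f g : M → ℝ} {x : M}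
    (hf : MDifferentiableAt (𝓡 n) 𝓘(ℝ, ℝ) f x) (hg : MDifferentiableAt (𝓡 n) 𝓘(ℝ, ℝ) g x) :
    V.der (f + g) x = V.der f x + V.der g x := by
  simp [VField.der, mvfderiv_add hf hg]

theorem VField.der_mul (V : VField n M) {f g : M → ℝ} {x : M}
    (hf : MDifferentiableAt (𝓡 n) 𝓘(ℝ, ℝ) f x) (hg : MDifferentiableAt (𝓡 n) 𝓘(ℝ, ℝ) g x) :
    V.der (f * g) x = f x * V.der g x + g x * V.der f x := by
  simp [VField.der, mvfderiv_mul hf hg]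

theorem VField.der_const (V : VField n M) (c : ℝ) (x : M) : V.der (fun _ => c) x = 0 := by
  simp [VField.der, mvfderiv_const]

theorem contMDiffAt_det {ι : Type*} [Fintype ι] [DecidableEq ι] {A : M → Matrix ι ι ℝ} {x : M}
    (hA : ∀ i j, ContMDiffAt (𝓡 n) 𝓘(ℝ, ℝ) ∞ (fun y => A y i j) x) :
    ContMDiffAt (𝓡 n) 𝓘(ℝ, ℝ) ∞ (fun y => (A y).det) x := by
  simp only [Matrix.det_apply]
  refine ContMDiffAt.sum fun σ _ => ?_
  simp only [zsmul_eq_mul, Units.smul_def]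
  exact contMDiffAt_const.mul (ContMDiffAt.prod fun i _ => hA _ _)

variable [IsManifold (𝓡 n) ∞ M]

/-- A vector field that is smooth on the open set `U`, as a derivation of `smoothAlg n U`. -/
def VField.toDerivation {U : Set M} (hU : IsOpen U) (V : VField n M) (hV : V.SmoothOn U) :
    Derivation ℝ (smoothAlg n U) (smoothAlg n U) :=
  Derivation.mk'
    { toFun := fun f => ⟨U.indicator (V.der f), smoothAlg.indicator_mem (hV.der hU f.2)⟩
      map_add' := fun f g => by
        ext x
        by_cases hx : x ∈ U
        · simpa [hx] using V.der_add (smoothAlg.mdifferentiableAt hU f hx)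
            (smoothAlg.mdifferentiableAt hU g hx)
        · simp [hx]
      map_smul' := fun c f => by
        ext x
        by_cases hx : x ∈ U
        · have := V.der_mul (mdifferentiableAt_const (c := c)) (smoothAlg.mdifferentiableAt hU f hx)
          rw [V.der_const, mul_zero, add_zero] at this
          simp only [Set.indicator_of_mem hx, Subalgebra.coe_smul, RingHom.id_apply, Pi.smul_apply,
            smul_eq_mul]
          exact this
        · simp [hx] }
    (fun f g => by
      ext x
      by_cases hx : x ∈ U
      · simpa [hx] using V.der_mul (smoothAlg.mdifferentiableAt hU f hx)
          (smoothAlg.mdifferentiableAt hU g hx)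
      · simp [hx])

theorem VField.toDerivation_apply {U : Set M} (hU : IsOpen U) (V : VField n M)
    (hV : V.SmoothOn U) (f : smoothAlg n U) {x : M} (hx : x ∈ U) :
    (V.toDerivation hU hV f : M → ℝ) x = V.der f x :=
  Set.indicator_of_mem hx _

theorem VField.toDerivation_apply_of_notMem {U : Set M} (hU : IsOpen U) (V : VField n M)
    (hV : V.SmoothOn U) (f : smoothAlg n U) {x : M} (hx : x ∉ U) :
    (V.toDerivation hU hV f : M → ℝ) x = 0 :=
  Set.indicator_of_notMem hx _

theorem VField.bracket_der_apply {U : Set M} (hU : IsOpen U) {V W : VField n M}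
    (hV : V.SmoothOn U) (hW : W.SmoothOn U) (f : smoothAlg n U) {x : M} (hx : x ∈ U) :
    (V.bracket W).der f x
      = (V.toDerivation hU hV (W.toDerivation hU hW f) : M → ℝ) x
        - (W.toDerivation hU hW (V.toDerivation hU hV f) : M → ℝ) x := by
  have hUx := hU.mem_nhds hx
  have key : ∀ (V' : VField n M) (hV' : V'.SmoothOn U),
      (V'.toDerivation hU hV' f : M → ℝ) =ᶠ[𝓝 x] V'.der f := fun V' hV' =>
    Filter.eventually_of_mem hUx fun y hy => V'.toDerivation_apply hU hV' f hy
  rw [VField.der_bracket hU hx hV hW f.2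
      (((hV.der hU f.2).contMDiffAt hUx).mdifferentiableAt (by simp))
      (((hW.der hU f.2).contMDiffAt hUx).mdifferentiableAt (by simp)),
    V.toDerivation_apply hU hV _ hx, W.toDerivation_apply hU hW _ hx,
    V.der_congr rfl (key W hW), W.der_congr rfl (key V hV)]

/-- Every linear functional on a tangent space is the differential of a smooth function. -/
theorem exists_smooth_mvfderiv_eq [T2Space M] (x : M) (l : TangentSpace (𝓡 n) x →ₗ[ℝ] ℝ) :
    ∃ f : M → ℝ, SmoothFun n f ∧ f x = 0 ∧ ∀ v, mvfderiv (𝓡 n) f x v = l v := by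
  have : IsManifold (𝓡 n) 1 M := inferInstance
  set φ := extChartAt (𝓡 n) x with hφ
  obtain ⟨e, he⟩ := isInvertible_mfderiv_extChartAt (I := 𝓡 n) (mem_extChartAt_source (I := 𝓡 n) x)
  let l' : EuclideanSpace ℝ (Fin n) →L[ℝ] ℝ :=
    LinearMap.toContinuousLinearMap
      (l ∘ₗ (show EuclideanSpace ℝ (Fin n) →ₗ[ℝ] TangentSpace (𝓡 n) x from
        e.symm.toLinearEquiv.toLinearMap))
  let g : M → ℝ := fun y => l' (φ y - φ x)
  have hg : ContMDiffOn (𝓡 n) 𝓘(ℝ, ℝ) ∞ g (chartAt (EuclideanSpace ℝ (Fin n)) x).source := by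
    have h1 : ContMDiffOn (𝓡 n) 𝓘(ℝ, EuclideanSpace ℝ (Fin n)) ∞ φ
        (chartAt (EuclideanSpace ℝ (Fin n)) x).source := contMDiffOn_extChartAt
    have h2 : ContMDiff 𝓘(ℝ, EuclideanSpace ℝ (Fin n)) 𝓘(ℝ, ℝ) ∞
        fun z : EuclideanSpace ℝ (Fin n) => l' (z - φ x) :=
      (l'.contDiff.comp (contDiff_id.sub contDiff_const)).contMDiff
    exact h2.comp_contMDiffOn h1
  -- The linear function in the chart is globalised by a bump function equal to 1 near x, which
  -- leaves the differential at x unchanged. Global smoothness of the product uses the Hausdorff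
  -- property.
  obtain ⟨B⟩ : Nonempty (SmoothBumpFunction (𝓡 n) x) := inferInstance
  refine ⟨fun y => B y • g y, B.contMDiff_smul hg, by simp [g], fun v => ?_⟩
  have hev : (fun y => B y • g y) =ᶠ[𝓝 x] g := by
    filter_upwards [B.eventuallyEq_one] with y hy
    simp [hy]
  have h1 : MDifferentiableAt (𝓡 n) 𝓘(ℝ, EuclideanSpace ℝ (Fin n)) φ x :=
    mdifferentiableAt_extChartAt (mem_chart_source _ x)
  have h2 : HasFDerivAt (fun z : EuclideanSpace ℝ (Fin n) => l' (z - φ x)) l' (φ x) := by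
    have h := l'.hasFDerivAt.comp (φ x) ((hasFDerivAt_id (𝕜 := ℝ) (φ x)).sub_const (φ x))
    rwa [ContinuousLinearMap.comp_id] at h
  have h3 := mfderiv_comp_apply x h2.hasMFDerivAt.mdifferentiableAt h1 v
  rw [h2.hasMFDerivAt.mfderiv] at h3
  have h4 : mfderiv (𝓡 n) 𝓘(ℝ, ℝ) (fun y => B y • g y) x = mfderiv (𝓡 n) 𝓘(ℝ, ℝ) g x :=
    hev.mfderiv_eq
  have h5 : mvfderiv (𝓡 n) (fun y => B y • g y) x v = mvfderiv (𝓡 n) g x v :=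
    congrArg (fun L => L v) h4
  rw [h5]
  refine h3.trans ?_
  change l (e.symm (mfderiv (𝓡 n) 𝓘(ℝ, EuclideanSpace ℝ (Fin n)) (extChartAt (𝓡 n) x) x v)) = l v
  rw [← he]
  exact congrArg l (e.symm_apply_apply v)

/-- Globally smooth functions separate tangent vectors. Identities between brackets can thus be
tested as identities between derivations. -/
theorem tangent_ext [T2Space M] {x : M} {v w : TangentSpace (𝓡 n) x}
    (h : ∀ f : M → ℝ, SmoothFun n f → mvfderiv (𝓡 n) f x v = mvfderiv (𝓡 n) f x w) : v = w := by
  rw [← sub_eq_zero, ← Module.forall_dual_apply_eq_zero_iff ℝ]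
  intro l
  obtain ⟨f, hf, -, hl⟩ := exists_smooth_mvfderiv_eq x l
  rw [← hl, map_sub, h f hf, sub_self]

theorem exists_dual_functions [T2Space M] {ι : Type*} [DecidableEq ι] {x : M}
    {v : ι → TangentSpace (𝓡 n) x} (hv : LinearIndependent ℝ v) :
    ∃ t : ι → M → ℝ, (∀ a, SmoothFun n (t a)) ∧ (∀ a, t a x = 0) ∧
      ∀ a b, mvfderiv (𝓡 n) (t b) x (v a) = if a = b then 1 else 0 := by
  have hker : (Finsupp.linearCombination ℝ v).ker = ⊥ :=
    LinearMap.ker_eq_bot.2 hv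
  have h : ∀ b, ∃ f : M → ℝ, SmoothFun n f ∧ f x = 0 ∧
      ∀ w, mvfderiv (𝓡 n) f x w
        = (Finsupp.lapply b ∘ₗ (Finsupp.linearCombination ℝ v).leftInverse) w :=
    fun b => exists_smooth_mvfderiv_eq x _
  choose t h1 h2 h3 using h
  refine ⟨t, h1, h2, fun a b => ?_⟩
  have := LinearMap.leftInverse_apply_of_inj hker (Finsupp.single a 1)
  rw [Finsupp.linearCombination_single, one_smul] at this
  rw [h3, LinearMap.comp_apply, this, Finsupp.lapply_apply, Finsupp.single_apply]

variable [T2Space M] {ι : Type*} [Fintype ι] [DecidableEq ι]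

/-- The matrix `(E a) (t b)` for functions `t` dual at `x` to the fields `E`. -/
theorem exists_dual_matrix {U : Set M} (hU : IsOpen U) {x : M} (hx : x ∈ U) {E : ι → VField n M}
    (hE : ∀ a, (E a).SmoothOn U) (hli : LinearIndependent ℝ fun a => E a x) :
    ∃ t : ι → M → ℝ, (∀ a, SmoothFun n (t a)) ∧
      (∀ a b, ContMDiffAt (𝓡 n) 𝓘(ℝ, ℝ) ∞ (fun y => (E a).der (t b) y) x) ∧
      ∀ᶠ y in 𝓝 x, (Matrix.of fun a b => (E b).der (t a) y).det ≠ 0 := by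
  obtain ⟨t, ht, -, htd⟩ := exists_dual_functions hli
  have hsm : ∀ a b, ContMDiffAt (𝓡 n) 𝓘(ℝ, ℝ) ∞ (fun y => (E a).der (t b) y) x := fun a b =>
    ((hE a).der hU ((ht b).contMDiffOn)).contMDiffAt (hU.mem_nhds hx)
  refine ⟨t, ht, hsm, ?_⟩
  have hdet : ContMDiffAt (𝓡 n) 𝓘(ℝ, ℝ) ∞
      (fun y => (Matrix.of fun a b => (E b).der (t a) y).det) x :=
    contMDiffAt_det fun a b => hsm b a
  refine hdet.continuousAt.eventually_ne ?_
  have : (Matrix.of fun a b => (E b).der (t a) x) = 1 := by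
    ext a b
    simp only [Matrix.of_apply, Matrix.one_apply, VField.der, htd, eq_comm]
  rw [this, Matrix.det_one]
  exact one_ne_zero

/-- For functions dual to the frame at x, the matrix of their derivatives along the frame is the
identity at x, hence invertible nearby. Any linear relation lies in its kernel. -/
theorem eventually_linearIndependent {U : Set M} (hU : IsOpen U) {x : M} (hx : x ∈ U)
    {E : ι → VField n M} (hE : ∀ a, (E a).SmoothOn U)
    (hli : LinearIndependent ℝ fun a => E a x) :
    ∀ᶠ y in 𝓝 x, LinearIndependent ℝ fun a => E a y := by
  obtain ⟨t, -, -, hdet⟩ := exists_dual_matrix hU hx hE hli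
  filter_upwards [hdet] with y hy
  rw [Fintype.linearIndependent_iff]
  intro c hc
  have h : (Matrix.of fun a b => (E b).der (t a) y).mulVec c = 0 := by
    funext a
    have := congrArg (mvfderiv (𝓡 n) (t a) y) hc
    simp only [map_sum, map_smul, map_zero, smul_eq_mul] at this
    simp only [Matrix.mulVec, dotProduct, Matrix.of_apply, VField.der, Pi.zero_apply]
    rw [← this]
    exact Finset.sum_congr rfl fun _ _ => mul_comm _ _
  intro a
  exact congrFun (Matrix.eq_zero_of_mulVec_eq_zero hy h) a

/-- The coefficients of a smooth field in a smooth frame are smooth. -/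
theorem contMDiffAt_coeff {U : Set M} (hU : IsOpen U) {x : M} (hx : x ∈ U)
    {E : ι → VField n M} (hE : ∀ a, (E a).SmoothOn U)
    (hli : LinearIndependent ℝ fun a => E a x) {V : VField n M} (hV : V.SmoothOn U)
    {u : ι → M → ℝ} (hu : ∀ᶠ y in 𝓝 x, V y = ∑ a, u a y • E a y) (a : ι) :
    ContMDiffAt (𝓡 n) 𝓘(ℝ, ℝ) ∞ (u a) x := by
  obtain ⟨t, ht, hsm, hdet⟩ := exists_dual_matrix hU hx hE hli
  have hsmV : ∀ b, ContMDiffAt (𝓡 n) 𝓘(ℝ, ℝ) ∞ (fun y => V.der (t b) y) x := fun b =>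
    (hV.der hU ((ht b).contMDiffOn)).contMDiffAt (hU.mem_nhds hx)
  -- Cramer's rule: the coefficient is a quotient of determinants whose entries are derivatives of
  -- the dual functions.
  have h1 : ContMDiffAt (𝓡 n) 𝓘(ℝ, ℝ) ∞
      (fun y => ((Matrix.of fun a b => (E b).der (t a) y).updateCol a
        fun b => V.der (t b) y).det) x := by
    refine contMDiffAt_det fun i j => ?_
    by_cases hj : j = a
    · subst hj; simpa using hsmV i
    · simpa [hj] using hsm j i
  have h2 : ContMDiffAt (𝓡 n) 𝓘(ℝ, ℝ) ∞
      (fun y => (Matrix.of fun a b => (E b).der (t a) y).det) x :=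
    contMDiffAt_det fun a b => hsm b a
  have h3 := h1.div₀ h2 hdet.self_of_nhds
  refine h3.congr_of_eventuallyEq ?_
  filter_upwards [hdet, hu] with y hy hVy
  have hmul : (Matrix.of fun a b => (E b).der (t a) y).mulVec (fun b => u b y)
      = fun b => V.der (t b) y := by
    funext b
    simp only [Matrix.mulVec, dotProduct, Matrix.of_apply, VField.der, hVy, map_sum, map_smul,
      smul_eq_mul]
    exact Finset.sum_congr rfl fun _ _ => mul_comm _ _
  rw [Pi.div_apply, eq_div_iff hy, ← Matrix.cramer_apply, ← hmul, Matrix.cramer_eq_adjugate_mulVec,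
    Matrix.mulVec_mulVec, Matrix.adjugate_mul, Matrix.smul_mulVec, Matrix.one_mulVec]
  simp [mul_comm]

end SmoothAlgebra

/-! ### Leibniz rules for brackets and locally constant functions -/

section Brackets

variable {n : ℕ} {M : Type*} [TopologicalSpace M] [ChartedSpace (EuclideanSpace ℝ (Fin n)) M]

instance finiteDimensional_tangentSpace (x : M) : FiniteDimensional ℝ (TangentSpace (𝓡 n) x) :=
  inferInstanceAs (FiniteDimensional ℝ (EuclideanSpace ℝ (Fin n)))

theorem finrank_tangentSpace (x : M) : Module.finrank ℝ (TangentSpace (𝓡 n) x) = n :=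
  finrank_euclideanSpace_fin

theorem VField.der_sum_smul {ι : Type*} [Fintype ι] {W : VField n M} {E : ι → VField n M}
    {u : ι → ℝ} {f : M → ℝ} {x : M} (h : W x = ∑ a, u a • E a x) :
    W.der f x = ∑ a, u a * (E a).der f x := by
  simp only [VField.der, h, map_sum, map_smul, smul_eq_mul]

theorem VField.bracket_swap (V W : VField n M) (x : M) : V.bracket W x = -W.bracket V x :=
  VectorField.mlieBracket_swap_apply

variable [IsManifold (𝓡 n) ∞ M]

theorem VField.SmoothOn.mono {U U' : Set M} {V : VField n M} (hV : V.SmoothOn U) (h : U' ⊆ U) :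
    V.SmoothOn U' :=
  ContMDiffOn.mono hV h

theorem VField.SmoothOn.congr {U : Set M} {V W : VField n M} (hV : V.SmoothOn U)
    (h : ∀ y ∈ U, W y = V y) : W.SmoothOn U :=
  ContMDiffOn.congr hV fun y hy => by rw [h y hy]

theorem smoothOn_sum {ι : Type*} [Fintype ι] {U : Set M} {E : ι → VField n M}
    (hE : ∀ a, (E a).SmoothOn U) (u : ι → smoothAlg n U) :
    VField.SmoothOn (fun y => ∑ a, (u a : M → ℝ) y • E a y : VField n M) U := by
  have : IsManifold (𝓡 n) 1 M := inferInstance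
  exact ContMDiffOn.sum_section fun a _ => ContMDiffOn.smul_section (u a).2 (hE a)

/-- Leibniz rule for the bracket with a linear combination of fields. -/
theorem bracket_sum_left [T2Space M] {ι : Type*} [Fintype ι] {U : Set M} (hU : IsOpen U)
    {E : ι → VField n M} (hE : ∀ a, (E a).SmoothOn U) (u : ι → smoothAlg n U)
    {V W : VField n M} (hV : V.SmoothOn U) (hW : ∀ y ∈ U, W y = ∑ a, (u a : M → ℝ) y • E a y)
    {x : M} (hx : x ∈ U) :
    W.bracket V x = ∑ a, (u a : M → ℝ) x • (E a).bracket V x - ∑ a, V.der (u a) x • E a x := by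
  have hWs : W.SmoothOn U := (smoothOn_sum hE u).congr hW
  refine tangent_ext fun f hf => ?_
  let F : smoothAlg n U := ⟨f, hf.contMDiffOn⟩
  have hder : ∀ g : smoothAlg n U, W.toDerivation hU hWs g
      = ∑ a, u a * (E a).toDerivation hU (hE a) g := by
    intro g
    ext y
    simp only [AddSubmonoidClass.coe_finsetSum, Finset.sum_apply, MulMemClass.coe_mul, Pi.mul_apply]
    by_cases hy : y ∈ U
    · rw [W.toDerivation_apply hU hWs g hy, VField.der_sum_smul (hW y hy)]
      exact Finset.sum_congr rfl fun a _ => by rw [(E a).toDerivation_apply hU (hE a) g hy]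
    · rw [W.toDerivation_apply_of_notMem hU hWs g hy]
      exact (Finset.sum_eq_zero fun a _ => by
        rw [(E a).toDerivation_apply_of_notMem hU (hE a) g hy, mul_zero]).symm
  have h1 := VField.bracket_der_apply hU hWs hV F hx
  have h2 : ∀ a, ((E a).bracket V).der f x = _ := fun a =>
    VField.bracket_der_apply hU (hE a) hV F hx
  change (W.bracket V).der f x = _
  rw [h1, hder, hder]
  simp only [map_sub, map_sum, map_smul, smul_eq_mul, Derivation.leibniz]
  change _ = ∑ a, (u a : M → ℝ) x * ((E a).bracket V).der f x
    - ∑ a, V.der (u a) x * (E a).der f x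
  simp only [h2, AddSubmonoidClass.coe_finsetSum, Finset.sum_apply, MulMemClass.coe_mul,
    Pi.mul_apply, AddMemClass.coe_add, Pi.add_apply, ← Finset.sum_sub_distrib]
  refine Finset.sum_congr rfl fun a _ => ?_
  rw [V.toDerivation_apply hU hV (u a) hx, (E a).toDerivation_apply hU (hE a) F hx]
  change _ = _ - V.der (u a) x * (E a).der f x
  ring

theorem bracket_sum_right [T2Space M] {ι : Type*} [Fintype ι] {U : Set M} (hU : IsOpen U)
    {E : ι → VField n M} (hE : ∀ a, (E a).SmoothOn U) (u : ι → smoothAlg n U)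
    {V W : VField n M} (hV : V.SmoothOn U) (hW : ∀ y ∈ U, W y = ∑ a, (u a : M → ℝ) y • E a y)
    {x : M} (hx : x ∈ U) :
    V.bracket W x = ∑ a, (u a : M → ℝ) x • V.bracket (E a) x + ∑ a, V.der (u a) x • E a x := by
  rw [V.bracket_swap, bracket_sum_left hU hE u hV hW hx, neg_sub, sub_eq_add_neg, add_comm,
    ← Finset.sum_neg_distrib]
  congr 1
  exact Finset.sum_congr rfl fun a _ => by rw [V.bracket_swap (E a), smul_neg]

/-- A function with vanishing differential on an open set is locally constant there. -/
theorem eventually_eq_of_mvfderiv_eq_zero {U : Set M} (hU : IsOpen U) {x : M} (hx : x ∈ U)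
    {f : M → ℝ} (hf : ContMDiffOn (𝓡 n) 𝓘(ℝ, ℝ) ∞ f U)
    (h0 : ∀ y ∈ U, ∀ v, mvfderiv (𝓡 n) f y v = 0) : ∀ᶠ y in 𝓝 x, f y = f x := by
  set φ := extChartAt (𝓡 n) x with hφ
  have hnear : ∀ᶠ y in 𝓝 (φ x), y ∈ φ.target ∧ φ.symm y ∈ U := by
    refine Filter.Eventually.and
      ((isOpen_extChartAt_target x).mem_nhds (mem_extChartAt_target x)) ?_
    exact (continuousAt_extChartAt_symm x).preimage_mem_nhds
      (by rw [extChartAt_to_inv]; exact hU.mem_nhds hx)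
  obtain ⟨r, hr, hball⟩ := Metric.eventually_nhds_iff_ball.1 hnear
  have hd : ∀ y ∈ Metric.ball (φ x) r, HasFDerivAt (f ∘ φ.symm) (0 : _ →L[ℝ] ℝ) y := by
    intro y hy
    have hfy : MDifferentiableAt (𝓡 n) 𝓘(ℝ, ℝ) f (φ.symm y) :=
      (hf.contMDiffAt (hU.mem_nhds (hball y hy).2)).mdifferentiableAt (by simp)
    have hs := mdifferentiableAt_chart_symm (hball y hy).1
    have hdiff : DifferentiableAt ℝ (f ∘ φ.symm) y :=
      mdifferentiableAt_iff_differentiableAt.1 (hfy.comp y hs)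
    convert! hdiff.hasFDerivAt using 1
    ext v
    have := mfderiv_comp_apply y hfy hs v
    rw [mfderiv_eq_fderiv] at this
    exact ((h0 _ (hball y hy).2 _).symm.trans this.symm)
  have hmem : ∀ᶠ y in 𝓝 x, y ∈ φ.source ∧ φ y ∈ Metric.ball (φ x) r :=
    Filter.Eventually.and (extChartAt_source_mem_nhds x)
      ((continuousAt_extChartAt x).preimage_mem_nhds (Metric.ball_mem_nhds _ hr))
  filter_upwards [hmem] with y hy
  have h1 := Metric.isOpen_ball.is_const_of_fderiv_eq_zero (𝕜 := ℝ)
    (convex_ball (φ x) r).isPreconnected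
    (fun z hz => (hd z hz).differentiableAt.differentiableWithinAt)
    (fun z hz => (hd z hz).fderiv) hy.2 (Metric.mem_ball_self hr)
  have h2 : f (φ.symm (φ y)) = f (φ.symm (φ x)) := h1
  rwa [φ.left_inv hy.1, extChartAt_to_inv] at h2

end Brackets

/-! ### Injectivity of evaluation on the transverse symmetries -/

section Injectivity

variable {n d : ℕ} {M : Type*} [TopologicalSpace M] [ChartedSpace (EuclideanSpace ℝ (Fin n)) M]
  [IsManifold (𝓡 n) ∞ M]

theorem IterBracket.smoothOn {Hor : ∀ x : M, Submodule ℝ (TangentSpace (𝓡 n) x)} {Y : VField n M}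
    (hY : IterBracket Hor Y) : Y.SmoothOn Set.univ := by
  induction hY with
  | horizontal X hX _ => exact hX
  | bracket X Y _ _ ihX ihY => exact ihX.bracket isOpen_univ ihY

/-- A function annihilated by the horizontal fields has vanishing differential. -/
theorem SubRiemannianStructure.mvfderiv_eq_zero (S : SubRiemannianStructure n d M) {U : Set M}
    (hU : IsOpen U) {f : M → ℝ} (hf : ContMDiffOn (𝓡 n) 𝓘(ℝ, ℝ) ∞ f U)
    (h0 : ∀ X : VField n M, X.SmoothOn Set.univ → (∀ y, X y ∈ S.Hor y) → ∀ y ∈ U, X.der f y = 0)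
    {x : M} (hx : x ∈ U) (v : TangentSpace (𝓡 n) x) : mvfderiv (𝓡 n) f x v = 0 := by
  have key : ∀ Y : VField n M, IterBracket S.Hor Y → ∀ y ∈ U, Y.der f y = 0 := by
    intro Y hY
    induction hY with
    | horizontal X hX hH => exact h0 X hX hH
    | bracket X Y hX hY ihX ihY =>
      intro y hy
      have hz : ∀ W : VField n M, (∀ z ∈ U, W.der f z = 0) → W.der f =ᶠ[𝓝 y] fun _ => 0 :=
        fun W hW => Filter.eventually_of_mem (hU.mem_nhds hy) hW
      have hXs := hX.smoothOn.mono (Set.subset_univ U)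
      have hYs := hY.smoothOn.mono (Set.subset_univ U)
      rw [VField.der_bracket hU hy hXs hYs hf
        (((hXs.der hU hf).contMDiffAt (hU.mem_nhds hy)).mdifferentiableAt (by simp))
        (((hYs.der hU hf).contMDiffAt (hU.mem_nhds hy)).mdifferentiableAt (by simp)),
        X.der_congr rfl (hz Y ihY), Y.der_congr rfl (hz X ihX), X.der_const, Y.der_const, sub_zero]
  have hspan : v ∈ Submodule.span ℝ
      {v : TangentSpace (𝓡 n) x | ∃ Y : VField n M, IterBracket S.Hor Y ∧ Y x = v} := by
    rw [S.bracket_generating x]; trivial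
  induction hspan using Submodule.span_induction with
  | mem v hv =>
    obtain ⟨Y, hY, rfl⟩ := hv
    exact key Y hY x hx
  | zero => exact map_zero _
  | add v w _ _ hv hw => rw [map_add, hv, hw, add_zero]
  | smul c v _ hv => rw [map_smul, hv, smul_zero]

theorem VField.isClosed_zero [T2Space M] {Z : VField n M} (hZ : Z.SmoothOn Set.univ) :
    IsClosed {x | Z x = 0} := by
  rw [← isOpen_compl_iff, isOpen_iff_mem_nhds]
  intro x hx
  have hx' : Z x ≠ 0 := hx
  obtain ⟨l, hl⟩ : ∃ l : Module.Dual ℝ (TangentSpace (𝓡 n) x), l (Z x) ≠ 0 := by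
    by_contra! h
    exact hx' ((Module.forall_dual_apply_eq_zero_iff ℝ _).1 h)
  obtain ⟨f, hf, -, hfl⟩ := exists_smooth_mvfderiv_eq x l
  have hc : ContinuousAt (Z.der f) x :=
    ((hZ.der isOpen_univ hf.contMDiffOn).contMDiffAt Filter.univ_mem).continuousAt
  have hne : Z.der f x ≠ 0 := by rw [VField.der, hfl]; exact hl
  filter_upwards [hc.eventually_ne hne] with y hy h0
  exact hy (by rw [VField.der, h0, map_zero])

namespace TransverseSymmetries

variable {h : ℕ} (S : TransverseSymmetries n d M h)

theorem frame_linearIndependent {x : M} {X : Fin d → VField n M} {U : Set M} (hx : x ∈ U)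
    (hX : IsOrthonormalFrameOn S.Hor S.g X U) : LinearIndependent ℝ fun i => X i x := by
  rw [Fintype.linearIndependent_iff]
  intro c hc i
  have := congrArg (fun v => S.g x v (X i x)) hc
  simpa [hX.orthonormal x hx] using this

theorem finrank_hor (x : M) : Module.finrank ℝ (S.Hor x) = d := by
  obtain ⟨X, U, -, hx, hX⟩ := S.exists_frame x
  rw [← hX.span_eq x hx, finrank_span_eq_card (S.frame_linearIndependent hx hX), Fintype.card_fin]

theorem finrank_ver (x : M) : d + Module.finrank ℝ (S.V.map (LinearMap.proj x)) = n := by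
  have := Submodule.finrank_add_eq_of_isCompl (S.isCompl x)
  rwa [S.finrank_hor, finrank_tangentSpace] at this

/-- All V(y) have the same dimension n - d, so fields W_a ∈ V forming a basis of V(x) remain bases
of V(y) near x, and Z = ∑ u_a W_a. For horizontal X the brackets [Z, X] and [W_a, X] are horizontal,
so ∑ (X u_a) W_a is both horizontal and vertical, hence zero. Bracket generation makes each u_a
locally constant, and u_a vanishes at x. -/
theorem eventually_eq_zero [T2Space M] {Z : VField n M} (hZ : Z ∈ S.V) {x : M} (hx : Z x = 0) :
    ∀ᶠ y in 𝓝 x, Z y = 0 := by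
  classical
  set k := Module.finrank ℝ (S.V.map (LinearMap.proj x)) with hk
  let B := Module.finBasis ℝ (S.V.map (LinearMap.proj x))
  have hB : ∀ a, ∃ W : VField n M, W ∈ S.V ∧ W x = B a := by
    intro a
    obtain ⟨W, hW, hWx⟩ := (B a).2
    exact ⟨W, hW, hWx⟩
  choose W hWV hWx using hB
  have hWs : ∀ a, (W a).SmoothOn Set.univ := fun a => (S.killing _ (hWV a)).smooth
  have hZs := (S.killing _ hZ).smooth
  have hli : LinearIndependent ℝ fun a => W a x := by
    simp only [hWx]
    exact B.linearIndependent.map' (Submodule.subtype _) (Submodule.ker_subtype _)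
  have hspan : ∀ᶠ y in 𝓝 x, LinearIndependent ℝ (fun a => W a y) ∧
      ∃ u : Fin k → ℝ, Z y = ∑ a, u a • W a y := by
    filter_upwards [eventually_linearIndependent isOpen_univ (Set.mem_univ x) hWs hli] with y hy
    refine ⟨hy, ?_⟩
    have hle : Submodule.span ℝ (Set.range fun a => W a y) ≤ S.V.map (LinearMap.proj y) := by
      rw [Submodule.span_le]
      rintro _ ⟨a, rfl⟩
      exact ⟨W a, hWV a, rfl⟩
    have heq := Submodule.eq_of_le_of_finrank_eq hle (by
      rw [finrank_span_eq_card hy, Fintype.card_fin]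
      have h1 := S.finrank_ver x
      have h2 := S.finrank_ver y
      omega)
    have hmem : Z y ∈ Submodule.span ℝ (Set.range fun a => W a y) := by
      rw [heq]; exact ⟨Z, hZ, rfl⟩
    obtain ⟨u, hu⟩ := (Submodule.mem_span_range_iff_exists_fun ℝ).1 hmem
    exact ⟨u, hu.symm⟩
  obtain ⟨U, hUsub, hU, hxU⟩ := eventually_nhds_iff.1 hspan
  have hUli := fun y hy => (hUsub y hy).1
  have hUu := fun y hy => (hUsub y hy).2
  choose! u hu using hUu
  have hus : ∀ a, ContMDiffOn (𝓡 n) 𝓘(ℝ, ℝ) ∞ (fun y => u y a) U := by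
    intro a y hy
    refine (contMDiffAt_coeff hU hy (fun a => (hWs a).mono (Set.subset_univ U)) (hUli y hy)
      (hZs.mono (Set.subset_univ U)) (u := fun a y => u y a) ?_ a).contMDiffWithinAt
    exact Filter.eventually_of_mem (hU.mem_nhds hy) hu
  have hder : ∀ X : VField n M, X.SmoothOn Set.univ → (∀ y, X y ∈ S.Hor y) → ∀ a, ∀ y ∈ U,
      X.der (fun y => u y a) y = 0 := by
    intro X hX hXH a y hy
    have hXU := hX.mono (Set.subset_univ U)
    have hbr := bracket_sum_left hU (fun a => (hWs a).mono (Set.subset_univ U))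
      (fun a => ⟨fun y => u y a, hus a⟩) hXU hu hy
    have hZX := (S.killing _ hZ).bracket_mem U X hU hXU (fun y _ => hXH y) y hy
    have hWX : ∀ a, (W a).bracket X y ∈ S.Hor y := fun a =>
      (S.killing _ (hWV a)).bracket_mem U X hU hXU (fun y _ => hXH y) y hy
    have hH : ∑ a, X.der (fun y => u y a) y • W a y ∈ S.Hor y := by
      have : ∑ a, X.der (fun y => u y a) y • W a y
          = ∑ a, u y a • (W a).bracket X y - Z.bracket X y := by
        rw [hbr]; exact (sub_sub_cancel _ _).symm
      rw [this]
      exact Submodule.sub_mem _ (Submodule.sum_mem _ fun a _ => Submodule.smul_mem _ _ (hWX a)) hZX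
    have hV : ∑ a, X.der (fun y => u y a) y • W a y ∈ S.V.map (LinearMap.proj y) :=
      Submodule.sum_mem _ fun a _ => Submodule.smul_mem _ _ ⟨W a, hWV a, rfl⟩
    have h0 := Submodule.disjoint_def.1 (S.isCompl y).disjoint _ hH hV
    exact Fintype.linearIndependent_iff.1 (hUli y hy) _ h0 a
  have hconst : ∀ a, ∀ᶠ y in 𝓝 x, u y a = 0 := by
    intro a
    have hux : u x a = 0 :=
      Fintype.linearIndependent_iff.1 (hUli x hxU) _ ((hu x hxU).symm.trans hx) a
    have := eventually_eq_of_mvfderiv_eq_zero hU hxU (hus a) fun y hy v =>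
      S.mvfderiv_eq_zero hU (hus a) (fun X hX hXH => hder X hX hXH a) hy v
    filter_upwards [this] with y hy
    rw [hy, hux]
  filter_upwards [hU.mem_nhds hxU, Filter.eventually_all.2 hconst] with y hy h0
  rw [hu y hy]
  exact Finset.sum_eq_zero fun a _ => by rw [h0 a, zero_smul]

/-- Evaluation of the transverse symmetries at a point is injective. -/
theorem ker_evalV [T2Space M] [ConnectedSpace M] (x : M) : (S.evalV x).ker = ⊥ := by
  rw [LinearMap.ker_eq_bot']
  rintro ⟨Z, hZ⟩ hx
  -- The zero set of Z is closed and, by `eventually_eq_zero`, open. On a connected manifold one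
  -- zero therefore forces Z = 0.
  have hcl : IsClopen {y | Z y = 0} := ⟨VField.isClosed_zero (S.killing _ hZ).smooth,
    isOpen_iff_mem_nhds.2 fun y hy => S.eventually_eq_zero hZ hy⟩
  have := hcl.eq_univ ⟨x, hx⟩
  ext1
  funext y
  exact (this ▸ Set.mem_univ y : y ∈ {y | Z y = 0})

end TransverseSymmetries

end Injectivity

namespace TransverseSymmetries

variable {n d h : ℕ} {M : Type*} [TopologicalSpace M] [ChartedSpace (EuclideanSpace ℝ (Fin n)) M]
  [IsManifold (𝓡 n) ∞ M] (S : TransverseSymmetries n d M h)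

/-! ### Pointwise linear algebra in an adapted frame -/

theorem smoothOn_Z (m : Fin h) (U : Set M) : (S.Z m).SmoothOn U :=
  (S.killing _ (S.Zbasis m).2).smooth.mono (Set.subset_univ U)

theorem Z_mem (m : Fin h) (y : M) : S.Z m y ∈ S.V.map (LinearMap.proj y) :=
  ⟨S.Z m, (S.Zbasis m).2, rfl⟩

variable {X : Fin d → VField n M} {U : Set M}

theorem frame_mem (hX : IsOrthonormalFrameOn S.Hor S.g X U) {y : M} (hy : y ∈ U) (i : Fin d) :
    X i y ∈ S.Hor y := by
  rw [← hX.span_eq y hy]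
  exact Submodule.subset_span ⟨i, rfl⟩

/-- Expansion of a horizontal vector in an orthonormal frame. -/
theorem sum_g_smul (hX : IsOrthonormalFrameOn S.Hor S.g X U) {y : M} (hy : y ∈ U)
    {v : TangentSpace (𝓡 n) y} (hv : v ∈ S.Hor y) : ∑ k, S.g y v (X k y) • X k y = v := by
  rw [← hX.span_eq y hy] at hv
  obtain ⟨c, rfl⟩ := (Submodule.mem_span_range_iff_exists_fun ℝ).1 hv
  refine Finset.sum_congr rfl fun k _ => ?_
  congr 1
  simp [hX.orthonormal y hy]

/-- The horizontal gradient of a functional does not depend on the orthonormal frame. -/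
theorem sum_dual_smul (hX : IsOrthonormalFrameOn S.Hor S.g X U) {y : M} (hy : y ∈ U)
    {F : Fin d → VField n M} {U' : Set M} (hF : IsOrthonormalFrameOn S.Hor S.g F U') (hy' : y ∈ U')
    (l : TangentSpace (𝓡 n) y →ₗ[ℝ] ℝ) :
    ∑ k, l (F k y) • F k y = ∑ k, l (X k y) • X k y := by
  have h1 : ∀ k, l (F k y) = ∑ j, S.g y (F k y) (X j y) * l (X j y) := by
    intro k
    conv_lhs => rw [← S.sum_g_smul hX hy (S.frame_mem hF hy' k)]
    simp only [map_sum, map_smul, smul_eq_mul]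
  simp only [h1, Finset.sum_smul]
  rw [Finset.sum_comm]
  refine Finset.sum_congr rfl fun j _ => ?_
  have h2 := congrArg (fun w => l (X j y) • w) (S.sum_g_smul hF hy' (S.frame_mem hX hy j))
  refine Eq.trans ?_ h2
  simp only [Finset.smul_sum]
  refine Finset.sum_congr rfl fun k _ => ?_
  rw [S.g_symm y _ (S.frame_mem hX hy j) _ (S.frame_mem hF hy' k), smul_smul, mul_comm]

theorem projH_mem (y : M) (v : TangentSpace (𝓡 n) y) : S.projH y v ∈ S.Hor y :=
  Subtype.coe_prop _

theorem projH_add_vertical {y : M} {v w : TangentSpace (𝓡 n) y} (hv : v ∈ S.Hor y)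
    (hw : w ∈ S.V.map (LinearMap.proj y)) : S.projH y (v + w) = v := by
  unfold projH
  rw [map_add, (Submodule.projectionOnto_apply_eq_zero_iff _).2 hw, add_zero]
  exact congrArg Subtype.val (Submodule.projectionOnto_apply_left (S.isCompl y) ⟨v, hv⟩)

theorem projH_of_mem {y : M} {v : TangentSpace (𝓡 n) y} (hv : v ∈ S.Hor y) : S.projH y v = v := by
  simpa using S.projH_add_vertical hv (Submodule.zero_mem _)

theorem exists_sum_Z {y : M} {w : TangentSpace (𝓡 n) y} (hw : w ∈ S.V.map (LinearMap.proj y)) :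
    ∃ α : Fin h → ℝ, w = ∑ m, α m • S.Z m y := by
  obtain ⟨Z, hZ, rfl⟩ := hw
  refine ⟨S.Zbasis.repr ⟨Z, hZ⟩, ?_⟩
  have := congrArg (S.evalV y) (S.Zbasis.sum_repr ⟨Z, hZ⟩)
  simp only [map_sum, map_smul] at this
  exact this.symm

/-- The fields `X₁, …, X_d, Z₁, …, Z_h`. -/
def adapted (X : Fin d → VField n M) : Fin d ⊕ Fin h → VField n M := Sum.elim X S.Z

theorem smoothOn_adapted (hX : IsOrthonormalFrameOn S.Hor S.g X U) (a : Fin d ⊕ Fin h) :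
    (S.adapted X a).SmoothOn U := by
  cases a with
  | inl i => exact hX.smooth i
  | inr m => exact S.smoothOn_Z m U

theorem sum_frame_mem (hX : IsOrthonormalFrameOn S.Hor S.g X U) {y : M} (hy : y ∈ U)
    (a : Fin d → ℝ) : ∑ i, a i • X i y ∈ S.Hor y :=
  Submodule.sum_mem _ fun i _ => Submodule.smul_mem _ _ (S.frame_mem hX hy i)

theorem projH_neg (y : M) (v : TangentSpace (𝓡 n) y) : S.projH y (-v) = -S.projH y v := by
  simp [projH]

theorem vertCoord_neg (y : M) (v : TangentSpace (𝓡 n) y) (m : Fin h) :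
    S.vertCoord y (-v) m = -S.vertCoord y v m := by
  unfold vertCoord
  rw [S.projH_neg, neg_sub_neg, ← neg_sub, map_neg, map_neg, Finsupp.neg_apply]

theorem bracket_Z_mem (hU : IsOpen U) (hX : IsOrthonormalFrameOn S.Hor S.g X U) (m : Fin h)
    (i : Fin d) : ∀ y ∈ U, (S.Z m).bracket (X i) y ∈ S.Hor y :=
  (S.killing _ (S.Zbasis m).2).bracket_mem U (X i) hU (hX.smooth i)
    fun _ hy => S.frame_mem hX hy i

variable [T2Space M] [ConnectedSpace M]

/-- `leftInverse` inverts evaluation only because evaluation is injective. This is where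
connectedness enters the frame calculus. -/
theorem vertCoord_add {y : M} {v : TangentSpace (𝓡 n) y} (hv : v ∈ S.Hor y) (α : Fin h → ℝ)
    (m : Fin h) : S.vertCoord y (v + ∑ l, α l • S.Z l y) m = α m := by
  have hw : ∑ l, α l • S.Z l y ∈ S.V.map (LinearMap.proj y) :=
    Submodule.sum_mem _ fun l _ => Submodule.smul_mem _ _ (S.Z_mem l y)
  unfold vertCoord
  rw [S.projH_add_vertical hv hw, add_sub_cancel_left]
  have h1 : ∑ l, α l • S.Z l y = S.evalV y (∑ l, α l • S.Zbasis l) := by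
    simp only [map_sum, map_smul]; rfl
  rw [h1, LinearMap.leftInverse_apply_of_inj (S.ker_evalV y), Module.Basis.repr_sum_self]

theorem projH_add_sum_vertCoord (y : M) (v : TangentSpace (𝓡 n) y) :
    v = S.projH y v + ∑ m, S.vertCoord y v m • S.Z m y := by
  have hmem : v - S.projH y v ∈ S.V.map (LinearMap.proj y) := by
    rw [← Submodule.projectionOnto_apply_eq_zero_iff (S.isCompl y), map_sub, sub_eq_zero]
    exact (Submodule.projectionOnto_apply_left (S.isCompl y) _).symm
  obtain ⟨α, hα⟩ := S.exists_sum_Z hmem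
  have hv : v = S.projH y v + ∑ m, α m • S.Z m y := by rw [← hα]; abel
  have h2 : S.vertCoord y v = α := by
    funext m
    conv_lhs => rw [hv]
    exact S.vertCoord_add (S.projH_mem y v) α m
  rw [h2]; exact hv

theorem eq_sum_frame (hX : IsOrthonormalFrameOn S.Hor S.g X U) {y : M} (hy : y ∈ U)
    (v : TangentSpace (𝓡 n) y) :
    v = ∑ k, S.g y (S.projH y v) (X k y) • X k y + ∑ m, S.vertCoord y v m • S.Z m y := by
  conv_lhs => rw [S.projH_add_sum_vertCoord y v, ← S.sum_g_smul hX hy (S.projH_mem y v)]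

theorem linearIndependent_Z (y : M) : LinearIndependent ℝ fun m => S.Z m y :=
  S.Zbasis.linearIndependent.map' (S.evalV y) (S.ker_evalV y)

theorem linearIndependent_adapted (hX : IsOrthonormalFrameOn S.Hor S.g X U) {y : M} (hy : y ∈ U) :
    LinearIndependent ℝ fun a => S.adapted X a y := by
  have h1 := (S.frame_linearIndependent hy hX).sum_type (S.linearIndependent_Z y) (by
    refine (S.isCompl y).disjoint.mono ?_ ?_
    · exact (hX.span_eq y hy).le
    · rw [Submodule.span_le]
      rintro _ ⟨m, rfl⟩
      exact S.Z_mem m y)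
  convert! h1 using 1
  funext a
  cases a <;> rfl

/-! ### Fields with smooth coefficients -/

/-- `V = ∑ a i • X i + ∑ α m • Z m` on `U`. -/
def IsComb (X : Fin d → VField n M) (V : VField n M) (a : Fin d → smoothAlg n U)
    (α : Fin h → smoothAlg n U) : Prop :=
  ∀ y ∈ U, V y = ∑ i, (a i : M → ℝ) y • X i y + ∑ m, (α m : M → ℝ) y • S.Z m y

theorem coeff_mem (hU : IsOpen U) (hX : IsOrthonormalFrameOn S.Hor S.g X U) {V : VField n M}
    (hV : V.SmoothOn U) :
    (∀ k, (U.indicator fun y => S.g y (S.projH y (V y)) (X k y)) ∈ smoothAlg n U) ∧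
      ∀ m, (U.indicator fun y => S.vertCoord y (V y) m) ∈ smoothAlg n U := by
  have key : ∀ y ∈ U, ∀ a, ContMDiffAt (𝓡 n) 𝓘(ℝ, ℝ) ∞
      ((Sum.elim (fun k y => S.g y (S.projH y (V y)) (X k y))
        (fun m y => S.vertCoord y (V y) m) : Fin d ⊕ Fin h → M → ℝ) a) y := by
    intro y hy
    refine contMDiffAt_coeff hU hy (S.smoothOn_adapted hX) (S.linearIndependent_adapted hX hy) hV ?_
    filter_upwards [hU.mem_nhds hy] with z hz
    rw [Fintype.sum_sum_type]
    exact S.eq_sum_frame hX hz (V z)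
  exact ⟨fun k => smoothAlg.indicator_mem fun y hy => (key y hy (Sum.inl k)).contMDiffWithinAt,
    fun m => smoothAlg.indicator_mem fun y hy => (key y hy (Sum.inr m)).contMDiffWithinAt⟩

variable (hU : IsOpen U) (hX : IsOrthonormalFrameOn S.Hor S.g X U)

/-- The horizontal components of a smooth field. -/
def coeffH {V : VField n M} (hV : V.SmoothOn U) (k : Fin d) : smoothAlg n U :=
  ⟨U.indicator fun y => S.g y (S.projH y (V y)) (X k y), (S.coeff_mem hU hX hV).1 k⟩

/-- The vertical components of a smooth field. -/
def coeffV {V : VField n M} (hV : V.SmoothOn U) (m : Fin h) : smoothAlg n U :=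
  ⟨U.indicator fun y => S.vertCoord y (V y) m, (S.coeff_mem hU hX hV).2 m⟩

theorem coeffH_apply {V : VField n M} (hV : V.SmoothOn U) (k : Fin d) {y : M} (hy : y ∈ U) :
    (S.coeffH hU hX hV k : M → ℝ) y = S.g y (S.projH y (V y)) (X k y) :=
  Set.indicator_of_mem hy fun y => S.g y (S.projH y (V y)) (X k y)

theorem coeffV_apply {V : VField n M} (hV : V.SmoothOn U) (m : Fin h) {y : M} (hy : y ∈ U) :
    (S.coeffV hU hX hV m : M → ℝ) y = S.vertCoord y (V y) m :=
  Set.indicator_of_mem hy fun y => S.vertCoord y (V y) m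

theorem isComb_coeff {V : VField n M} (hV : V.SmoothOn U) :
    S.IsComb X V (S.coeffH hU hX hV) (S.coeffV hU hX hV) := by
  intro y hy
  simp only [S.coeffH_apply hU hX hV _ hy, S.coeffV_apply hU hX hV _ hy]
  exact S.eq_sum_frame hX hy (V y)

theorem coeffH_bracket_swap {V W : VField n M} (hVW : (V.bracket W).SmoothOn U)
    (hWV : (W.bracket V).SmoothOn U) (k : Fin d) :
    S.coeffH hU hX hWV k = -S.coeffH hU hX hVW k := by
  refine smoothAlg.ext_on_off (fun y hy => ?_) fun y hy => ?_
  · rw [NegMemClass.coe_neg, Pi.neg_apply, S.coeffH_apply hU hX _ _ hy,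
      S.coeffH_apply hU hX _ _ hy, W.bracket_swap, S.projH_neg, map_neg, LinearMap.neg_apply]
  · simp [coeffH, hy]

theorem coeffV_bracket_swap {V W : VField n M} (hVW : (V.bracket W).SmoothOn U)
    (hWV : (W.bracket V).SmoothOn U) (m : Fin h) :
    S.coeffV hU hX hWV m = -S.coeffV hU hX hVW m := by
  refine smoothAlg.ext_on_off (fun y hy => ?_) fun y hy => ?_
  · rw [NegMemClass.coe_neg, Pi.neg_apply, S.coeffV_apply hU hX _ _ hy,
      S.coeffV_apply hU hX _ _ hy, W.bracket_swap, S.vertCoord_neg]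
  · simp [coeffV, hy]

/-- On U this is the expansion of the bracket field in the adapted frame, acting on f; off U every
derivation is zero. -/
theorem comm_eq_coeff {V W : VField n M} (hV : V.SmoothOn U) (hW : W.SmoothOn U)
    (f : smoothAlg n U) :
    V.toDerivation hU hV (W.toDerivation hU hW f) - W.toDerivation hU hW (V.toDerivation hU hV f)
      = ∑ k, S.coeffH hU hX (hV.bracket hU hW) k * (X k).toDerivation hU (hX.smooth k) f
        + ∑ m, S.coeffV hU hX (hV.bracket hU hW) m
          * (S.Z m).toDerivation hU (S.smoothOn_Z m U) f := by
  refine smoothAlg.ext_on_off (fun y hy => ?_) fun y hy => ?_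
  · simp only [AddSubgroupClass.coe_sub, Pi.sub_apply, AddMemClass.coe_add, Pi.add_apply,
      AddSubmonoidClass.coe_finsetSum, Finset.sum_apply, MulMemClass.coe_mul, Pi.mul_apply]
    rw [← VField.bracket_der_apply hU hV hW f hy, VField.der,
      S.isComb_coeff hU hX (hV.bracket hU hW) y hy]
    simp only [map_add, map_sum, map_smul, smul_eq_mul]
    congr 1
    · exact Finset.sum_congr rfl fun k _ => by
        rw [(X k).toDerivation_apply hU (hX.smooth k) f hy]; rfl
    · exact Finset.sum_congr rfl fun m _ => by
        rw [(S.Z m).toDerivation_apply hU (S.smoothOn_Z m U) f hy]; rfl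
  · simp only [AddSubgroupClass.coe_sub, Pi.sub_apply, AddMemClass.coe_add, Pi.add_apply,
      AddSubmonoidClass.coe_finsetSum, Finset.sum_apply, MulMemClass.coe_mul, Pi.mul_apply,
      VField.toDerivation_apply_of_notMem _ _ _ _ hy, mul_zero, Finset.sum_const_zero, add_zero,
      sub_zero]

theorem coeffV_eq_zero {V : VField n M} (hV : V.SmoothOn U) (hH : ∀ y ∈ U, V y ∈ S.Hor y)
    (m : Fin h) : S.coeffV hU hX hV m = 0 := by
  refine smoothAlg.ext_on_off (fun y hy => ?_) fun y hy => ?_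
  · rw [S.coeffV_apply hU hX hV m hy]
    simpa using S.vertCoord_add (hH y hy) 0 m
  · simp [coeffV, hy]

theorem coeffH_eq_zero {V : VField n M} (hV : V.SmoothOn U)
    (hH : ∀ y ∈ U, V y ∈ S.V.map (LinearMap.proj y)) (k : Fin d) :
    S.coeffH hU hX hV k = 0 := by
  refine smoothAlg.ext_on_off (fun y hy => ?_) fun y hy => ?_
  · have := S.projH_add_vertical (Submodule.zero_mem _) (hH y hy)
    rw [zero_add] at this
    rw [S.coeffH_apply hU hX hV k hy, this]
    simp
  · simp [coeffH, hy]

/-- The calculus of the frame `X₁, …, X_d, Z₁, …, Z_h` on `U`. -/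
def calculus : FrameCalculus (smoothAlg n U) (Fin d) (Fin h) where
  X i := (X i).toDerivation hU (hX.smooth i)
  Z m := (S.Z m).toDerivation hU (S.smoothOn_Z m U)
  c i j := S.coeffH hU hX ((hX.smooth i).bracket hU (hX.smooth j))
  γ i j := S.coeffV hU hX ((hX.smooth i).bracket hU (hX.smooth j))
  δ m i := S.coeffH hU hX ((S.smoothOn_Z m U).bracket hU (hX.smooth i))
  e m l := S.coeffV hU hX ((S.smoothOn_Z m U).bracket hU (S.smoothOn_Z l U))
  c_swap i j k := S.coeffH_bracket_swap hU hX _ _ k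
  γ_swap i j m := S.coeffV_bracket_swap hU hX _ _ m
  δ_swap m i k := by
    refine smoothAlg.ext_on_off (fun y hy => ?_) fun y hy => ?_
    -- The products g(X i, X k) are constant on U, so the Killing equation reduces to skewness of Z
    -- m's action on the frame.
    · have h1 := (S.killing _ (S.Zbasis m).2).lie_metric U (X i) (X k) hU (hX.smooth i)
        (hX.smooth k) (fun _ hy => S.frame_mem hX hy i) (fun _ hy => S.frame_mem hX hy k) y hy
      have h2 : (fun z => S.g z (X i z) (X k z)) =ᶠ[𝓝 y] fun _ => if i = k then 1 else 0 :=
        Filter.eventually_of_mem (hU.mem_nhds hy) fun z hz => hX.orthonormal z hz i k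
      rw [VField.der_congr rfl h2, VField.der_const] at h1
      have h3 := S.bracket_Z_mem hU hX m i y hy
      have h4 := S.bracket_Z_mem hU hX m k y hy
      rw [NegMemClass.coe_neg, Pi.neg_apply, S.coeffH_apply hU hX _ _ hy,
        S.coeffH_apply hU hX _ _ hy, S.projH_of_mem h3, S.projH_of_mem h4,
        S.g_symm y _ h4 _ (S.frame_mem hX hy i)]
      change 0 = S.g y ((S.Z m).bracket (X i) y) (X k y) + S.g y (X i y) ((S.Z m).bracket (X k) y)
        at h1
      linarith
    · simp [coeffH, hy]
  comm_XX i j f := S.comm_eq_coeff hU hX _ _ f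
  comm_ZX m i f := by
    rw [S.comm_eq_coeff hU hX (S.smoothOn_Z m U) (hX.smooth i) f]
    simp only [S.coeffV_eq_zero hU hX _ (S.bracket_Z_mem hU hX m i), zero_mul,
      Finset.sum_const_zero, add_zero]
  comm_ZZ m l f := by
    rw [S.comm_eq_coeff hU hX (S.smoothOn_Z m U) (S.smoothOn_Z l U) f]
    -- V is closed under brackets, so the bracket has no horizontal component.
    have hmem : ∀ y ∈ U, (S.Z m).bracket (S.Z l) y ∈ S.V.map (LinearMap.proj y) := fun y _ =>
      ⟨_, S.bracket_mem _ (S.Zbasis m).2 _ (S.Zbasis l).2, rfl⟩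
    simp only [S.coeffH_eq_zero hU hX _ hmem, zero_mul, Finset.sum_const_zero, zero_add]

end TransverseSymmetries

/-! ### Koszul's formula and the canonical connection in a frame -/

theorem sum_rotate {α β γ A : Type*} [Fintype α] [Fintype β] [Fintype γ] [AddCommMonoid A]
    (f : α → β → γ → A) : ∑ i, ∑ j, ∑ k, f i j k = ∑ k, ∑ i, ∑ j, f i j k := by
  calc ∑ i, ∑ j, ∑ k, f i j k = ∑ i, ∑ k, ∑ j, f i j k :=
        Finset.sum_congr rfl fun i _ => Finset.sum_comm
    _ = ∑ k, ∑ i, ∑ j, f i j k := Finset.sum_comm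

namespace FrameCalculus

variable {A ι κ : Type*} [CommRing A] [Algebra ℝ A] [Fintype ι] [Fintype κ]
  (C : FrameCalculus A ι κ)

/-- Koszul's formula. -/
theorem koszul_eq (a w p : ι → A) :
    (∑ i, a i * C.X i (∑ k, w k * p k) + ∑ i, w i * C.X i (∑ k, a k * p k)
        - ∑ i, p i * C.X i (∑ k, a k * w k))
      + (∑ k, C.brH a w k * p k - ∑ k, C.brH a p k * w k - ∑ k, C.brH w p k * a k)
    = 2 * ∑ k, C.cov a 0 w k * p k := by
  have hG : 2 * ∑ k, (∑ i, ∑ l, a i * w l * C.G i l k) * p k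
      = ∑ k, (∑ i, ∑ j, a i * w j * C.c i j k) * p k
        - ∑ k, (∑ i, ∑ j, a i * p j * C.c i j k) * w k
        - ∑ k, (∑ i, ∑ j, w i * p j * C.c i j k) * a k := by
    simp only [Finset.sum_mul, Finset.mul_sum]
    have e1 : ∑ k, ∑ i, ∑ j, a i * p j * C.c i j k * w k
        = ∑ k, ∑ i, ∑ j, a i * w j * C.c i k j * p k := by
      rw [Finset.sum_comm]
      conv_rhs => rw [Finset.sum_comm]
      refine Finset.sum_congr rfl fun i _ => ?_
      rw [Finset.sum_comm]
      exact Finset.sum_congr rfl fun k _ => Finset.sum_congr rfl fun j _ => by ring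
    have e2 : ∑ k, ∑ i, ∑ j, w i * p j * C.c i j k * a k
        = ∑ k, ∑ i, ∑ j, a i * w j * C.c j k i * p k := by
      calc ∑ k, ∑ i, ∑ j, w i * p j * C.c i j k * a k
          = ∑ k, ∑ j, ∑ i, w i * p j * C.c i j k * a k :=
            Finset.sum_congr rfl fun k _ => Finset.sum_comm
        _ = ∑ j, ∑ k, ∑ i, w i * p j * C.c i j k * a k := Finset.sum_comm
        _ = _ := Finset.sum_congr rfl fun j _ => Finset.sum_congr rfl fun k _ =>
            Finset.sum_congr rfl fun i _ => by ring
    rw [e1, e2]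
    simp only [← Finset.sum_sub_distrib]
    refine Finset.sum_congr rfl fun k _ => Finset.sum_congr rfl fun i _ =>
      Finset.sum_congr rfl fun j _ => ?_
    have h2 : 2 * C.G i j k = C.c i j k - C.c i k j - C.c j k i := by rw [G, two_smul_half]
    linear_combination a i * w j * p k * h2
  have hD : ∀ u v q : ι → A, ∑ i, u i * C.X i (∑ k, v k * q k)
      = ∑ k, (∑ i, u i * C.X i (v k)) * q k + ∑ k, (∑ i, u i * C.X i (q k)) * v k := by
    intro u v q
    simp only [map_sum, Derivation.leibniz, smul_eq_mul, Finset.mul_sum, Finset.sum_mul,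
      ← Finset.sum_add_distrib]
    rw [Finset.sum_comm]
    exact Finset.sum_congr rfl fun i _ => Finset.sum_congr rfl fun k _ => by ring
  simp only [hD, brH, cov, Pi.zero_apply, zero_mul, Finset.sum_const_zero, add_zero, add_mul,
    sub_mul, Finset.sum_add_distrib, Finset.sum_sub_distrib]
  linear_combination -hG

theorem cov_sub_cov (a w : ι → A) (k : ι) :
    C.cov a 0 w k - C.cov w 0 a k - C.brH a w k = 0 := by
  have h : ∑ i, ∑ l, a i * w l * C.G i l k - ∑ i, ∑ l, w i * a l * C.G i l k
      = ∑ i, ∑ j, a i * w j * C.c i j k := by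
    conv_lhs => rw [Finset.sum_comm (f := fun i l => w i * a l * C.G i l k)]
    simp only [← Finset.sum_sub_distrib]
    refine Finset.sum_congr rfl fun i _ => Finset.sum_congr rfl fun j _ => ?_
    rw [← C.G_sub]; ring
  simp only [cov, brH, Pi.zero_apply, zero_mul, Finset.sum_const_zero, add_zero]
  linear_combination h

end FrameCalculus

namespace TransverseSymmetries

variable {n d h : ℕ} {M : Type*} [TopologicalSpace M] [ChartedSpace (EuclideanSpace ℝ (Fin n)) M]
  [IsManifold (𝓡 n) ∞ M] {S : TransverseSymmetries n d M h}
  {X : Fin d → VField n M} {U : Set M}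

theorem IsComb.projH_eq (hX : IsOrthonormalFrameOn S.Hor S.g X U) {V : VField n M}
    {a : Fin d → smoothAlg n U} {α : Fin h → smoothAlg n U} (hV : S.IsComb X V a α) {y : M}
    (hy : y ∈ U) : S.projH y (V y) = ∑ i, (a i : M → ℝ) y • X i y := by
  rw [hV y hy]
  exact S.projH_add_vertical (S.sum_frame_mem hX hy _)
    (Submodule.sum_mem _ fun m _ => Submodule.smul_mem _ _ (S.Z_mem m y))

theorem IsComb.horPart (hX : IsOrthonormalFrameOn S.Hor S.g X U) {V : VField n M}
    {a : Fin d → smoothAlg n U} {α : Fin h → smoothAlg n U} (hV : S.IsComb X V a α) :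
    S.IsComb X (S.horPart V) a 0 := by
  intro y hy
  simp only [TransverseSymmetries.horPart, hV.projH_eq hX hy, Pi.zero_apply, ZeroMemClass.coe_zero,
    zero_smul, Finset.sum_const_zero, add_zero]

theorem IsComb.eq_sum {V : VField n M} {a : Fin d → smoothAlg n U} (hV : S.IsComb X V a 0) :
    ∀ y ∈ U, V y = ∑ i, (a i : M → ℝ) y • X i y := by
  intro y hy
  simpa using hV y hy

theorem IsComb.g_eq (hX : IsOrthonormalFrameOn S.Hor S.g X U) {V W : VField n M}
    {a b : Fin d → smoothAlg n U} {α β : Fin h → smoothAlg n U} (hV : S.IsComb X V a α)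
    (hW : S.IsComb X W b β) {y : M} (hy : y ∈ U) :
    S.g y (S.projH y (V y)) (S.projH y (W y)) = ∑ k, (a k : M → ℝ) y * (b k : M → ℝ) y := by
  rw [hV.projH_eq hX hy, hW.projH_eq hX hy]
  simp [hX.orthonormal y hy, mul_comm]

theorem IsComb.smoothOn (hX : IsOrthonormalFrameOn S.Hor S.g X U) {V : VField n M}
    {a : Fin d → smoothAlg n U} {α : Fin h → smoothAlg n U} (hV : S.IsComb X V a α) :
    V.SmoothOn U := by
  refine (smoothOn_sum (S.smoothOn_adapted hX) (Sum.elim a α)).congr fun y hy => ?_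
  rw [hV y hy, Fintype.sum_sum_type]
  rfl

theorem IsComb.frame (i : Fin d) : S.IsComb X (X i) (Pi.single i (1 : smoothAlg n U)) 0 := by
  classical
  intro y _
  rw [Finset.sum_eq_single i]
  · simp
  · intro j _ hj
    simp [hj]
  · simp

theorem IsComb.Z (m : Fin h) : S.IsComb X (S.Z m) 0 (Pi.single m (1 : smoothAlg n U)) := by
  classical
  intro y _
  rw [Finset.sum_eq_single (f := fun l => _ • S.Z l y) m]
  · simp
  · intro j _ hj
    simp [hj]
  · simp

theorem IsComb.sub {V W : VField n M} {a b : Fin d → smoothAlg n U} {α β : Fin h → smoothAlg n U}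
    (hV : S.IsComb X V a α) (hW : S.IsComb X W b β) : S.IsComb X (V - W) (a - b) (α - β) := by
  intro y hy
  rw [Pi.sub_apply, hV y hy, hW y hy]
  simp only [Pi.sub_apply, AddSubgroupClass.coe_sub, sub_smul, Finset.sum_sub_distrib]
  abel

/-- Restriction to a smaller open set. -/
def _root_.smoothAlg.restrict {U U' : Set M} (h : U' ⊆ U) (f : smoothAlg n U) : smoothAlg n U' :=
  ⟨f, ContMDiffOn.mono f.2 h⟩

theorem IsComb.restrict {U' : Set M} (hsub : U' ⊆ U) {V : VField n M} {a : Fin d → smoothAlg n U}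
    {α : Fin h → smoothAlg n U} (hV : S.IsComb X V a α) :
    S.IsComb X V (fun i => smoothAlg.restrict hsub (a i)) fun m => smoothAlg.restrict hsub (α m) :=
  fun y hy => hV y (hsub hy)

theorem _root_.IsOrthonormalFrameOn.mono {U' : Set M} (hX : IsOrthonormalFrameOn S.Hor S.g X U)
    (hsub : U' ⊆ U) : IsOrthonormalFrameOn S.Hor S.g X U' where
  smooth i := (hX.smooth i).mono hsub
  span_eq y hy := hX.span_eq y (hsub hy)
  orthonormal y hy := hX.orthonormal y (hsub hy)

variable [T2Space M] [ConnectedSpace M]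

theorem IsComb.vertCoord_eq (hX : IsOrthonormalFrameOn S.Hor S.g X U) {V : VField n M}
    {a : Fin d → smoothAlg n U} {α : Fin h → smoothAlg n U} (hV : S.IsComb X V a α) {y : M}
    (hy : y ∈ U) (m : Fin h) : S.vertCoord y (V y) m = (α m : M → ℝ) y := by
  rw [hV y hy]
  exact S.vertCoord_add (S.sum_frame_mem hX hy _) _ m

theorem IsComb.gR_eq (hX : IsOrthonormalFrameOn S.Hor S.g X U) {V W : VField n M}
    {a b : Fin d → smoothAlg n U} {α β : Fin h → smoothAlg n U} (hV : S.IsComb X V a α)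
    (hW : S.IsComb X W b β) {y : M} (hy : y ∈ U) :
    S.gR y (V y) (W y) = ∑ k, (a k : M → ℝ) y * (b k : M → ℝ) y
      + ∑ m, (α m : M → ℝ) y * (β m : M → ℝ) y := by
  unfold gR
  rw [hV.g_eq hX hW hy]
  simp only [hV.vertCoord_eq hX hy, hW.vertCoord_eq hX hy]

variable (hU : IsOpen U) (hX : IsOrthonormalFrameOn S.Hor S.g X U)

theorem calculus_X_apply (i : Fin d) (f : smoothAlg n U) {y : M} (hy : y ∈ U) :
    ((S.calculus hU hX).X i f : M → ℝ) y = (X i).der f y :=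
  (X i).toDerivation_apply hU (hX.smooth i) f hy

theorem calculus_Z_apply (m : Fin h) (f : smoothAlg n U) {y : M} (hy : y ∈ U) :
    ((S.calculus hU hX).Z m f : M → ℝ) y = (S.Z m).der f y :=
  (S.Z m).toDerivation_apply hU (S.smoothOn_Z m U) f hy

theorem IsComb.der_eq {V : VField n M} {a : Fin d → smoothAlg n U} {α : Fin h → smoothAlg n U}
    (hV : S.IsComb X V a α) (f : smoothAlg n U) {y : M} (hy : y ∈ U) :
    V.der f y = ((∑ i, a i * (S.calculus hU hX).X i f + ∑ m, α m * (S.calculus hU hX).Z m f :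
      smoothAlg n U) : M → ℝ) y := by
  rw [VField.der, hV y hy]
  simp only [map_add, map_sum, map_smul, smul_eq_mul, AddMemClass.coe_add, Pi.add_apply,
    AddSubmonoidClass.coe_finsetSum, Finset.sum_apply, MulMemClass.coe_mul, Pi.mul_apply,
    calculus_X_apply hU hX _ f hy, calculus_Z_apply hU hX _ f hy]
  rfl

/-- The bracket of two horizontal fields. -/
theorem IsComb.bracket {V W : VField n M} {a w : Fin d → smoothAlg n U}
    (hV : S.IsComb X V a 0) (hW : S.IsComb X W w 0) :
    S.IsComb X (V.bracket W) ((S.calculus hU hX).brH a w) ((S.calculus hU hX).brV a w) := by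
  intro y hy
  have hWs := hW.smoothOn hX
  rw [bracket_sum_left hU hX.smooth a hWs hV.eq_sum hy]
  have h1 : ∀ i, (X i).bracket W y = _ := fun i =>
    bracket_sum_right hU hX.smooth w (hX.smooth i) hW.eq_sum hy
  have h2 : ∀ i j, (X i).bracket (X j) y
      = ∑ k, ((S.calculus hU hX).c i j k : M → ℝ) y • X k y
        + ∑ m, ((S.calculus hU hX).γ i j m : M → ℝ) y • S.Z m y := fun i j =>
    S.isComb_coeff hU hX ((hX.smooth i).bracket hU (hX.smooth j)) y hy
  have h3 : ∀ i, W.der (a i) y = _ := fun i => hW.der_eq hU hX (a i) hy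
  simp only [h1, h2, h3, FrameCalculus.brH, FrameCalculus.brV, ← calculus_X_apply hU hX _ _ hy,
    Pi.zero_apply, zero_mul, Finset.sum_const_zero, add_zero]
  simp only [AddMemClass.coe_add, Pi.add_apply, AddSubgroupClass.coe_sub, Pi.sub_apply,
    AddSubmonoidClass.coe_finsetSum, Finset.sum_apply, MulMemClass.coe_mul, Pi.mul_apply,
    add_smul, sub_smul, smul_add, Finset.sum_add_distrib, Finset.sum_sub_distrib,
    Finset.smul_sum, Finset.sum_smul, smul_smul, ← mul_assoc]
  rw [sum_rotate (f := fun i j k => _ • X k y), sum_rotate (f := fun i j m => _ • S.Z m y),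
    Finset.sum_comm (f := fun i j => _ • X j y)]
  abel

/-- The derivative of `g(V, W)`. -/
theorem IsComb.der_gH {P V W : VField n M} {p a b : Fin d → smoothAlg n U}
    {α β : Fin h → smoothAlg n U} (hP : S.IsComb X P p 0) (hV : S.IsComb X V a α)
    (hW : S.IsComb X W b β) {y : M} (hy : y ∈ U) :
    P.der (S.gH V W) y
      = ((∑ i, p i * (S.calculus hU hX).X i (∑ k, a k * b k) : smoothAlg n U) : M → ℝ) y := by
  have h1 : S.gH V W =ᶠ[𝓝 y] ((∑ k, a k * b k : smoothAlg n U) : M → ℝ) := by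
    filter_upwards [hU.mem_nhds hy] with z hz
    rw [gH, hV.g_eq hX hW hz]
    simp
  rw [P.der_congr rfl h1, hP.der_eq hU hX _ hy]
  simp

theorem IsComb.koszul_eq {V W P : VField n M} {a w p : Fin d → smoothAlg n U}
    (hV : S.IsComb X V a 0) (hW : S.IsComb X W w 0) (hP : S.IsComb X P p 0) {y : M} (hy : y ∈ U) :
    S.koszul V W P y
      = ∑ k, ((S.calculus hU hX).cov a 0 w k : M → ℝ) y * (p k : M → ℝ) y := by
  have hk := congrArg (fun f : smoothAlg n U => (f : M → ℝ) y)
    ((S.calculus hU hX).koszul_eq a w p)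
  unfold koszul
  rw [hV.der_gH hU hX hW hP hy, hW.der_gH hU hX hV hP hy, hP.der_gH hU hX hV hW hy]
  simp only [gH]
  rw [(hV.bracket hU hX hW).g_eq hX hP hy, (hV.bracket hU hX hP).g_eq hX hW hy,
    (hW.bracket hU hX hP).g_eq hX hV hy]
  simp only [two_mul, AddMemClass.coe_add, AddSubgroupClass.coe_sub,
    AddSubmonoidClass.coe_finsetSum, MulMemClass.coe_mul, Pi.add_apply, Pi.sub_apply, Pi.mul_apply, Finset.sum_apply] at hk ⊢
  linarith

/-- The right-hand side involves only the fields and coefficient functions near y. Calculi over U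
and over a smaller open set can thus be compared at y. -/
theorem cov_apply (a w : Fin d → smoothAlg n U) (α : Fin h → smoothAlg n U) (k : Fin d) {y : M}
    (hy : y ∈ U) :
    ((S.calculus hU hX).cov a α w k : M → ℝ) y
      = (∑ i, (a i : M → ℝ) y * (X i).der (w k) y + ∑ m, (α m : M → ℝ) y * (S.Z m).der (w k) y)
        + (∑ i, ∑ l, (a i : M → ℝ) y * (w l : M → ℝ) y * ((1 / 2) *
            (S.g y (S.projH y ((X i).bracket (X l) y)) (X k y)
              - S.g y (S.projH y ((X i).bracket (X k) y)) (X l y)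
              - S.g y (S.projH y ((X l).bracket (X k) y)) (X i y)))
          + ∑ m, ∑ l, (α m : M → ℝ) y * (w l : M → ℝ) y
            * S.g y (S.projH y ((S.Z m).bracket (X l) y)) (X k y)) := by
  simp only [FrameCalculus.cov, FrameCalculus.G, AddMemClass.coe_add,
    AddSubmonoidClass.coe_finsetSum, MulMemClass.coe_mul, Pi.add_apply, Pi.mul_apply,
    Finset.sum_apply, calculus_X_apply hU hX _ _ hy, calculus_Z_apply hU hX _ _ hy,
    Subalgebra.coe_smul, Pi.smul_apply, smul_eq_mul, AddSubgroupClass.coe_sub, Pi.sub_apply]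
  simp only [calculus, S.coeffH_apply hU hX _ _ hy]

/-- The canonical connection in a frame. -/
theorem IsComb.nabla {V W : VField n M} {a w : Fin d → smoothAlg n U}
    {α β : Fin h → smoothAlg n U} (hV : S.IsComb X V a α) (hW : S.IsComb X W w β) :
    S.IsComb X (S.nabla V W) ((S.calculus hU hX).cov a α w)
      (fun m => ∑ i, a i * (S.calculus hU hX).X i (β m)
        + ∑ l, α l * (S.calculus hU hX).Z l (β m)) := by
  intro y hy
  have hcov : ∀ k, ((S.calculus hU hX).cov a α w k : M → ℝ) y
      = ((S.calculus hU hX).cov a 0 w k : M → ℝ) y + ∑ m, ((α m : M → ℝ) y * (S.Z m).der (w k) y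
        + ∑ l, (α m : M → ℝ) y * (w l : M → ℝ) y * ((S.calculus hU hX).δ m l k : M → ℝ) y) := by
    intro k
    have hδ : ∀ m l, ((S.calculus hU hX).δ m l k : M → ℝ) y
        = S.g y (S.projH y ((S.Z m).bracket (X l) y)) (X k y) := fun m l =>
      S.coeffH_apply hU hX ((S.smoothOn_Z m U).bracket hU (hX.smooth l)) _ hy
    rw [cov_apply hU hX _ _ _ _ hy, cov_apply hU hX _ _ _ _ hy]
    simp only [hδ, Pi.zero_apply, ZeroMemClass.coe_zero, zero_mul,
      Finset.sum_const_zero, add_zero, Finset.sum_add_distrib]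
    ring
  have hvert : ∀ m, V.der (fun y => S.vertCoord y (W y) m) y
      = ((∑ i, a i * (S.calculus hU hX).X i (β m) + ∑ l, α l * (S.calculus hU hX).Z l (β m) :
        smoothAlg n U) : M → ℝ) y := by
    intro m
    have h1 : (fun y => S.vertCoord y (W y) m) =ᶠ[𝓝 y] (β m : M → ℝ) := by
      filter_upwards [hU.mem_nhds hy] with z hz
      exact hW.vertCoord_eq hX hz m
    rw [V.der_congr rfl h1, hV.der_eq hU hX _ hy]
  -- The definition of the connection at y uses the frame chosen at y, not X. On the intersection of
  -- the two domains that frame is expanded in X, and the result is re-expanded in an orthonormal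
  -- basis, so the choice drops out.
  have hhor : ∑ k, S.koszul (S.horPart V) (S.horPart W) (S.frame y k) y • S.frame y k y
      = ∑ k, ((S.calculus hU hX).cov a 0 w k : M → ℝ) y • X k y := by
    obtain ⟨U', hU', hyU', hF⟩ := (S.exists_frame y).choose_spec
    change IsOrthonormalFrameOn S.Hor S.g (S.frame y) U' at hF
    have hsub : U ∩ U' ⊆ U := Set.inter_subset_left
    have hyi : y ∈ U ∩ U' := ⟨hy, hyU'⟩
    have hUi := hU.inter hU'
    have hXi := hX.mono hsub
    have hVi := (hV.horPart hX).restrict hsub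
    have hWi := (hW.horPart hX).restrict hsub
    have hkos : ∀ k, S.koszul (S.horPart V) (S.horPart W) (S.frame y k) y
        = S.g y (∑ j, ((S.calculus hU hX).cov a 0 w j : M → ℝ) y • X j y) (S.frame y k y) := by
      intro k
      have hFs := (hF.smooth k).mono (Set.inter_subset_right : U ∩ U' ⊆ U')
      have hFk := S.isComb_coeff hUi hXi hFs
      have hz : S.coeffV hUi hXi hFs = 0 := funext fun m =>
        S.coeffV_eq_zero hUi hXi hFs (fun z hz => S.frame_mem hF hz.2 k) m
      rw [hz] at hFk
      rw [IsComb.koszul_eq hUi hXi hVi hWi hFk hyi]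
      simp only [map_sum, map_smul, LinearMap.sum_apply, LinearMap.smul_apply, smul_eq_mul]
      refine Finset.sum_congr rfl fun j _ => ?_
      congr 1
      · rw [cov_apply hUi hXi _ _ _ _ hyi, cov_apply hU hX _ _ _ _ hy]
        rfl
      · rw [S.coeffH_apply hUi hXi hFs j hyi, S.projH_of_mem (S.frame_mem hF hyU' k)]
        exact S.g_symm y _ (S.frame_mem hF hyU' k) _ (S.frame_mem hX hy j)
    simp only [hkos]
    exact S.sum_g_smul hF hyU' (S.sum_frame_mem hX hy _)
  -- The bracket with a Killing field keeps the horizontal part horizontal, so ∇_{Z m} contributes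
  -- only X k-components.
  have hmix : ∀ m, (S.Z m).bracket (S.horPart W) y
      = ∑ k, ((S.Z m).der (w k) y
        + ∑ l, (w l : M → ℝ) y * ((S.calculus hU hX).δ m l k : M → ℝ) y) • X k y := by
    intro m
    have h1 : ∀ l, (S.Z m).bracket (X l) y
        = ∑ k, ((S.calculus hU hX).δ m l k : M → ℝ) y • X k y := by
      intro l
      have h2 := S.isComb_coeff hU hX ((S.smoothOn_Z m U).bracket hU (hX.smooth l)) y hy
      simp only [S.coeffV_eq_zero hU hX _ (S.bracket_Z_mem hU hX m l)] at h2
      have h3 : (S.Z m).bracket (X l) y = ∑ k, (S.coeffH hU hX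
          ((S.smoothOn_Z m U).bracket hU (hX.smooth l)) k : M → ℝ) y • X k y := by
        simpa using h2
      exact h3
    rw [bracket_sum_right hU hX.smooth w (S.smoothOn_Z m U) (hW.horPart hX).eq_sum hy]
    simp only [h1, Finset.smul_sum, smul_smul, add_smul, Finset.sum_add_distrib, Finset.sum_smul]
    rw [Finset.sum_comm, add_comm]
  unfold TransverseSymmetries.nabla
  rw [hhor]
  simp only [hvert, hmix, hV.vertCoord_eq hX hy, hcov, add_smul, Finset.sum_add_distrib,
    smul_add, Finset.smul_sum, smul_smul, Finset.sum_smul, mul_assoc]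
  congr 2
  congr 1
  · rw [Finset.sum_comm]
  · rw [Finset.sum_comm]

end TransverseSymmetries

/-! ### Tensoriality of the curvature -/

namespace FrameCalculus

variable {A ι κ : Type*} [CommRing A] [Algebra ℝ A] [Fintype ι] [Fintype κ]
  (C : FrameCalculus A ι κ)

/-- The derivative of `f` along `∑ a i • X i + ∑ α m • Z m`. -/
def dir (a : ι → A) (α : κ → A) (f : A) : A := ∑ i, a i * C.X i f + ∑ m, α m * C.Z m f

theorem dir_bracket (a w : ι → A) (f : A) :
    C.dir a 0 (C.dir w 0 f) - C.dir w 0 (C.dir a 0 f) = C.dir (C.brH a w) (C.brV a w) f := by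
  simp only [dir, brH, brV, Pi.zero_apply, zero_mul, Finset.sum_const_zero, add_zero, map_sum,
    Derivation.leibniz, smul_eq_mul, Finset.mul_sum, Finset.sum_mul, add_mul, sub_mul, mul_add,
    Finset.sum_add_distrib, Finset.sum_sub_distrib]
  have h : ∑ i, ∑ j, a i * (w j * C.X i (C.X j f)) - ∑ i, ∑ j, w i * (a j * C.X i (C.X j f))
      = ∑ k, ∑ i, ∑ j, a i * w j * C.c i j k * C.X k f
        + ∑ m, ∑ i, ∑ j, a i * w j * C.γ i j m * C.Z m f := by
    rw [← sum_rotate (f := fun i j k => a i * w j * C.c i j k * C.X k f),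
      ← sum_rotate (f := fun i j m => a i * w j * C.γ i j m * C.Z m f),
      Finset.sum_comm (f := fun i j => w i * (a j * C.X i (C.X j f)))]
    simp only [← Finset.sum_add_distrib, ← Finset.sum_sub_distrib]
    refine Finset.sum_congr rfl fun i _ => Finset.sum_congr rfl fun j _ => ?_
    have := C.comm_XX i j f
    simp only [mul_assoc, ← Finset.mul_sum]
    linear_combination a i * w j * this
  have h1 : ∑ i, ∑ j, a i * (C.X j f * C.X i (w j)) = ∑ k, ∑ i, a i * C.X i (w k) * C.X k f := by
    rw [Finset.sum_comm]
    exact Finset.sum_congr rfl fun i _ => Finset.sum_congr rfl fun j _ => by ring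
  have h2 : ∑ i, ∑ j, w i * (C.X j f * C.X i (a j)) = ∑ k, ∑ i, w i * C.X i (a k) * C.X k f := by
    rw [Finset.sum_comm]
    exact Finset.sum_congr rfl fun i _ => Finset.sum_congr rfl fun j _ => by ring
  linear_combination h + h1 - h2

theorem cov_smul (a : ι → A) (α : κ → A) (p : A) (w : ι → A) (k : ι) :
    C.cov a α (p • w) k = C.dir a α p * w k + p * C.cov a α w k := by
  simp only [cov, dir, Pi.smul_apply, smul_eq_mul, Derivation.leibniz, mul_add,
    Finset.sum_add_distrib, Finset.mul_sum, add_mul, Finset.sum_mul]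
  simp only [show ∀ x y : A, x * (p * y) = p * (x * y) from fun x y => by ring,
    show ∀ x y : A, x * (w k * y) = x * y * w k from fun x y => by ring]
  ring_nf

theorem cov_add (a : ι → A) (α : κ → A) (v w : ι → A) :
    C.cov a α (v + w) = C.cov a α v + C.cov a α w := by
  funext k
  simp only [cov, Pi.add_apply, map_add, mul_add, add_mul, Finset.sum_add_distrib]
  ring

theorem cov_smul_left (p : A) (a : ι → A) (α : κ → A) (w : ι → A) :
    C.cov (p • a) (p • α) w = p • C.cov a α w := by
  funext k
  simp only [cov, Pi.smul_apply, smul_eq_mul, mul_add, Finset.mul_sum, mul_assoc]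

theorem cov_add_left (a b : ι → A) (α β : κ → A) (w : ι → A) :
    C.cov (a + b) (α + β) w = C.cov a α w + C.cov b β w := by
  funext k
  simp only [cov, Pi.add_apply, add_mul, Finset.sum_add_distrib]
  ring

theorem brH_smul (p : A) (a w : ι → A) :
    C.brH a (p • w) = C.dir a 0 p • w + p • C.brH a w := by
  funext k
  simp only [brH, dir, Pi.smul_apply, Pi.add_apply, smul_eq_mul, Derivation.leibniz, mul_add,
    Finset.sum_add_distrib, Finset.mul_sum, Finset.sum_mul, Pi.zero_apply, zero_mul,
    Finset.sum_const_zero, add_zero, mul_sub]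
  simp only [show ∀ x y : A, x * (p * y) = p * (x * y) from fun x y => by ring,
    show ∀ x y : A, x * (w k * y) = x * y * w k from fun x y => by ring, mul_assoc p]
  ring

theorem brV_smul (p : A) (a w : ι → A) : C.brV a (p • w) = p • C.brV a w := by
  funext k
  simp only [brV, Pi.smul_apply, smul_eq_mul, Finset.mul_sum]
  exact Finset.sum_congr rfl fun i _ => Finset.sum_congr rfl fun j _ => by ring

theorem brH_add (a v w : ι → A) : C.brH a (v + w) = C.brH a v + C.brH a w := by
  funext k
  simp only [brH, Pi.add_apply, map_add, mul_add, add_mul, Finset.sum_add_distrib]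
  ring

theorem brV_add (a v w : ι → A) : C.brV a (v + w) = C.brV a v + C.brV a w := by
  funext k
  simp only [brV, Pi.add_apply, mul_add, add_mul, Finset.sum_add_distrib]

/-- The derivative of p produced by ∇_a cancels against the one produced by the bracket of a with p
w. -/
theorem curv_smul_middle (p : A) (a w u : ι → A) : C.curv a (p • w) u = p • C.curv a w u := by
  funext k
  have h1 : C.cov (p • w) 0 u = p • C.cov w 0 u := by
    simpa using C.cov_smul_left p w 0 u
  have h2 : C.cov (p • w) 0 (C.cov a 0 u) = p • C.cov w 0 (C.cov a 0 u) := by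
    simpa using C.cov_smul_left p w 0 (C.cov a 0 u)
  have h3 : C.cov (C.brH a (p • w)) (C.brV a (p • w)) u
      = C.dir a 0 p • C.cov w 0 u + p • C.cov (C.brH a w) (C.brV a w) u := by
    rw [brH_smul, brV_smul, ← C.cov_smul_left p, ← C.cov_smul_left (C.dir a 0 p), ← C.cov_add_left]
    simp
  simp only [curv, h1, h2, h3, cov_smul, Pi.smul_apply, Pi.add_apply, smul_eq_mul]
  ring

/-- The first-order terms in p cancel, and its second derivatives combine to zero because the
bracket is the commutator of derivations (`dir_bracket`). -/
theorem curv_smul_right (p : A) (a w u : ι → A) : C.curv a w (p • u) = p • C.curv a w u := by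
  funext k
  have h : ∀ b : ι → A, ∀ β : κ → A, C.cov b β (p • u) = C.dir b β p • u + p • C.cov b β u :=
    fun b β => funext fun k => by simp [cov_smul]
  have := C.dir_bracket a w p
  simp only [curv, h, cov_add, cov_smul, Pi.smul_apply, Pi.add_apply, smul_eq_mul]
  linear_combination u k * this

theorem curv_add_middle (a v w u : ι → A) : C.curv a (v + w) u = C.curv a v u + C.curv a w u := by
  funext k
  have h : ∀ z, C.cov (v + w) 0 z = C.cov v 0 z + C.cov w 0 z := fun z => by
    simpa using C.cov_add_left v w 0 0 z
  simp only [curv, brH_add, brV_add, cov_add_left, h, cov_add, Pi.add_apply]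
  ring

theorem curv_add_right (a w u v : ι → A) : C.curv a w (u + v) = C.curv a w u + C.curv a w v := by
  funext k
  simp only [curv, cov_add, Pi.add_apply]
  ring

/-- The curvature is tensorial. -/
theorem curv_eq_sum [DecidableEq ι] (a w u : ι → A) (k : ι) :
    C.curv a w u k
      = ∑ j, ∑ l, w j * u l * C.curv a (Pi.single j 1) (Pi.single l 1) k := by
  let B : (ι → A) →ₗ[A] (ι → A) →ₗ[A] (ι → A) :=
    LinearMap.mk₂ A (fun w u => C.curv a w u) (fun v w u => C.curv_add_middle a v w u)
      (fun p w u => C.curv_smul_middle p a w u) (fun w u v => C.curv_add_right a w u v)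
      (fun p w u => C.curv_smul_right p a w u)
  have hs : ∀ v : ι → A, v = ∑ j, v j • Pi.single j (1 : A) := fun v => by
    simpa using (pi_eq_sum_univ' v)
  change B w u k = _
  conv_lhs => rw [hs w, hs u]
  simp only [map_sum, map_smul, LinearMap.sum_apply, LinearMap.smul_apply, Finset.sum_apply,
    Pi.smul_apply, smul_eq_mul, Finset.mul_sum]
  rw [Finset.sum_comm]
  exact Finset.sum_congr rfl fun j _ => Finset.sum_congr rfl fun l _ => by
    rw [mul_comm (w j) (u l), mul_assoc]; rfl

theorem brV_single [DecidableEq ι] (l k : ι) (m : κ) :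
    C.brV (Pi.single l 1) (Pi.single k 1) m = C.γ l k m := by
  simp [brV, Pi.single_apply]

theorem brV_single_left [DecidableEq ι] (l : ι) (w : ι → A) (m : κ) :
    C.brV (Pi.single l 1) w m = ∑ j, C.γ l j m * w j := by
  simp [brV, Pi.single_apply, mul_comm]

theorem brV_single_right [DecidableEq ι] (a : ι → A) (k : ι) (m : κ) :
    C.brV a (Pi.single k 1) m = ∑ i, a i * C.γ i k m := by
  simp [brV, Pi.single_apply]

theorem cov_single_single [DecidableEq ι] (l k i : ι) :
    C.cov (Pi.single l 1) 0 (Pi.single k 1) i = C.G l k i := by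
  have : C.X l ((Pi.single k (1 : A) : ι → A) i) = 0 := by
    by_cases h : i = k
    · subst h; simp
    · simp [h]
  rw [cov_single, this]
  simp [Pi.single_apply]

end FrameCalculus

/-! ### Torsion, curvature and the forms 𝓡, 𝓣 in a frame -/

namespace TransverseSymmetries

variable {n d h : ℕ} {M : Type*} [TopologicalSpace M] [ChartedSpace (EuclideanSpace ℝ (Fin n)) M]
  [IsManifold (𝓡 n) ∞ M] {S : TransverseSymmetries n d M h}
  {X : Fin d → VField n M} {U : Set M}

theorem IsComb.of_eq {V : VField n M} {a b : Fin d → smoothAlg n U} {α β : Fin h → smoothAlg n U}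
    (hV : S.IsComb X V a α) (hab : a = b) (hαβ : α = β) : S.IsComb X V b β :=
  hab ▸ hαβ ▸ hV

variable [T2Space M] [ConnectedSpace M]
  (hU : IsOpen U) (hX : IsOrthonormalFrameOn S.Hor S.g X U)

theorem IsComb.nabla_horizontal {V W : VField n M} {a w : Fin d → smoothAlg n U}
    {α : Fin h → smoothAlg n U} (hV : S.IsComb X V a α) (hW : S.IsComb X W w 0) :
    S.IsComb X (S.nabla V W) ((S.calculus hU hX).cov a α w) 0 :=
  (hV.nabla hU hX hW).of_eq rfl (funext fun m => by simp)

/-- The horizontal parts cancel by `cov_sub_cov`, leaving minus the vertical part of the bracket. -/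
theorem IsComb.torsion {V W : VField n M} {a w : Fin d → smoothAlg n U}
    (hV : S.IsComb X V a 0) (hW : S.IsComb X W w 0) :
    S.IsComb X (S.torsion V W) 0 (-(S.calculus hU hX).brV a w) :=
  (((hV.nabla_horizontal hU hX hW).sub (hW.nabla_horizontal hU hX hV)).sub
    (hV.bracket hU hX hW)).of_eq (funext fun k => (S.calculus hU hX).cov_sub_cov a w k) (by simp)

theorem isComb_nablaTorsion (l k : Fin d) :
    S.IsComb X (S.nablaTorsion (X l) (X l) (X k)) 0
      fun m => -(S.calculus hU hX).nablaγ l k m := by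
  have hl : S.IsComb X (X l) (Pi.single l (1 : smoothAlg n U)) 0 := IsComb.frame l
  have hk : S.IsComb X (X k) (Pi.single k (1 : smoothAlg n U)) 0 := IsComb.frame k
  refine (((hl.nabla hU hX (hl.torsion hU hX hk)).sub
    ((hl.nabla_horizontal hU hX hl).torsion hU hX hk)).sub
    (hl.torsion hU hX (hl.nabla_horizontal hU hX hk))).of_eq ?_ ?_
  · funext i
    simp [FrameCalculus.cov]
  · funext m
    simp only [Pi.sub_apply, Pi.neg_apply, FrameCalculus.brV_single]
    simp only [FrameCalculus.brV_single_right, FrameCalculus.brV_single_left,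
      FrameCalculus.cov_single_single, FrameCalculus.nablaγ, Pi.zero_apply, zero_mul,
      Finset.sum_const_zero, add_zero, map_neg]
    rw [Finset.sum_eq_single l (by intro b _ hb; simp [hb]) (by simp)]
    simp only [Pi.single_eq_same, one_mul, mul_comm ((S.calculus hU hX).γ l _ m)]
    ring

theorem IsComb.curvature {V W u : VField n M} {a w v : Fin d → smoothAlg n U}
    (hV : S.IsComb X V a 0) (hW : S.IsComb X W w 0) (hu : S.IsComb X u v 0) :
    S.IsComb X (S.curvature V W u) ((S.calculus hU hX).curv a w v) 0 :=
  (((hV.nabla_horizontal hU hX (hW.nabla_horizontal hU hX hu)).sub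
    (hW.nabla_horizontal hU hX (hV.nabla_horizontal hU hX hu))).sub
    ((hV.bracket hU hX hW).nabla_horizontal hU hX hu)).of_eq rfl (by simp)

/-- The curvature `R(V, W) u` is horizontal for horizontal `u`. -/
theorem IsComb.exists_curvature (hU : IsOpen U) (hX : IsOrthonormalFrameOn S.Hor S.g X U)
    {V W u : VField n M} {a w v : Fin d → smoothAlg n U}
    {α β : Fin h → smoothAlg n U} (hV : S.IsComb X V a α) (hW : S.IsComb X W w β)
    (hu : S.IsComb X u v 0) : ∃ r : Fin d → smoothAlg n U, S.IsComb X (S.curvature V W u) r 0 := by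
  have hVW := S.isComb_coeff hU hX ((hV.smoothOn hX).bracket hU (hW.smoothOn hX))
  exact ⟨_, (((hV.nabla_horizontal hU hX (hW.nabla_horizontal hU hX hu)).sub
    (hW.nabla_horizontal hU hX (hV.nabla_horizontal hU hX hu))).sub
    (hVW.nabla_horizontal hU hX hu)).of_eq rfl (by simp)⟩

theorem der_eq_X {f : M → ℝ} {F : smoothAlg n U} (hf : Set.EqOn f F U) (i : Fin d) {y : M}
    (hy : y ∈ U) : (X i).der f y = ((S.calculus hU hX).X i F : M → ℝ) y := by
  rw [calculus_X_apply hU hX i F hy]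
  exact VField.der_congr rfl (hf.eventuallyEq_of_mem (hU.mem_nhds hy))

theorem der_eq_Z {f : M → ℝ} {F : smoothAlg n U} (hf : Set.EqOn f F U) (m : Fin h) {y : M}
    (hy : y ∈ U) : (S.Z m).der f y = ((S.calculus hU hX).Z m F : M → ℝ) y := by
  rw [calculus_Z_apply hU hX m F hy]
  exact VField.der_congr rfl (hf.eventuallyEq_of_mem (hU.mem_nhds hy))

/-- The gradient is defined with a separately chosen frame at every point; its independence of the
frame (`sum_dual_smul`) gives it smooth coefficients. -/
theorem IsComb.gradH {f : M → ℝ} {F : smoothAlg n U} (hf : Set.EqOn f F U) :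
    S.IsComb X (S.gradH f) (fun i => (S.calculus hU hX).X i F) 0 := by
  intro y hy
  obtain ⟨U', hU', hyU', hF⟩ := (S.exists_frame y).choose_spec
  change IsOrthonormalFrameOn S.Hor S.g (S.frame y) U' at hF
  have h := S.sum_dual_smul hX hy hF hyU' (mvfderiv (𝓡 n) f y).toLinearMap
  simp only [← der_eq_X hU hX hf _ hy, Pi.zero_apply, ZeroMemClass.coe_zero, zero_smul,
    Finset.sum_const_zero, add_zero]
  exact h

/-- The vertical half of the Ricci trace vanishes because R(·, ·)∇_H f is horizontal. Torsion is
minus the vertical bracket, so the minus sign in front of ∇T becomes a plus in front of `nablaγ`.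
Working in the frame chosen at x matches the definition term by term. -/
theorem ricciForm_eq {x : M} (hx : x ∈ U) (hF : IsOrthonormalFrameOn S.Hor S.g (S.frame x) U)
    {f : M → ℝ} {F : smoothAlg n U} (hf : Set.EqOn f F U) :
    S.ricciForm f x = ((∑ i, (S.calculus hU hF).curv (Pi.single i 1)
          (fun k => (S.calculus hU hF).X k F) (fun k => (S.calculus hU hF).X k F) i
        + ∑ l, ∑ k, (∑ m, (S.calculus hU hF).nablaγ l k m * (S.calculus hU hF).Z m F)
          * (S.calculus hU hF).X k F
        + (1 / 4 : ℝ) • ∑ l, ∑ k, (S.calculus hU hF).γZ F l k ^ 2 : smoothAlg n U) : M → ℝ) x := by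
  have hg := IsComb.gradH hU hF hf
  have hfr : ∀ i, S.IsComb (S.frame x) (S.frame x i) (Pi.single i (1 : smoothAlg n U)) 0 :=
    fun i => IsComb.frame i
  have hder : ∀ {V : VField n M} {α : Fin h → smoothAlg n U}, S.IsComb (S.frame x) V 0 α →
      V.der f x = ((∑ m, α m * (S.calculus hU hF).Z m F : smoothAlg n U) : M → ℝ) x := by
    intro V α hV
    rw [VField.der_congr rfl (hf.eventuallyEq_of_mem (hU.mem_nhds hx)), hV.der_eq hU hF F hx]
    simp
  have h1 : ∀ i, S.gR x (S.curvature (S.frame x i) (S.gradH f) (S.gradH f) x) (S.frame x i x)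
      = ((S.calculus hU hF).curv (Pi.single i 1)
          (fun k => (S.calculus hU hF).X k F) (fun k => (S.calculus hU hF).X k F) i : M → ℝ) x := by
    intro i
    rw [((hfr i).curvature hU hF hg hg).gR_eq hF (hfr i) hx,
      Finset.sum_eq_single i (by intro b _ hb; simp [hb]) (by simp)]
    simp
  have h2 : ∀ m, S.gR x (S.curvature (S.Z m) (S.gradH f) (S.gradH f) x) (S.Z m x) = 0 := by
    intro m
    have hZ : S.IsComb (S.frame x) (S.Z m) 0 (Pi.single m (1 : smoothAlg n U)) := IsComb.Z m
    obtain ⟨r, hr⟩ := hZ.exists_curvature hU hF hg hg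
    rw [hr.gR_eq hF hZ hx]
    simp
  have h3 : ∀ l k, (S.torsion (S.frame x l) (S.frame x k)).der f x
      = -((S.calculus hU hF).γZ F l k : M → ℝ) x := by
    intro l k
    rw [hder ((hfr l).torsion hU hF (hfr k))]
    simp [FrameCalculus.brV_single, FrameCalculus.γZ]
  unfold ricciForm Ric
  simp only [h1, h2, h3, hder (isComb_nablaTorsion hU hF _ _), der_eq_X hU hF hf _ hx]
  simp only [Finset.sum_const_zero, add_zero, AddMemClass.coe_add, AddSubmonoidClass.coe_finsetSum,
    MulMemClass.coe_mul, Pi.add_apply, Pi.mul_apply, Finset.sum_apply, Subalgebra.coe_smul,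
    Pi.smul_apply, smul_eq_mul, SubmonoidClass.coe_pow, Pi.pow_apply, NegMemClass.coe_neg,
    Pi.neg_apply, neg_mul, Finset.sum_neg_distrib, neg_neg, neg_sq, Finset.sum_add_distrib,
    Finset.mul_sum, add_assoc]

theorem torsionForm_eq {x : M} (hx : x ∈ U) (hF : IsOrthonormalFrameOn S.Hor S.g (S.frame x) U)
    {f : M → ℝ} {F : smoothAlg n U} (hf : Set.EqOn f F U) :
    S.torsionForm f x = ((∑ i, ∑ m, (∑ j, (S.calculus hU hF).γ i j m
      * (S.calculus hU hF).X j F) ^ 2 : smoothAlg n U) : M → ℝ) x := by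
  have hg := IsComb.gradH hU hF hf
  have hfr : ∀ i, S.IsComb (S.frame x) (S.frame x i) (Pi.single i (1 : smoothAlg n U)) 0 :=
    fun i => IsComb.frame i
  unfold torsionForm
  simp only [((hfr _).torsion hU hF hg).gR_eq hF ((hfr _).torsion hU hF hg) hx]
  simp [FrameCalculus.brV_single_left, pow_two]

end TransverseSymmetries

/-! ### The divergence in a frame -/

section Determinant

variable {n : ℕ}

theorem sum_det_updateRow (A W : Matrix (Fin n) (Fin n) ℝ) :
    ∑ b, (A.updateRow b (W b)).det = (W * A.adjugate).trace := by
  refine Finset.sum_congr rfl fun b _ => ?_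
  rw [← Matrix.cramer_transpose_apply, Matrix.cramer_eq_adjugate_mulVec, Matrix.diag_apply,
    Matrix.mul_apply, Matrix.mulVec, dotProduct, ← Matrix.adjugate_transpose]
  exact Finset.sum_congr rfl fun j _ => mul_comm _ _

/-- The determinant as a continuous multilinear function of its rows. -/
def euclideanDet (n : ℕ) :
    ContinuousMultilinearMap ℝ (fun _ : Fin n => EuclideanSpace ℝ (Fin n)) ℝ where
  toMultilinearMap :=
    (Matrix.detRowAlternating (R := ℝ) (n := Fin n)).toMultilinearMap.compLinearMap fun _ => (EuclideanSpace.equiv (Fin n) ℝ).toLinearMap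
  cont := by
    change Continuous fun v : Fin n → EuclideanSpace ℝ (Fin n) =>
      Matrix.det (fun b => EuclideanSpace.equiv (Fin n) ℝ (v b))
    exact Continuous.matrix_det (by fun_prop)

theorem euclideanDet_apply (v : Fin n → EuclideanSpace ℝ (Fin n)) :
    euclideanDet n v = (Matrix.of fun b i => v b i).det := rfl

/-- Jacobi's formula: the determinant is multilinear in the rows, and replacing one row at a time is
summed by `sum_det_updateRow`. -/
theorem hasFDerivAt_det {E : Fin n → EuclideanSpace ℝ (Fin n) → EuclideanSpace ℝ (Fin n)}
    {p : EuclideanSpace ℝ (Fin n)} (hE : ∀ b, DifferentiableAt ℝ (E b) p) :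
    ∃ L : EuclideanSpace ℝ (Fin n) →L[ℝ] ℝ,
      HasFDerivAt (fun y => (Matrix.of fun b i => E b y i).det) L p ∧
      ∀ v, L v = ((Matrix.of fun b i => fderiv ℝ (E b) p v i)
        * (Matrix.of fun b i => E b p i).adjugate).trace := by
  have h := HasFDerivAt.multilinear_comp (euclideanDet n) fun b => (hE b).hasFDerivAt
  refine ⟨_, h, fun v => ?_⟩
  rw [← sum_det_updateRow, _root_.sum_apply]
  refine Finset.sum_congr rfl fun b _ => ?_
  rw [ContinuousLinearMap.comp_apply, ContinuousMultilinearMap.toContinuousLinearMap_apply,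
    euclideanDet_apply]
  congr 1
  ext c i
  by_cases hc : c = b
  · subst hc; simp
  · simp [hc]

/-- The divergence of `V` with respect to the density for which the frame `E` has volume one is
`-∑ b, E^b([V, E_b])`. -/
theorem divergence_eq_neg_trace
    {E : Fin n → EuclideanSpace ℝ (Fin n) → EuclideanSpace ℝ (Fin n)}
    {V : EuclideanSpace ℝ (Fin n) → EuclideanSpace ℝ (Fin n)} {p : EuclideanSpace ℝ (Fin n)}
    (hE : ∀ b, DifferentiableAt ℝ (E b) p) (hV : DifferentiableAt ℝ V p)
    {ρ : EuclideanSpace ℝ (Fin n) → ℝ}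
    (hρ : ρ =ᶠ[𝓝 p] fun y => |(Matrix.of fun b i => E b y i).det|⁻¹)
    (hdet : (Matrix.of fun b i => E b p i).det ≠ 0) (c : Matrix (Fin n) (Fin n) ℝ)
    (hc : ∀ b, VectorField.lieBracket ℝ V (E b) p = ∑ a, c b a • E a p) :
    (ρ p)⁻¹ * ∑ i, fderiv ℝ (fun y => ρ y * V y i) p (EuclideanSpace.single i 1)
      = -c.trace := by
  obtain ⟨L, hL, hLv⟩ := hasFDerivAt_det hE
  set A : Matrix (Fin n) (Fin n) ℝ := Matrix.of fun b i => E b p i with hA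
  let T : Matrix (Fin n) (Fin n) ℝ :=
    Matrix.of fun i j => fderiv ℝ V p (EuclideanSpace.single j 1) i
  have hexp : ∀ v : EuclideanSpace ℝ (Fin n), v = ∑ j, v j • EuclideanSpace.single j (1 : ℝ) := by
    intro v
    ext i
    simp [Pi.single_apply]
  -- The derivative of E_b along V is [V, E_b] + DV(E_b). In matrix form this is c A + A Tᵀ, with T
  -- the Jacobian of V.
  have hW : (Matrix.of fun b i => fderiv ℝ (E b) p (V p) i) = c * A + A * T.transpose := by
    ext b i
    have h1 : fderiv ℝ (E b) p (V p) = ∑ a, c b a • E a p + fderiv ℝ V p (E b p) := by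
      rw [← hc, VectorField.lieBracket]; abel
    have h2 : fderiv ℝ V p (E b p) i = ∑ j, E b p j * T i j := by
      conv_lhs => rw [hexp (E b p)]
      simp [T]
    rw [Matrix.of_apply, h1, Matrix.add_apply, Matrix.mul_apply, Matrix.mul_apply, PiLp.add_apply,
      h2]
    simp [hA]
  have hLV : L (V p) = A.det * (c.trace + T.trace) := by
    rw [hLv, hW, Matrix.add_mul, Matrix.trace_add, Matrix.mul_assoc, Matrix.mul_adjugate,
      Matrix.mul_assoc A, Matrix.trace_mul_comm A, Matrix.mul_assoc, Matrix.adjugate_mul]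
    simp [Matrix.trace_smul]
    ring
  have hρ' : HasFDerivAt ρ (-((|A.det| ^ 2)⁻¹ * (SignType.sign A.det : ℝ)) • L) p := by
    have h1 := (hasDerivAt_abs hdet).comp_hasFDerivAt p hL
    have h2 := (hasDerivAt_inv (abs_ne_zero.2 hdet)).comp_hasFDerivAt p h1
    refine (h2.congr_of_eventuallyEq hρ).congr_fderiv ?_
    rw [smul_smul, neg_mul]
  have hVi : ∀ i, HasFDerivAt (fun y => V y i)
      ((EuclideanSpace.proj i : EuclideanSpace ℝ (Fin n) →L[ℝ] ℝ).comp (fderiv ℝ V p)) p := fun i =>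
    (EuclideanSpace.proj i : EuclideanSpace ℝ (Fin n) →L[ℝ] ℝ).hasFDerivAt.comp p hV.hasFDerivAt
  have hρp : ρ p = |A.det|⁻¹ := hρ.self_of_nhds
  have hne := abs_ne_zero.2 hdet
  -- The product rule gives ρ tr T + Vρ. Jacobi's formula makes Vρ equal to -ρ (tr c + tr T), so the
  -- chart-dependent tr T cancels and -tr c remains.
  have hsum : ∑ i, fderiv ℝ (fun y => ρ y * V y i) p (EuclideanSpace.single i 1)
      = ρ p * T.trace - (|A.det| ^ 2)⁻¹ * (SignType.sign A.det : ℝ) * L (V p) := by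
    have h1 : ∀ i, fderiv ℝ (fun y => ρ y * V y i) p (EuclideanSpace.single i 1)
        = ρ p * T i i - (|A.det| ^ 2)⁻¹ * (SignType.sign A.det : ℝ)
          * (V p i * L (EuclideanSpace.single i 1)) := by
      intro i
      have h := hρ'.mul (hVi i)
      change HasFDerivAt (fun y => ρ y * V y i) _ p at h
      rw [h.fderiv]
      simp [T]
      ring
    have h2 : L (V p) = ∑ i, V p i * L (EuclideanSpace.single i 1) := by
      conv_lhs => rw [hexp (V p)]
      simp
    simp only [h1, Finset.sum_sub_distrib, ← Finset.mul_sum, h2]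
    rfl
  rw [hsum, hLV, hρp]
  have h3 : (|A.det| ^ 2)⁻¹ * (SignType.sign A.det : ℝ) * (A.det * (c.trace + T.trace))
      = |A.det|⁻¹ * (c.trace + T.trace) := by
    have : (SignType.sign A.det : ℝ) * A.det = |A.det| := sign_mul_self _
    calc _ = (|A.det| ^ 2)⁻¹ * ((SignType.sign A.det : ℝ) * A.det) * (c.trace + T.trace) := by ring
      _ = _ := by rw [this]; field_simp
  rw [h3]
  field_simp
  ring

end Determinant

theorem FrameCalculus.neg_sum_brH_single {A ι κ : Type*} [CommRing A] [Algebra ℝ A] [Fintype ι]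
    [Fintype κ] [DecidableEq ι] (C : FrameCalculus A ι κ) (a : ι → A) :
    -∑ k, C.brH a (Pi.single k 1) k = C.div a := by
  have h : ∀ k, C.brH a (Pi.single k 1) k = -C.X k (a k) - ∑ i, C.c k i k * a i := by
    intro k
    simp [brH, Pi.single_apply, C.c_swap k _ k, mul_comm, sub_eq_add_neg]
  simp only [h, div, b, Finset.sum_sub_distrib, Finset.sum_neg_distrib, Finset.sum_add_distrib,
    Finset.sum_mul]
  rw [Finset.sum_comm]
  ring

namespace TransverseSymmetries

variable {n d h : ℕ} {M : Type*} [TopologicalSpace M] [ChartedSpace (EuclideanSpace ℝ (Fin n)) M]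
  [IsManifold (𝓡 n) ∞ M] {S : TransverseSymmetries n d M h}
  {X : Fin d → VField n M} {U : Set M}

theorem gR_sum {ι : Type*} [Fintype ι] (y : M) (c c' : ι → ℝ) (u v : ι → TangentSpace (𝓡 n) y) :
    S.gR y (∑ i, c i • u i) (∑ j, c' j • v j) = ∑ i, ∑ j, c i * S.gR y (u i) (v j) * c' j := by
  have h1 : ∀ (c : ι → ℝ) (u : ι → TangentSpace (𝓡 n) y),
      S.projH y (∑ i, c i • u i) = ∑ i, c i • S.projH y (u i) := by
    intro c u
    simp [projH]
  have h2 : ∀ (c : ι → ℝ) (u : ι → TangentSpace (𝓡 n) y) (m : Fin h),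
      S.vertCoord y (∑ i, c i • u i) m = ∑ i, c i * S.vertCoord y (u i) m := by
    intro c u m
    simp only [vertCoord, h1, ← Finset.sum_sub_distrib, ← smul_sub, map_sum, map_smul,
      Finsupp.finsetSum_apply, Finsupp.smul_apply, smul_eq_mul]
  unfold gR
  simp only [h1, h2, map_sum, map_smul, LinearMap.sum_apply, LinearMap.smul_apply, smul_eq_mul,
    mul_add, add_mul, Finset.sum_add_distrib, Finset.mul_sum, Finset.sum_mul]
  congr 1
  · rw [Finset.sum_comm]
    exact Finset.sum_congr rfl fun i _ => Finset.sum_congr rfl fun j _ => by ring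
  · rw [← sum_rotate, Finset.sum_comm]
    exact Finset.sum_congr rfl fun i _ => Finset.sum_congr rfl fun j _ =>
      Finset.sum_congr rfl fun m _ => by ring

variable [T2Space M] [ConnectedSpace M]

variable (S) in
theorem card_adapted (hX : IsOrthonormalFrameOn S.Hor S.g X U) {y : M} (hy : y ∈ U) :
    Fintype.card (Fin d ⊕ Fin h) = n := by
  have hli := S.linearIndependent_adapted hX hy
  have hsp : ⊤ ≤ Submodule.span ℝ (Set.range fun a => S.adapted X a y) := by
    intro v _
    rw [S.eq_sum_frame hX hy v]
    exact Submodule.add_mem _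
      (Submodule.sum_mem _ fun i _ => Submodule.smul_mem _ _
        (Submodule.subset_span ⟨Sum.inl i, rfl⟩))
      (Submodule.sum_mem _ fun m _ => Submodule.smul_mem _ _
        (Submodule.subset_span ⟨Sum.inr m, rfl⟩))
  rw [← Module.finrank_eq_card_basis (Module.Basis.mk hli hsp), finrank_tangentSpace]

variable (S) in
theorem gR_adapted (hX : IsOrthonormalFrameOn S.Hor S.g X U) {y : M} (hy : y ∈ U)
    (a b : Fin d ⊕ Fin h) :
    S.gR y (S.adapted X a y) (S.adapted X b y) = if a = b then 1 else 0 := by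
  have hF : ∀ i, S.IsComb X (X i) (Pi.single i (1 : smoothAlg n U)) 0 := fun i => IsComb.frame i
  have hZ : ∀ m, S.IsComb X (S.Z m) 0 (Pi.single m (1 : smoothAlg n U)) := fun m => IsComb.Z m
  have hs : ∀ {N : ℕ} (i j : Fin N), ∑ k, ((Pi.single i (1 : smoothAlg n U) : Fin N → smoothAlg n U)
      k : M → ℝ) y * ((Pi.single j (1 : smoothAlg n U) : Fin N → smoothAlg n U) k : M → ℝ) y
      = if i = j then 1 else 0 := by
    intro N i j
    rw [Finset.sum_eq_single i (by intro b _ hb; simp [hb]) (by simp)]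
    by_cases hij : i = j
    · subst hij; simp
    · simp [hij]
  rcases a with i | m <;> rcases b with j | l
  · simpa [hs, adapted] using (hF i).gR_eq hX (hF j) hy
  · simpa [adapted] using (hF i).gR_eq hX (hZ l) hy
  · simpa [adapted] using (hZ m).gR_eq hX (hF j) hy
  · simpa [hs, adapted] using (hZ m).gR_eq hX (hZ l) hy

/-- If A holds the chart components of the adapted orthonormal frame and G is the Gram matrix of the
coordinate fields, then A G Aᵀ = 1. Hence √det G = |det A|⁻¹. -/
theorem chartDensity_eq (hX : IsOrthonormalFrameOn S.Hor S.g X U) (σ : Fin n ≃ Fin d ⊕ Fin h)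
    {x₀ : M} {y : EuclideanSpace ℝ (Fin n)} (hy : y ∈ (extChartAt (𝓡 n) x₀).target)
    (hyU : (extChartAt (𝓡 n) x₀).symm y ∈ U) :
    (Matrix.of fun b i => chartRep x₀ (S.adapted X (σ b)) y i).det ≠ 0 ∧
    S.chartDensity x₀ y = |(Matrix.of fun b i => chartRep x₀ (S.adapted X (σ b)) y i).det|⁻¹ := by
  set A : Matrix (Fin n) (Fin n) ℝ :=
    Matrix.of fun b i => chartRep x₀ (S.adapted X (σ b)) y i with hA
  let D := mfderiv 𝓘(ℝ, EuclideanSpace ℝ (Fin n)) (𝓡 n) (extChartAt (𝓡 n) x₀).symm y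
  let e : Fin n → TangentSpace (𝓡 n) ((extChartAt (𝓡 n) x₀).symm y) := fun i =>
    D (EuclideanSpace.single i (1 : ℝ))
  let G : Matrix (Fin n) (Fin n) ℝ :=
    Matrix.of fun i j => S.gR ((extChartAt (𝓡 n) x₀).symm y) (e i) (e j)
  have hρ : S.chartDensity x₀ y = Real.sqrt G.det := rfl
  have hcomb : ∀ b, S.adapted X (σ b) ((extChartAt (𝓡 n) x₀).symm y) = ∑ i, A b i • e i := by
    intro b
    rw [← mfderiv_chartRep (S.adapted X (σ b)) hy]
    have h1 : chartRep x₀ (S.adapted X (σ b)) y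
        = ∑ j, A b j • EuclideanSpace.single j (1 : ℝ) := by
      ext i
      simp [hA, Pi.single_apply]
    rw [h1]
    change D _ = _
    exact (map_sum D _ _).trans (Finset.sum_congr rfl fun j _ => map_smul D _ _)
  have hone : A * G * A.transpose = 1 := by
    ext b c
    have h1 := S.gR_adapted hX hyU (σ b) (σ c)
    rw [hcomb, hcomb, gR_sum, Finset.sum_comm] at h1
    simp only [Matrix.mul_apply, Matrix.transpose_apply, Finset.sum_mul, Matrix.one_apply]
    simp only [σ.injective.eq_iff] at h1
    exact h1
  have hdet : A.det ^ 2 * G.det = 1 := by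
    have := congrArg Matrix.det hone
    rw [Matrix.det_mul, Matrix.det_mul, Matrix.det_transpose, Matrix.det_one] at this
    linarith
  have hne : A.det ≠ 0 := by
    rintro h0
    simp [h0] at hdet
  refine ⟨hne, ?_⟩
  have hG : G.det = (|A.det|⁻¹) ^ 2 := by
    rw [inv_pow, sq_abs]
    exact eq_inv_of_mul_eq_one_right hdet
  rw [hρ, hG, Real.sqrt_sq (by positivity)]

/-- The divergence of a horizontal field. -/
theorem IsComb.divergence_eq (hU : IsOpen U) (hX : IsOrthonormalFrameOn S.Hor S.g X U)
    {V : VField n M} {a : Fin d → smoothAlg n U} (hV : S.IsComb X V a 0) {y : M} (hy : y ∈ U) :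
    S.divergence V y = ((S.calculus hU hX).div a : M → ℝ) y := by
  obtain ⟨σ⟩ : Nonempty (Fin n ≃ Fin d ⊕ Fin h) :=
    ⟨Fintype.equivOfCardEq (by rw [S.card_adapted hX hy, Fintype.card_fin])⟩
  have hUy := hU.mem_nhds hy
  set φ := extChartAt (𝓡 n) y with hφ
  have hnear : ∀ᶠ z in 𝓝 (φ y), z ∈ φ.target ∧ φ.symm z ∈ U := by
    refine Filter.Eventually.and
      ((isOpen_extChartAt_target y).mem_nhds (mem_extChartAt_target y)) ?_
    exact (continuousAt_extChartAt_symm y).preimage_mem_nhds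
      (by rw [extChartAt_to_inv]; exact hUy)
  have hdiff : ∀ {W : VField n M}, W.SmoothOn U → DifferentiableAt ℝ (chartRep y W) (φ y) :=
    fun hW => differentiableAt_chartRep ((hW.contMDiffAt hUy).mdifferentiableAt (by simp))
  have hVs := hV.smoothOn hX
  let c : Fin d ⊕ Fin h → Fin d ⊕ Fin h → ℝ := fun b =>
    Sum.elim (fun k => S.g y (S.projH y (V.bracket (S.adapted X b) y)) (X k y))
      (fun m => S.vertCoord y (V.bracket (S.adapted X b) y) m)
  have hlin : ∀ b, VectorField.lieBracket ℝ (chartRep y V) (chartRep y (S.adapted X b)) (φ y)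
      = ∑ a, c b a • chartRep y (S.adapted X a) (φ y) := by
    intro b
    rw [← chartRep_bracket]
    simp only [chartRep_eq _ (mem_extChartAt_source (I := 𝓡 n) y), hφ]
    have h1 := S.eq_sum_frame hX hy (V.bracket (S.adapted X b) y)
    have h2 : V.bracket (S.adapted X b) y = ∑ a, c b a • S.adapted X a y := by
      rw [Fintype.sum_sum_type]; exact h1
    rw [h2]
    exact (map_sum (mfderiv (𝓡 n) 𝓘(ℝ, EuclideanSpace ℝ (Fin n)) (extChartAt (𝓡 n) y) y) _ _).trans
      (Finset.sum_congr rfl fun j _ => map_smul _ _ _)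
  have key := divergence_eq_neg_trace (p := φ y) (V := chartRep y V) (ρ := S.chartDensity y)
    (E := fun b => chartRep y (S.adapted X (σ b)))
    (fun b => hdiff (S.smoothOn_adapted hX (σ b))) (hdiff hVs)
    (by filter_upwards [hnear] with z hz using (chartDensity_eq hX σ hz.1 hz.2).2)
    (chartDensity_eq hX σ hnear.self_of_nhds.1 hnear.self_of_nhds.2).1
    (Matrix.of fun b a => c (σ b) (σ a))
    (fun b => (hlin (σ b)).trans
      (σ.sum_comp fun a => c (σ b) a • chartRep y (S.adapted X a) (φ y)).symm)
  have htr : Matrix.trace (Matrix.of fun b a => c (σ b) (σ a)) = ∑ b, c b b :=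
    σ.sum_comp fun b => c b b
  have hH : ∀ k, c (Sum.inl k) (Sum.inl k)
      = ((S.calculus hU hX).brH a (Pi.single k 1) k : M → ℝ) y := by
    intro k
    have hb := hV.bracket hU hX (IsComb.frame k)
    change S.g y (S.projH y (V.bracket (X k) y)) (X k y) = _
    rw [hb.projH_eq hX hy]
    simp [hX.orthonormal y hy]
  -- Brackets of horizontal fields with Z m are horizontal, so the vertical directions contribute
  -- nothing to the trace: μ yields the purely horizontal `div`.
  have hZ : ∀ m, c (Sum.inr m) (Sum.inr m) = 0 := by
    intro m
    change S.vertCoord y (V.bracket (S.Z m) y) m = 0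
    have h1 : (S.Z m).bracket V y ∈ S.Hor y := by
      refine (S.killing _ (S.Zbasis m).2).bracket_mem U V hU hVs (fun z hz => ?_) y hy
      rw [hV.eq_sum z hz]
      exact S.sum_frame_mem hX hz _
    rw [V.bracket_swap, S.vertCoord_neg]
    simpa using S.vertCoord_add h1 0 m
  have hdiv : S.divergence V y = -∑ b, c b b := by rw [← htr, ← key]; rfl
  rw [hdiv, Fintype.sum_sum_type]
  simp only [hH, hZ, Finset.sum_const_zero, add_zero, ← FrameCalculus.neg_sum_brH_single]
  simp

end TransverseSymmetries

/-! ### Bochner's formula at a point and its dependence on the jet -/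

namespace FrameCalculus

variable {A ι κ : Type*} [CommRing A] [Algebra ℝ A] [Fintype ι] [Fintype κ]
  (C : FrameCalculus A ι κ)

/-- The curvature form `𝓡(f)`. -/
def ricci [DecidableEq ι] (f : A) : A :=
  ∑ i, C.curv (Pi.single i 1) (fun k => C.X k f) (fun k => C.X k f) i
    + ∑ l, ∑ k, (∑ m, C.nablaγ l k m * C.Z m f) * C.X k f
    + (1 / 4 : ℝ) • ∑ l, ∑ k, C.γZ f l k ^ 2

/-- The symmetric part of the horizontal Hessian. -/
def symHess (f : A) (i j : ι) : A := C.hess f i j - (1 / 2 : ℝ) • C.γZ f i j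

/-- The vertical components of `[X i, ∇f]`, up to derivatives of the coefficients. -/
def tor (f : A) (i : ι) (m : κ) : A := ∑ j, C.γ i j m * C.X j f

/-- Subtracting half of the skew difference `hess_sub` leaves a symmetric array. Symmetry is what
allows it to be prescribed through a function's second jet. -/
theorem symHess_swap (f : A) (i j : ι) : C.symHess f j i = C.symHess f i j := by
  have h1 := C.hess_sub f i j
  have h2 : C.γZ f j i = -C.γZ f i j := by rw [← hess_sub, ← hess_sub]; ring
  have h3 := two_smul_half (C.γZ f i j)
  simp only [symHess, h2, smul_neg]
  linear_combination -h1 + h3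

theorem lap_eq_sum_symHess (f : A) : C.lap f = ∑ i, C.symHess f i i := by
  have h : ∀ i, C.γZ f i i = 0 := fun i => by rw [← hess_sub, sub_self]
  simp [lap_eq_sum_hess, symHess, h]

variable (ev : A →ₐ[ℝ] ℝ)

theorem eval_bochner [DecidableEq ι] (f : A) :
    ev (C.lap (∑ j, C.X j f * C.X j f)) - 2 * ev (∑ k, C.X k f * C.X k (C.lap f))
      = 2 * (ev (C.ricci f) + ∑ i, ∑ j, ev (C.symHess f i j) ^ 2
        + 2 * ∑ i, ∑ m, ev (C.tor f i m) * ev (C.X i (C.Z m f))) := by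
  have h := congrArg ev (C.bochner f)
  have h2 : ∑ i, ∑ j, ∑ m, C.X j f * C.γ i j m * C.X i (C.Z m f)
      = ∑ i, ∑ m, C.tor f i m * C.X i (C.Z m f) := by
    refine Finset.sum_congr rfl fun i _ => ?_
    rw [Finset.sum_comm]
    refine Finset.sum_congr rfl fun m _ => ?_
    rw [tor, Finset.sum_mul]
    exact Finset.sum_congr rfl fun j _ => by ring
  rw [sum_hess_sq, h2] at h
  simp only [map_sub, map_mul, map_add, map_ofNat, map_smul, smul_eq_mul] at h
  rw [h, ricci]
  simp only [map_add, map_sum, map_mul, map_pow, map_smul, smul_eq_mul, symHess]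
  ring

/-- Although `curv` is written with derivatives of the gradient, tensoriality (`curv_eq_sum`) makes
it quadratic in the values X k f at the point. -/
theorem eval_ricci_congr [DecidableEq ι] {f g : A} (hX : ∀ i, ev (C.X i f) = ev (C.X i g))
    (hZ : ∀ m, ev (C.Z m f) = ev (C.Z m g)) : ev (C.ricci f) = ev (C.ricci g) := by
  have h : ∀ (f : A) (i : ι), C.curv (Pi.single i 1) (fun k => C.X k f) (fun k => C.X k f) i = _ :=
    fun f i => C.curv_eq_sum _ _ _ _
  simp only [ricci, h, γZ, map_add, map_sum, map_mul, map_smul, map_pow, hX, hZ]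

theorem eval_tor_congr {f g : A} (hX : ∀ i, ev (C.X i f) = ev (C.X i g)) (i : ι) (m : κ) :
    ev (C.tor f i m) = ev (C.tor g i m) := by
  simp only [tor, map_sum, map_mul, hX]

theorem eval_symHess_add (f p : A) (hX : ∀ i, ev (C.X i p) = 0) (hZ : ∀ m, ev (C.Z m p) = 0)
    (i j : ι) : ev (C.symHess (f + p) i j) = ev (C.symHess f i j) + ev (C.X i (C.X j p)) := by
  simp only [symHess, hess, γZ, map_add, map_sub, map_sum, map_mul, map_smul, hX, hZ, add_zero]
  ring

end FrameCalculus

section Quadratic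

variable {A α : Type*} [CommRing A] [Algebra ℝ A] [Fintype α] (ev : A →ₐ[ℝ] ℝ) {t : α → A}
  (Q : α → α → ℝ)

theorem Derivation.eval_quadratic (ht : ∀ a, ev (t a) = 0) (D : Derivation ℝ A A) :
    ev (D (∑ a, ∑ b, (Q a b / 2) • (t a * t b))) = 0 := by
  simp [ht]

/-- At a common zero of the t a only terms with both factors differentiated survive. Each pair of
indices is reached twice, which the factor ½ and the symmetry of Q compensate. -/
theorem Derivation.eval_eval_quadratic [DecidableEq α] (ht : ∀ a, ev (t a) = 0)
    (hQ : ∀ a b, Q a b = Q b a) {E : α → Derivation ℝ A A}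
    (hE : ∀ a b, ev (E a (t b)) = if a = b then 1 else 0) (a b : α) :
    ev (E a (E b (∑ a, ∑ b, (Q a b / 2) • (t a * t b)))) = Q a b := by
  simp [ht, hE, Finset.sum_add_distrib, hQ b a]

end Quadratic

section Evaluation

variable {n : ℕ} {M : Type*} [TopologicalSpace M] [ChartedSpace (EuclideanSpace ℝ (Fin n)) M]

/-- Evaluation at a point. -/
def smoothAlg.eval (U : Set M) (x : M) : smoothAlg n U →ₐ[ℝ] ℝ :=
  (Pi.evalAlgHom ℝ (fun _ : M => ℝ) x).comp (smoothAlg n U).val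

theorem smoothAlg.eval_apply {U : Set M} (x : M) (f : smoothAlg n U) :
    smoothAlg.eval U x f = (f : M → ℝ) x := rfl

end Evaluation

/-! ### The forms Γ, Γ^Z, Γ₂ and Γ₂^Z at a point -/

namespace TransverseSymmetries

variable {n d h : ℕ} {M : Type*} [TopologicalSpace M] [ChartedSpace (EuclideanSpace ℝ (Fin n)) M]
  [IsManifold (𝓡 n) ∞ M] {S : TransverseSymmetries n d M h}
  {X : Fin d → VField n M} {U : Set M} [T2Space M] [ConnectedSpace M]
  (hU : IsOpen U) (hX : IsOrthonormalFrameOn S.Hor S.g X U)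

theorem exists_dual_smoothAlg {x : M} (hx : x ∈ U) :
    ∃ t : Fin d ⊕ Fin h → smoothAlg n U, (∀ a, SmoothFun n (t a : M → ℝ)) ∧
      (∀ a, smoothAlg.eval U x (t a) = 0) ∧
      ∀ a b, smoothAlg.eval U x (Sum.elim (S.calculus hU hX).X (S.calculus hU hX).Z a (t b))
        = if a = b then 1 else 0 := by
  obtain ⟨t, hts, ht0, htd⟩ := exists_dual_functions (S.linearIndependent_adapted hX hx)
  refine ⟨fun a => ⟨t a, (hts a).contMDiffOn⟩, hts, ht0, fun a b => ?_⟩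
  rw [← htd a b]
  rcases a with i | m
  · exact calculus_X_apply hU hX i _ hx
  · exact calculus_Z_apply hU hX m _ hx

/-- A function with vanishing first derivatives and prescribed second derivatives at a point. -/
theorem exists_second_jet {x : M} (hx : x ∈ U) (Q : Fin d ⊕ Fin h → Fin d ⊕ Fin h → ℝ)
    (hQ : ∀ a b, Q a b = Q b a) :
    ∃ p : smoothAlg n U, SmoothFun n (p : M → ℝ) ∧
      (∀ i, smoothAlg.eval U x ((S.calculus hU hX).X i p) = 0) ∧
      (∀ m, smoothAlg.eval U x ((S.calculus hU hX).Z m p) = 0) ∧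
      (∀ i j, smoothAlg.eval U x ((S.calculus hU hX).X i ((S.calculus hU hX).X j p))
        = Q (Sum.inl i) (Sum.inl j)) ∧
      ∀ i m, smoothAlg.eval U x ((S.calculus hU hX).X i ((S.calculus hU hX).Z m p))
        = Q (Sum.inl i) (Sum.inr m) := by
  obtain ⟨t, hts, ht0, htd⟩ := exists_dual_smoothAlg hU hX hx
  set E := Sum.elim (S.calculus hU hX).X (S.calculus hU hX).Z with hE
  set ev := smoothAlg.eval (n := n) U x with hev
  let p : smoothAlg n U := ∑ a, ∑ b, (Q a b / 2) • (t a * t b)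
  have h1 : ∀ a, ev (E a p) = 0 := fun a => Derivation.eval_quadratic ev Q ht0 (E a)
  have h2 : ∀ a b, ev (E a (E b p)) = Q a b := Derivation.eval_eval_quadratic ev Q ht0 hQ htd
  refine ⟨p, ?_, fun i => h1 (Sum.inl i), fun m => h1 (Sum.inr m),
    fun i j => h2 (Sum.inl i) (Sum.inl j), fun i m => h2 (Sum.inl i) (Sum.inr m)⟩
  have hp : (p : M → ℝ) = ∑ a, ∑ b, fun y => (Q a b / 2) * ((t a : M → ℝ) y * (t b : M → ℝ) y) := by
    funext y
    simp [p]
  have hmem : ∀ f : M → ℝ, SmoothFun n f ↔ f ∈ smoothAlg n (Set.univ : Set M) := fun f =>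
    contMDiffOn_univ.symm
  rw [hmem, hp]
  refine sum_mem fun a _ => sum_mem fun b _ => ?_
  exact Subalgebra.smul_mem _ (Subalgebra.mul_mem _ ((hmem _).1 (hts a)) ((hmem _).1 (hts b))) _

theorem subLaplacian_eqOn {f : M → ℝ} {F : smoothAlg n U} (hf : Set.EqOn f F U) :
    Set.EqOn (S.subLaplacian f) ((S.calculus hU hX).lap F : M → ℝ) U := fun _ hy =>
  (IsComb.gradH hU hX hf).divergence_eq hU hX hy

theorem carreDuChamp_eqOn {f g : M → ℝ} {F G : smoothAlg n U} (hf : Set.EqOn f F U)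
    (hg : Set.EqOn g G U) :
    Set.EqOn (carreDuChamp S.subLaplacian f g)
      ((∑ i, (S.calculus hU hX).X i F * (S.calculus hU hX).X i G : smoothAlg n U) : M → ℝ) U := by
  intro y hy
  have hfg : Set.EqOn (fun y => f y * g y) ((F * G : smoothAlg n U) : M → ℝ) U := fun z hz => by
    simp only [hf hz, hg hz, MulMemClass.coe_mul, Pi.mul_apply]
  have hl := congrArg (smoothAlg.eval U y) ((S.calculus hU hX).lap_mul F G)
  simp only [map_add, map_mul, map_ofNat] at hl
  unfold carreDuChamp
  rw [subLaplacian_eqOn hU hX hfg hy, subLaplacian_eqOn hU hX hf hy, subLaplacian_eqOn hU hX hg hy,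
    hf hy, hg hy]
  simp only [← smoothAlg.eval_apply]
  rw [hl]
  ring

theorem ΓZ_eqOn {f g : M → ℝ} {F G : smoothAlg n U} (hf : Set.EqOn f F U) (hg : Set.EqOn g G U) :
    Set.EqOn (S.ΓZ f g)
      ((∑ m, (S.calculus hU hX).Z m F * (S.calculus hU hX).Z m G : smoothAlg n U) : M → ℝ) U := by
  intro y hy
  simp only [ΓZ, der_eq_Z hU hX hf _ hy, der_eq_Z hU hX hg _ hy]
  simp

/-- The sub-Laplacian commutes with the fields `Z m`. -/
theorem lap_Z (m : Fin h) (F : smoothAlg n U) :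
    (S.calculus hU hX).lap ((S.calculus hU hX).Z m F)
      = (S.calculus hU hX).Z m ((S.calculus hU hX).lap F) := by
  refine (S.calculus hU hX).comm_lap_Z m F fun k => smoothAlg.ext_on_off (fun y hy => ?_)
    fun y hy => ?_
  · obtain ⟨t, -, -, htd⟩ := exists_dual_smoothAlg hU hX hy
    have h := (S.calculus hU hX).eval_Z_b (smoothAlg.eval U y).toRingHom (fun j => t (Sum.inl j))
      (fun i j => by simpa using htd (Sum.inl i) (Sum.inl j))
      (fun m j => by simpa using htd (Sum.inr m) (Sum.inl j)) m k
    have h' : smoothAlg.eval U y _ = smoothAlg.eval U y _ := h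
    rw [← smoothAlg.eval_apply, ← smoothAlg.eval_apply, map_mul, map_mul, h']
  · have h0 : ((S.calculus hU hX).X k F : M → ℝ) y = 0 :=
      VField.toDerivation_apply_of_notMem hU (X k) (hX.smooth k) F hy
    rw [MulMemClass.coe_mul, MulMemClass.coe_mul, Pi.mul_apply, Pi.mul_apply, h0, mul_zero,
      mul_zero]

variable {x : M} {f : M → ℝ} {F : smoothAlg n U}

theorem subLaplacian_apply (hx : x ∈ U) (hf : Set.EqOn f F U) :
    S.subLaplacian f x = ∑ i, smoothAlg.eval U x ((S.calculus hU hX).symHess F i i) := by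
  rw [subLaplacian_eqOn hU hX hf hx, ← smoothAlg.eval_apply, FrameCalculus.lap_eq_sum_symHess,
    map_sum]

theorem carreDuChamp_apply (hx : x ∈ U) (hf : Set.EqOn f F U) :
    carreDuChamp S.subLaplacian f f x
      = ∑ i, smoothAlg.eval U x ((S.calculus hU hX).X i F) ^ 2 := by
  rw [carreDuChamp_eqOn hU hX hf hf hx, ← smoothAlg.eval_apply]
  simp [pow_two]

theorem ΓZ_apply (hx : x ∈ U) (hf : Set.EqOn f F U) :
    S.ΓZ f f x = ∑ m, smoothAlg.eval U x ((S.calculus hU hX).Z m F) ^ 2 := by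
  rw [ΓZ_eqOn hU hX hf hf hx, ← smoothAlg.eval_apply]
  simp [pow_two]

theorem iteratedForm_carreDuChamp_apply (hx : x ∈ U) (hf : Set.EqOn f F U) :
    iteratedForm S.subLaplacian (carreDuChamp S.subLaplacian) f f x
      = smoothAlg.eval U x ((S.calculus hU hX).ricci F)
        + ∑ i, ∑ j, smoothAlg.eval U x ((S.calculus hU hX).symHess F i j) ^ 2
        + 2 * ∑ i, ∑ m, smoothAlg.eval U x ((S.calculus hU hX).tor F i m)
          * smoothAlg.eval U x ((S.calculus hU hX).X i ((S.calculus hU hX).Z m F)) := by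
  have hl := subLaplacian_eqOn hU hX hf
  have hb := (S.calculus hU hX).eval_bochner (smoothAlg.eval U x) F
  unfold iteratedForm
  rw [subLaplacian_eqOn hU hX (carreDuChamp_eqOn hU hX hf hf) hx, carreDuChamp_eqOn hU hX hf hl hx]
  simp only [← smoothAlg.eval_apply]
  linarith

theorem iteratedForm_ΓZ_apply (hx : x ∈ U) (hf : Set.EqOn f F U) :
    iteratedForm S.subLaplacian S.ΓZ f f x
      = ∑ i, ∑ m, smoothAlg.eval U x ((S.calculus hU hX).X i ((S.calculus hU hX).Z m F)) ^ 2 := by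
  have hl := subLaplacian_eqOn hU hX hf
  have hb := congrArg (smoothAlg.eval U x)
    ((S.calculus hU hX).bochner_vertical F fun m => lap_Z hU hX m F)
  unfold iteratedForm
  rw [subLaplacian_eqOn hU hX (ΓZ_eqOn hU hX hf hf) hx, ΓZ_eqOn hU hX hf hl hx]
  simp only [map_sub, map_mul, map_ofNat, map_sum, map_pow] at hb
  simp only [← smoothAlg.eval_apply, map_sum, map_mul]
  linarith

end TransverseSymmetries

/-! ### The pointwise inequalities -/

theorem inv_card_mul_sq_trace_le {d : ℕ} (H : Fin d → Fin d → ℝ) :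
    ((d : ℝ≥0∞)⁻¹).toReal * (∑ i, H i i) ^ 2 ≤ ∑ i, ∑ j, H i j ^ 2 := by
  have h1 : ∑ i, H i i ^ 2 ≤ ∑ i, ∑ j, H i j ^ 2 := Finset.sum_le_sum fun i _ =>
    Finset.single_le_sum (f := fun j => H i j ^ 2) (fun j _ => sq_nonneg _) (Finset.mem_univ i)
  refine le_trans ?_ h1
  rcases Nat.eq_zero_or_pos d with rfl | hd
  -- For d = 0 the trace is an empty sum and the inverse has real value 0, so the left side is 0.
  · simp
  · have h2 := sq_sum_le_card_mul_sum_sq (s := (Finset.univ : Finset (Fin d))) (f := fun i => H i i)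
    rw [Finset.card_univ, Fintype.card_fin] at h2
    have hd' : (0 : ℝ) < d := Nat.cast_pos.2 hd
    rw [ENNReal.toReal_inv, ENNReal.toReal_natCast, inv_mul_le_iff₀ hd']
    exact h2

/-- Completing the square: equality holds exactly at q = -c/ν, which is the value used for
necessity. -/
theorem neg_sum_sq_div_le {d h : ℕ} (c q : Fin d → Fin h → ℝ) {ν : ℝ} (hν : 0 < ν) :
    -((∑ i, ∑ m, c i m ^ 2) / ν) ≤ 2 * ∑ i, ∑ m, c i m * q i m + ν * ∑ i, ∑ m, q i m ^ 2 := by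
  have h : 0 ≤ ∑ i, ∑ m, (c i m + ν * q i m) ^ 2 / ν :=
    Finset.sum_nonneg fun i _ => Finset.sum_nonneg fun m _ => by positivity
  have h2 : ∑ i, ∑ m, (c i m + ν * q i m) ^ 2 / ν
      = (∑ i, ∑ m, c i m ^ 2) / ν
        + (2 * ∑ i, ∑ m, c i m * q i m + ν * ∑ i, ∑ m, q i m ^ 2) := by
    simp only [Finset.sum_div, Finset.mul_sum, ← Finset.sum_add_distrib]
    refine Finset.sum_congr rfl fun i _ => Finset.sum_congr rfl fun m _ => ?_
    field_simp
    ring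
  linarith

/-- Large ν isolates a and small ν isolates b, after multiplication by ν. -/
theorem nonneg_of_forall_pos_add_div {a b : ℝ} (hab : ∀ ν : ℝ, 0 < ν → 0 ≤ a + b / ν) :
    0 ≤ a ∧ 0 ≤ b := by
  have hm : ∀ ν : ℝ, 0 < ν → 0 ≤ ν * a + b := fun ν hν => by
    have := mul_nonneg hν.le (hab ν hν)
    rwa [mul_add, mul_div_cancel₀ _ hν.ne'] at this
  constructor
  · by_contra! ha
    -- Chosen so that ν a = -(|b| + 1), which makes ν a + b ≤ -1.
    have h1 := hm ((|b| + 1) / -a) (div_pos (by positivity) (by linarith))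
    have h2 : (|b| + 1) / -a * a = -(|b| + 1) := by
      rw [div_neg, neg_mul, div_mul_cancel₀ _ ha.ne]
    linarith [le_abs_self b]
  · by_contra! hb
    -- Chosen so that ν a ≤ -b/2, which makes ν a + b ≤ b/2 < 0.
    have h1 := hm (-b / (2 * (|a| + 1))) (div_pos (by linarith) (by positivity))
    have h2 : -b / (2 * (|a| + 1)) * a ≤ -b / (2 * (|a| + 1)) * (|a| + 1) :=
      mul_le_mul_of_nonneg_left (by linarith [le_abs_self a])
        (div_nonneg (by linarith) (by positivity))
    have h3 : -b / (2 * (|a| + 1)) * (|a| + 1) = -b / 2 := by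
      have : |a| + 1 ≠ 0 := by positivity
      field_simp
    linarith

namespace TransverseSymmetries

variable {n d h : ℕ} {M : Type*} [TopologicalSpace M] [ChartedSpace (EuclideanSpace ℝ (Fin n)) M]
  [IsManifold (𝓡 n) ∞ M] [T2Space M] [ConnectedSpace M] {S : TransverseSymmetries n d M h}
  {U : Set M} (hU : IsOpen U) {x : M} (hF : IsOrthonormalFrameOn S.Hor S.g (S.frame x) U)

theorem ricciForm_apply (hx : x ∈ U) {f : M → ℝ} {F : smoothAlg n U} (hf : Set.EqOn f F U) :
    S.ricciForm f x = smoothAlg.eval U x ((S.calculus hU hF).ricci F) :=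
  ricciForm_eq hU hx hF hf

theorem torsionForm_apply (hx : x ∈ U) {f : M → ℝ} {F : smoothAlg n U} (hf : Set.EqOn f F U) :
    S.torsionForm f x
      = ∑ i, ∑ m, smoothAlg.eval U x ((S.calculus hU hF).tor F i m) ^ 2 := by
  rw [torsionForm_eq hU hx hF hf, ← smoothAlg.eval_apply]
  simp only [map_sum, map_pow, FrameCalculus.tor]

end TransverseSymmetries

end

theorem theoremP {n d h : ℕ} {M : Type*} [TopologicalSpace M]
    [ChartedSpace (EuclideanSpace ℝ (Fin n)) M] [IsManifold (𝓡 n) ∞ M]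
    [T2Space M] [SecondCountableTopology M] [ConnectedSpace M]
    (S : TransverseSymmetries n d M h)
    (ρ₁ ρ₂ κ : ℝ) (hρ₂ : 0 < ρ₂) (hκ : 0 ≤ κ) :
    GeneralizedCD n S.subLaplacian S.ΓZ ρ₁ ρ₂ κ (d : ℝ≥0∞) ↔
      ∀ f : M → ℝ, SmoothFun n f → ∀ x : M,
        S.ricciForm f x ≥ ρ₁ * S.Γ f f x + ρ₂ * S.ΓZ f f x ∧
        S.torsionForm f x ≤ κ * S.Γ f f x := by
  constructor
  · intro hCD f hf x
    obtain ⟨U, hU, hx, hX⟩ := (S.exists_frame x).choose_spec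
    change IsOrthonormalFrameOn S.Hor S.g (S.frame x) U at hX
    let F : smoothAlg n U := ⟨f, hf.contMDiffOn⟩
    have hfF : Set.EqOn f F U := fun _ _ => rfl
    set C := S.calculus hU hX with hC
    set ev := smoothAlg.eval (n := n) U x with hev
    suffices hs : ∀ ν : ℝ, 0 < ν →
        0 ≤ (S.ricciForm f x - ρ₁ * S.Γ f f x - ρ₂ * S.ΓZ f f x)
          + (κ * S.Γ f f x - S.torsionForm f x) / ν by
      obtain ⟨h1, h2⟩ := nonneg_of_forall_pos_add_div hs
      exact ⟨by linarith, by linarith⟩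
    intro ν hν
    -- The second jet of the correction p: it cancels the symmetric Hessian of f and moves X_i Z_m f
    -- to -c_im/ν, the minimiser in `neg_sum_sq_div_le`. The vertical-vertical block does not enter
    -- any of the forms and is set to 0.
    let Q : Fin d ⊕ Fin h → Fin d ⊕ Fin h → ℝ :=
      Sum.elim (fun i => Sum.elim (fun j => -ev (C.symHess F i j))
          (fun m => -ev (C.tor F i m) / ν - ev (C.X i (C.Z m F))))
        (fun m => Sum.elim (fun i => -ev (C.tor F i m) / ν - ev (C.X i (C.Z m F))) fun _ => 0)
    have hQ : ∀ a b, Q a b = Q b a := by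
      rintro (i | m) (j | l)
      · simp [Q, C.symHess_swap F i j]
      all_goals rfl
    obtain ⟨p, hps, hpX, hpZ, hpXX, hpXZ⟩ := TransverseSymmetries.exists_second_jet hU hX hx Q hQ
    have hg : SmoothFun n ((F + p : smoothAlg n U) : M → ℝ) := ContMDiff.add hf hps
    have hgF : Set.EqOn ((F + p : smoothAlg n U) : M → ℝ) (F + p : smoothAlg n U) U :=
      fun _ _ => rfl
    have hX' : ∀ i, ev (C.X i (F + p)) = ev (C.X i F) := fun i => by
      rw [map_add, map_add, hpX, add_zero]
    have hZ' : ∀ m, ev (C.Z m (F + p)) = ev (C.Z m F) := fun m => by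
      rw [map_add, map_add, hpZ, add_zero]
    have hH' : ∀ i j, ev (C.symHess (F + p) i j) = 0 := fun i j => by
      rw [C.eval_symHess_add ev F p hpX hpZ, hpXX]
      simp [Q]
    have hXZ' : ∀ i m, ev (C.X i (C.Z m (F + p))) = -ev (C.tor F i m) / ν := fun i m => by
      rw [map_add, map_add, map_add, hpXZ]
      simp [Q]
    have key := hCD _ hg ν hν x
    rw [TransverseSymmetries.iteratedForm_carreDuChamp_apply hU hX hx hgF,
      TransverseSymmetries.iteratedForm_ΓZ_apply hU hX hx hgF,
      TransverseSymmetries.subLaplacian_apply hU hX hx hgF,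
      TransverseSymmetries.carreDuChamp_apply hU hX hx hgF,
      TransverseSymmetries.ΓZ_apply hU hX hx hgF] at key
    -- The correction p leaves all first-order quantities of f unchanged, including 𝓡 and 𝓣, so the
    -- inequality for f + p becomes one about f.
    simp only [← hC, ← hev, hX', hZ', hH', hXZ', C.eval_ricci_congr ev hX' hZ',
      C.eval_tor_congr ev hX'] at key
    rw [TransverseSymmetries.ricciForm_apply hU hX hx hfF,
      TransverseSymmetries.torsionForm_apply hU hX hx hfF,
      TransverseSymmetries.ΓZ_apply hU hX hx hfF, TransverseSymmetries.Γ,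
      TransverseSymmetries.carreDuChamp_apply hU hX hx hfF]
    have e1 : ∑ i, ∑ m, ev (C.tor F i m) * (-ev (C.tor F i m) / ν)
        = -((∑ i, ∑ m, ev (C.tor F i m) ^ 2) / ν) := by
      simp only [Finset.sum_div, ← Finset.sum_neg_distrib]
      exact Finset.sum_congr rfl fun i _ => Finset.sum_congr rfl fun m _ => by ring
    have e2 : ν * ∑ i, ∑ m, (-ev (C.tor F i m) / ν) ^ 2
        = (∑ i, ∑ m, ev (C.tor F i m) ^ 2) / ν := by
      simp only [Finset.sum_div, Finset.mul_sum]
      exact Finset.sum_congr rfl fun i _ => Finset.sum_congr rfl fun m _ => by field_simp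
    rw [e1, e2] at key
    simp only [ne_eq, OfNat.ofNat_ne_zero, not_false_eq_true, zero_pow, Finset.sum_const_zero,
      mul_zero, add_zero, zero_add] at key
    rw [← hC, ← hev, sub_div, mul_div_right_comm]
    linarith
  · intro hR f hf ν hν x
    obtain ⟨U, hU, hx, hX⟩ := (S.exists_frame x).choose_spec
    change IsOrthonormalFrameOn S.Hor S.g (S.frame x) U at hX
    let F : smoothAlg n U := ⟨f, hf.contMDiffOn⟩
    have hfF : Set.EqOn f F U := fun _ _ => rfl
    obtain ⟨h1, h2⟩ := hR f hf x
    rw [TransverseSymmetries.ricciForm_apply hU hX hx hfF] at h1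
    rw [TransverseSymmetries.torsionForm_apply hU hX hx hfF] at h2
    rw [TransverseSymmetries.iteratedForm_carreDuChamp_apply hU hX hx hfF,
      TransverseSymmetries.iteratedForm_ΓZ_apply hU hX hx hfF,
      TransverseSymmetries.subLaplacian_apply hU hX hx hfF]
    change _ ≥ _ + (ρ₁ - κ / ν) * S.Γ f f x + _
    -- The Hessian term dominates (Lf)²/d, the terms in X_i Z_m f are at least -𝓣(f)/ν, and 𝓣(f)/ν ≤
    -- (κ/ν) Γ(f).
    have h3 := inv_card_mul_sq_trace_le fun i j =>
      smoothAlg.eval U x ((S.calculus hU hX).symHess F i j)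
    have h4 := neg_sum_sq_div_le (fun i m => smoothAlg.eval U x ((S.calculus hU hX).tor F i m))
      (fun i m => smoothAlg.eval U x ((S.calculus hU hX).X i ((S.calculus hU hX).Z m F))) hν
    have h5 := div_le_div_of_nonneg_right h2 hν.le
    rw [mul_div_right_comm] at h5
    linarith
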